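/- Let $p$ be an odd prime, let $k=\overline{\mathbb F}_p$ and let $h\ge 0$. Let $R(X)=\sum_{i=0}^h a_iX^{p^i}$ be an additive polynomial with coefficients in a finite field $\mathbb F_{p^r}\subset k$ and $a_h\neq 0$, and let $C_R$ be the smooth projective curve with affine equation $Y^p-Y=XR(X)$; it has a unique point $\infty$ at infinity. Put $E(X)=R(X)^{p^h}+\sum_{i=0}^h(a_iX)^{p^{h-i}}$, let $W\subset k$ be the set of zeros of $E$, which is an $\mathbb F_p$-vector space, and let $\mathbb F_q=\mathbb F_{p^r}(W)$ be the splitting field of $E$ over $\mathbb F_{p^r}$. For $c\in W$ let $B_c\in Xk[X]$ be the unique polynomial without constant term satisfying $B_c(X)^p-B_c(X)=cR(X)+R(c)X$. Let $P$ be the (unique) Sylow $p$-subgroup of the group $\operatorname{Aut}^0(C_R)$ of $k$-automorphisms of $C_R$ that fix $\infty$. Its elements are the automorphisms $\sigma_{b,c}\colon(x,y)\mapsto(x+c,\,y+b+B_c(x))$ with $c\in W$ and $b^p-b=cR(c)$, and $\sigma_{b,c}\mapsto c$ defines a homomorphism $P\to W$. Let $\mathcal A$ be a maximal abelian subgroup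 of $P$ and let $\overline A\subset W$ be its image under $P\to W$, which is a maximal isotropic subspace of $W$ for the pairing $\epsilon(c_1,c_2)=B_{c_1}(c_2)-B_{c_2}(c_1)$. Let $A\subset\mathcal A$ be any subgroup of order $p^h$ that intersects the center $Z(P)$ trivially. Then the elements of $A$ are defined over $\mathbb F_q$, the constant $a_{\mathcal A}$ below lies in $\mathbb F_q$, and the quotient curve $C_R/A$ (over $\mathbb F_q$, i.e. with function field $\mathbb F_q(C_R)^A$) is isomorphic over $\mathbb F_q$ to the smooth projective curve with affine equation $$Y^p-Y=a_{\mathcal A}X^2 .$$ Here $$a_{\mathcal A}=\frac{a_h}{2}\prod_{c\in\overline A\setminus\{0\}}c\quad\text{if }h\ge 1,\qquad a_{\mathcal A}=a_0\quad\text{if }h=0.$$ -/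

import Mathlib

open Polynomial
open scoped Pointwise

/-! ### Artin-Schreier function fields -/

/-- The Artin-Schreier polynomial `Y ^ p - Y - f(X)` in the variable `Y`, over the rational function
field `K(X)`. -/
noncomputable abbrev artinSchreierPoly (p : ℕ) {K : Type*} [Field K] (f : K[X]) : (RatFunc K)[X] :=
  X ^ p - X - C (algebraMap K[X] (RatFunc K) f)

/-- The function field `K(X)[Y] / (Y ^ p - Y - f(X))`, over `K`, of the smooth projective curve with
affine equation `Y ^ p - Y = f(X)`. -/
abbrev ArtinSchreierField (p : ℕ) {K : Type*} [Field K] (f : K[X]) : Type _ :=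
  AdjoinRoot (artinSchreierPoly p f)

/-- Over a field of characteristic `p`, the polynomial `Y ^ p - Y - a` is irreducible as soon as it
has no root. -/
theorem irreducible_X_pow_sub_X_sub_C {p : ℕ} [hp : Fact p.Prime] {L : Type*} [Field L] [CharP L p]
    {a : L} (ha : ∀ r : L, r ^ p - r ≠ a) : Irreducible (X ^ p - X - C a : L[X]) := by
  have hp1 : 1 < p := hp.out.one_lt
  set P : L[X] := X ^ p - X - C a with hP
  have hPeq : P = X ^ p - (X + C a) := by rw [hP]; ring
  have hdegsmall : (X + C a : L[X]).degree < (p : ℕ) := by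
    rw [degree_X_add_C]; exact_mod_cast hp1
  have hmon : P.Monic := by rw [hPeq]; exact monic_X_pow_sub (n := p) (by
    rw [degree_X_add_C]; exact_mod_cast hp1)
  have hdeg : P.natDegree = p := by
    rw [hPeq]
    apply natDegree_eq_of_degree_eq_some
    rw [degree_sub_eq_left_of_degree_lt (by rw [degree_X_pow]; exact hdegsmall), degree_X_pow]
  have hP1 : P ≠ 1 := by
    intro h; rw [h, natDegree_one] at hdeg; omega
  rw [hmon.irreducible_iff_natDegree' ]
  refine ⟨hP1, ?_⟩
  intro f g hf hg hfg hmem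
  rw [Finset.mem_Ioc, hdeg] at hmem
  obtain ⟨hg0, hg1⟩ := hmem
  have hgp : g.natDegree < p := lt_of_le_of_lt hg1 (Nat.div_lt_self (by omega) (by norm_num))
  -- pass to a splitting field of `P`
  let M := SplittingField P
  have : CharP M p := charP_of_injective_algebraMap (algebraMap L M).injective p
  have hsplit : (P.map (algebraMap L M)).Splits := SplittingField.splits P
  have hP0 : P.map (algebraMap L M) ≠ 0 := (hmon.map _).ne_zero
  have hgdvd : g.map (algebraMap L M) ∣ P.map (algebraMap L M) :=
    Polynomial.map_dvd _ ⟨f, by rw [← hfg]; ring⟩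
  have hgsplit : (g.map (algebraMap L M)).Splits := hsplit.of_dvd hP0 hgdvd
  have hroot : ∀ α ∈ (g.map (algebraMap L M)).roots, α ^ p - α = algebraMap L M a := by
    intro α hα
    have h1 := (mem_roots'.1 hα).2.dvd hgdvd
    simp only [IsRoot.def, hP, Polynomial.map_sub, Polynomial.map_pow, map_X, map_C, eval_sub,
      eval_pow, eval_X, eval_C] at h1
    exact sub_eq_zero.1 h1
  have hcard : Multiset.card (g.map (algebraMap L M)).roots = g.natDegree := by
    rw [← hgsplit.natDegree_eq_card_roots, natDegree_map]
  -- the sum of the roots of `g` lies in `L` and solves `s ^ p - s = d a`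
  have hsum : ∀ s : Multiset M, (∀ α ∈ s, α ^ p - α = algebraMap L M a) →
      s.sum ^ p - s.sum = (Multiset.card s : M) * algebraMap L M a := by
    intro s
    induction s using Multiset.induction_on with
    | empty => intro _; simp [hp.out.ne_zero]
    | cons b t ih =>
      intro hs
      have h1 := hs b (Multiset.mem_cons_self b t)
      have h2 := ih fun α hα => hs α (Multiset.mem_cons_of_mem hα)
      rw [Multiset.sum_cons, add_pow_char, Multiset.card_cons]
      push_cast
      linear_combination h1 + h2
  have hs := hsum _ hroot
  rw [hcard] at hs
  have hnext : algebraMap L M (-g.nextCoeff) = (g.map (algebraMap L M)).roots.sum := by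
    rw [map_neg, ← nextCoeff_map (algebraMap L M).injective,
      hgsplit.nextCoeff_eq_neg_sum_roots_of_monic (hg.map _), neg_neg]
  rw [← hnext] at hs
  have hs' : (-g.nextCoeff) ^ p - (-g.nextCoeff) = (g.natDegree : L) * a := by
    apply (algebraMap L M).injective
    rw [map_sub, map_pow, hs, map_mul, map_natCast]
  have hd : (g.natDegree : L) ≠ 0 := by
    intro h
    exact absurd (Nat.le_of_dvd hg0 ((CharP.cast_eq_zero_iff L p _).1 h)) (by omega)
  have hdp : (g.natDegree : L) ^ p = g.natDegree := by
    have := map_natCast (frobenius L p) g.natDegree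
    rwa [frobenius_def] at this
  apply ha (-g.nextCoeff / g.natDegree)
  rw [div_pow, hdp, ← sub_div, hs']
  field_simp

/-- If the degree of `f` is prime to the characteristic `p`, then `Y ^ p - Y - f(X)` is irreducible
over `K(X)`. -/
theorem irreducible_artinSchreierPoly {p : ℕ} [hp : Fact p.Prime] {K : Type*} [Field K] [CharP K p]
    {f : K[X]} (hf : ¬ p ∣ f.natDegree) : Irreducible (artinSchreierPoly p f) := by
  have : CharP (RatFunc K) p :=
    charP_of_injective_algebraMap (algebraMap K (RatFunc K)).injective p
  apply irreducible_X_pow_sub_X_sub_C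
  intro r hr
  have hmon : (X ^ p - (X + C f) : K[X][X]).Monic := monic_X_pow_sub (by
    rw [degree_X_add_C]; exact_mod_cast hp.out.one_lt)
  obtain ⟨g, hg⟩ := isInteger_of_is_root_of_monic (K := RatFunc K) hmon (r := r) (by
    simp only [map_sub, map_pow, map_add, aeval_X, aeval_C]
    linear_combination hr)
  have hgf : g ^ p - g = f := by
    apply IsFractionRing.injective K[X] (RatFunc K)
    rw [map_sub, map_pow, hg, hr]
  apply hf
  rcases Nat.eq_zero_or_pos g.natDegree with h0 | h0
  · have : f.natDegree ≤ 0 := by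
      rw [← hgf]
      refine (natDegree_sub_le _ _).trans ?_
      rw [natDegree_pow, h0]
      simp
    rw [Nat.le_zero.1 this]
    exact dvd_zero p
  · rw [← hgf, natDegree_sub_eq_left_of_natDegree_lt, natDegree_pow]
    · exact dvd_mul_right _ _
    · rw [natDegree_pow]
      exact lt_mul_left h0 hp.out.one_lt

/-! ### The curve `C_R` -/

/-- An additive polynomial `R(X) = ∑_{i=0}^h a_i X ^ (p ^ i)` over `F` of degree `p ^ h`, given by
its coefficients `a_0, …, a_h` with `a_h ≠ 0`. -/
structure AdditivePolynomial (p h : ℕ) (F : Type*) [Field F] where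
  /-- The coefficients `a_0, …, a_h`. -/
  coeff : Fin (h + 1) → F
  coeff_last_ne_zero : coeff (Fin.last h) ≠ 0

namespace AdditivePolynomial

/-- The polynomial `R(X) = ∑_{i=0}^h a_i X ^ (p ^ i)`. -/
noncomputable def toPoly {p h : ℕ} {F : Type*} [Field F] (R : AdditivePolynomial p h F) : F[X] :=
  ∑ i : Fin (h + 1), C (R.coeff i) * X ^ p ^ (i : ℕ)

/-- The leading coefficient `a_h` of `R`. -/
def lead {p h : ℕ} {F : Type*} [Field F] (R : AdditivePolynomial p h F) : F :=
  R.coeff (Fin.last h)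

/-- The polynomial `E(X) = R(X) ^ (p ^ h) + ∑_{i=0}^h (a_i X) ^ (p ^ (h - i))`. -/
noncomputable def E {p h : ℕ} {F : Type*} [Field F] (R : AdditivePolynomial p h F) : F[X] :=
  R.toPoly ^ p ^ h + ∑ i : Fin (h + 1), (C (R.coeff i) * X) ^ p ^ (h - (i : ℕ))

/-- The zero locus `W` of `E` in `k`. -/
def W {p h : ℕ} {F : Type*} [Field F] (R : AdditivePolynomial p h F)
    (k : Type*) [Field k] [Algebra F k] : Set k :=
  {c : k | aeval c R.E = 0}

/-- The splitting field `𝔽_q = F(W)` of `E` inside the extension `k` of the coefficient field. -/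
abbrev Fq {p h : ℕ} {F : Type*} [Field F] (R : AdditivePolynomial p h F)
    (k : Type*) [Field k] [Algebra F k] : IntermediateField F k :=
  IntermediateField.adjoin F (R.W k)

/-- The polynomial `X R(X)`, over an extension `K` of the coefficient field. -/
noncomputable abbrev rhs {p h : ℕ} {F : Type*} [Field F] (R : AdditivePolynomial p h F)
    (K : Type*) [Field K] [Algebra F K] : K[X] :=
  X * R.toPoly.map (algebraMap F K)

/-- The function field `K(C_R)` of the curve `C_R : Y ^ p - Y = X R(X)`, over an extension `K` of
the coefficient field. -/
abbrev FunctionField {p h : ℕ} {F : Type*} [Field F] (R : AdditivePolynomial p h F)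
    (K : Type*) [Field K] [Algebra F K] : Type _ :=
  ArtinSchreierField p (R.rhs K)

theorem natDegree_toPoly {p h : ℕ} [hp : Fact p.Prime] {F : Type*} [Field F]
    (R : AdditivePolynomial p h F) : R.toPoly.natDegree = p ^ h := by
  unfold toPoly
  rw [Fin.sum_univ_castSucc]
  have h1 : (C (R.coeff (Fin.last h)) * X ^ p ^ ((Fin.last h : Fin (h + 1)) : ℕ)).natDegree
      = p ^ h := by
    rw [natDegree_C_mul_X_pow _ _ R.coeff_last_ne_zero, Fin.val_last]
  have hpos : 0 < p ^ h := pow_pos hp.out.pos h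
  rw [natDegree_add_eq_right_of_natDegree_lt, h1]
  rw [h1]
  refine lt_of_le_of_lt (natDegree_sum_le_of_forall_le (n := p ^ h - 1) _ _ ?_) (by omega)
  intro i _
  refine (natDegree_C_mul_X_pow_le _ _).trans ?_
  have : p ^ (i : ℕ) < p ^ h := Nat.pow_lt_pow_right hp.out.one_lt i.2
  simp only [Fin.val_castSucc]
  omega

/-- For odd `p`, the equation of `C_R` is irreducible, so that `K(C_R)` is a field. -/
instance {p h : ℕ} [hp : Fact p.Prime] [hp2 : Fact (p ≠ 2)] {F : Type*} [Field F] [CharP F p]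
    (R : AdditivePolynomial p h F) (K : Type*) [Field K] [Algebra F K] :
    Fact (Irreducible (artinSchreierPoly p (R.rhs K))) := by
  have : CharP K p := charP_of_injective_algebraMap (algebraMap F K).injective p
  refine ⟨irreducible_artinSchreierPoly ?_⟩
  have hne : R.toPoly.map (algebraMap F K) ≠ 0 := by
    rw [Ne, Polynomial.map_eq_zero]
    intro h0
    have := R.natDegree_toPoly
    rw [h0, natDegree_zero] at this
    exact absurd this.symm (pow_pos hp.out.pos h).ne'
  rw [rhs, natDegree_X_mul hne, natDegree_map, natDegree_toPoly]
  rcases Nat.eq_zero_or_pos h with rfl | hh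
  · intro hd
    exact hp2.out ((Nat.prime_dvd_prime_iff_eq hp.out Nat.prime_two).1 (by simpa using hd))
  · intro hd
    exact hp.out.one_lt.ne' (Nat.dvd_one.1 ((Nat.dvd_add_right (dvd_pow_self p hh.ne')).1 hd))

/-- The coordinate function `x` on `C_R`. -/
noncomputable def x {p h : ℕ} {F : Type*} [Field F] (R : AdditivePolynomial p h F)
    (K : Type*) [Field K] [Algebra F K] : R.FunctionField K :=
  AdjoinRoot.of _ RatFunc.X

/-- The coordinate function `y` on `C_R`. -/
noncomputable def y {p h : ℕ} {F : Type*} [Field F] (R : AdditivePolynomial p h F)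
    (K : Type*) [Field K] [Algebra F K] : R.FunctionField K :=
  AdjoinRoot.root _

/-! ### The symplectic pairing on `W` -/

/-- `B` is the polynomial `B_c`, i.e. the solution without constant term of
`B ^ p - B = c R(X) + R(c) X`. -/
def IsB {p h : ℕ} {F : Type*} [Field F] (R : AdditivePolynomial p h F)
    {k : Type*} [Field k] [Algebra F k] (c : k) (B : k[X]) : Prop :=
  B.coeff 0 = 0 ∧
    B ^ p - B = C c * R.toPoly.map (algebraMap F k) + C (aeval c R.toPoly) * X

/-- An additive subgroup (that is, an `𝔽_p`-subspace) `V` of `W` is isotropic if the pairing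
`ε(c₁, c₂) = B_{c₁}(c₂) - B_{c₂}(c₁)` vanishes on `V`. -/
def IsIsotropic {p h : ℕ} {F : Type*} [Field F] (R : AdditivePolynomial p h F)
    {k : Type*} [Field k] [Algebra F k] (V : AddSubgroup k) : Prop :=
  (V : Set k) ⊆ R.W k ∧ ∀ c₁ ∈ V, ∀ c₂ ∈ V, ∃ B₁ B₂ : k[X],
    R.IsB c₁ B₁ ∧ R.IsB c₂ B₂ ∧ B₁.eval c₂ - B₂.eval c₁ = 0

/-! ### Automorphisms of `C_R` -/

/-- The points at infinity of the smooth projective curve `C_R` over `k`, as places of the function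
field: the valuation rings of `k(C_R) / k` at which `x` or `y` has a pole. (There is exactly one
of them, the point `∞`.) -/
def placesAtInfinity {p h : ℕ} [Fact p.Prime] [Fact (p ≠ 2)] {F : Type*} [Field F] [CharP F p]
    (R : AdditivePolynomial p h F) (k : Type*) [Field k] [Algebra F k] :
    Set (ValuationSubring (R.FunctionField k)) :=
  {V | (∀ c : k, algebraMap k (R.FunctionField k) c ∈ V) ∧ ¬ (R.x k ∈ V ∧ R.y k ∈ V)}

/-- The group `Aut⁰(C_R)` of the `k`-automorphisms of `C_R` that fix the point `∞`, as a group of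
automorphisms of the function field. -/
noncomputable def aut0 {p h : ℕ} [Fact p.Prime] [Fact (p ≠ 2)] {F : Type*} [Field F] [CharP F p]
    (R : AdditivePolynomial p h F) (k : Type*) [Field k] [Algebra F k] :
    Subgroup (R.FunctionField k ≃ₐ[k] R.FunctionField k) :=
  ⨅ V ∈ R.placesAtInfinity k, MulAction.stabilizer (R.FunctionField k ≃ₐ[k] R.FunctionField k) V

/-- The image `Ā ⊆ k` of a subgroup `𝒜` of `P` under the map `P → W` that sends the automorphism
`(x, y) ↦ (x + c, y + b + B_c(x))` to `c`. -/
def translations {p h : ℕ} [Fact p.Prime] [Fact (p ≠ 2)] {F : Type*} [Field F] [CharP F p]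
    {R : AdditivePolynomial p h F} {k : Type*} [Field k] [Algebra F k]
    {P : Sylow p (R.aut0 k)} (𝒜 : Subgroup P) : Set k :=
  {c : k | ∃ σ ∈ 𝒜, ((σ : R.aut0 k) : R.FunctionField k ≃ₐ[k] R.FunctionField k) (R.x k)
    = R.x k + algebraMap k (R.FunctionField k) c}

/-- The constant `a_𝒜 = (a_h / 2) ∏_{c ∈ Ā \ {0}} c` for `h ≥ 1`, and `a_𝒜 = a_0` for `h = 0`. -/
noncomputable def aConst {p h : ℕ} [Fact p.Prime] [Fact (p ≠ 2)] {F : Type*} [Field F] [CharP F p]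
    {R : AdditivePolynomial p h F} {k : Type*} [Field k] [Algebra F k]
    {P : Sylow p (R.aut0 k)} (𝒜 : Subgroup P) : k :=
  if h = 0 then algebraMap F k (R.coeff 0)
  else algebraMap F k R.lead / 2 * ∏ᶠ c ∈ translations 𝒜 \ {0}, c

/-! ### Quotient curves over `𝔽_q` -/

/-- The function field `𝔽_q(C_R) = 𝔽_q(x, y)` of `C_R` as a curve over `𝔽_q`, inside `k(C_R)`. -/
noncomputable def fieldOverFq {p h : ℕ} [Fact p.Prime] [Fact (p ≠ 2)] {F : Type*} [Field F]
    [CharP F p] (R : AdditivePolynomial p h F) (k : Type*) [Field k] [Algebra F k] :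
    IntermediateField (R.Fq k) (R.FunctionField k) :=
  IntermediateField.adjoin (R.Fq k) {R.x k, R.y k}

/-- The function field of the quotient curve `C_R / A` over `𝔽_q`: the functions in `𝔽_q(C_R)`
that are invariant under every element of `A`. -/
noncomputable def quotientField {p h : ℕ} [Fact p.Prime] [Fact (p ≠ 2)] {F : Type*} [Field F]
    [CharP F p] {R : AdditivePolynomial p h F} {k : Type*} [Field k] [Algebra F k]
    {P : Sylow p (R.aut0 k)} (A : Subgroup P) :
    IntermediateField (R.Fq k) (R.FunctionField k) :=
  R.fieldOverFq k ⊓ (IntermediateField.fixedField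
    ((A.map P.toSubgroup.subtype).map (R.aut0 k).subtype)).restrictScalars (R.Fq k)

end AdditivePolynomial

/-!
The elements of `P` are the automorphisms `σ_{b,c}`. An automorphism that fixes the place at
infinity preserves the ring `k[x, y]` of functions regular elsewhere and the pole orders at
infinity. Hence it is of the form `(x, y) ↦ (α x + c, γ y + B(x))`, and if its order is a power of
`p`, then `α = γ = 1` (`exists_isTranslation_of_mem_aut0`). The place at infinity is unique,
because pole orders can be read off from the coefficients with respect to `1, y, …, y ^ (p - 1)`.
Thus all `σ_{b,c}` fix it, and they form a `p`-group, which is `P` (`sylow_eq_translationGroup`).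
The polynomial `B_c` exists exactly if `E(c) = 0`; it has coefficients in `𝔽_q`, and so does `b`,
as `b - B_c(c) / 2` lies in the prime field. Two automorphisms commute exactly if the pairing `ε`
of their images in `W` vanishes, so maximal abelian subgroups correspond to maximal isotropic
subspaces.

Let `V` be the image of `A` in `W`, a group of order `p ^ h`, and let `π(x) = ∏_{c ∈ V} (x - c)`,
an additive polynomial with constant derivative `e = ∏_{c ≠ 0} c`. By the additive Hilbert 90 for
the translations by `V` there is an `A`-invariant function `Y = y + Q(x)`. Then `Y ^ p - Y = x
R(x) + Q ^ p - Q` is a `V`-invariant polynomial, that is, a polynomial `g(π)`, and `g` may be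
taken reduced modulo `r ^ p - r`. Comparing degrees in this equation and in its derivative shows
that `g` is quadratic with leading coefficient `a = a_h / (2 e)`; completing the square, `Y ^ p -
Y = a (π + s) ^ 2 - a s ^ 2` (`exists_quotient_equation`). The constant `a s ^ 2` can be removed
over `𝔽_q`: by a parity argument the point `x₀` with `π(x₀) = -s` is a zero of `E`, so it lies in
`𝔽_q`, and `-a s ^ 2 = η ^ p - η` with `η = B_{x₀}(x₀) / 2 + Q(x₀)` (`exists_pow_sub_eq_neg`).

An element `σ` of `𝒜` commutes with `A`, so `σ(Y) - Y` is an `A`-invariant polynomial in `x`; its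
equation forces it to be constant and `π` to vanish at the image of `σ` in `W`. Hence `𝒜` and `A`
have the same image (`translations_eq_of_le`), and `e` is the product in `a_𝒜`. Finally, with `X =
(π(x) + s) / e` the equation becomes `(Y - η) ^ p - (Y - η) = a e ^ 2 X ^ 2`, where `a e ^ 2 =
a_𝒜`, and `𝔽_q(X, Y)` is the whole field of invariants: an invariant in `𝔽_q(X, Y)(x)` is a
polynomial of degree less than `p ^ h` in `x` over `𝔽_q(X, Y)` with the same value at all `x + c`,
and so it is constant (`IntermediateField.mem_of_forall_apply_eq`).
-/

/-! ### Polynomials over a field of characteristic `p` -/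

section ArtinSchreierOperator

variable {p : ℕ} [hp : Fact p.Prime] {K : Type*} [Field K]

theorem eq_C_of_pow_sub_self_natDegree_lt {D g : K[X]} (hD : D ^ p - D = g)
    (hg : g.natDegree < p) : D = C (D.coeff 0) := by
  apply eq_C_of_natDegree_eq_zero
  by_contra h0
  have h0 := Nat.pos_of_ne_zero h0
  have h1 : D.natDegree < (D ^ p).natDegree := by
    rw [natDegree_pow]; exact lt_mul_left h0 hp.out.one_lt
  have h2 := natDegree_sub_eq_left_of_natDegree_lt h1
  rw [hD, natDegree_pow] at h2
  have := Nat.le_mul_of_pos_right p h0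
  omega

theorem eq_zero_of_pow_eq_self {D : K[X]} (hD : D ^ p = D) (h0 : D.coeff 0 = 0) : D = 0 := by
  rw [eq_C_of_pow_sub_self_natDegree_lt (g := 0) (sub_eq_zero.2 hD) (by simpa using hp.out.pos),
    h0, C_0]

variable (p) in
theorem exists_pow_sub_eq [IsAlgClosed K] (u : K) : ∃ b : K, b ^ p - b = u := by
  obtain ⟨b, hb⟩ := IsAlgClosed.exists_root (X ^ p - (X + C u) : K[X]) (by
    rw [degree_sub_eq_left_of_degree_lt] <;> rw [degree_X_pow]
    · exact_mod_cast hp.out.ne_zero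
    · rw [degree_X_add_C]; exact_mod_cast hp.out.one_lt)
  refine ⟨b, ?_⟩
  simp only [IsRoot.def, eval_sub, eval_pow, eval_X, eval_add, eval_C] at hb
  linear_combination hb

variable [CharP K p]

/-- Every polynomial over a perfect field is congruent, modulo polynomials `r ^ p - r`, to a
constant or to a polynomial of degree prime to `p`. -/
theorem exists_reduced [PerfectField K] (g : K[X]) :
    ∃ r : K[X], (g - (r ^ p - r)).natDegree = 0 ∨ ¬ p ∣ (g - (r ^ p - r)).natDegree := by
  induction hn : g.natDegree using Nat.strong_induction_on generalizing g with
  | _ n ih =>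
  by_cases h0 : n = 0
  · exact ⟨0, Or.inl (by simp [hp.out.ne_zero, hn, h0])⟩
  by_cases hdvd : p ∣ n
  · obtain ⟨m, rfl⟩ := hdvd
    have hm : 0 < m := Nat.pos_of_ne_zero fun h => h0 (by rw [h, mul_zero])
    have hexp : ExpChar K p := ExpChar.prime hp.out
    obtain ⟨w, hw⟩ := (PerfectRing.bijective_frobenius (R := K) (p := p)).2 g.leadingCoeff
    change w ^ p = _ at hw
    have hg0 : g ≠ 0 := by rintro rfl; exact h0 (by simpa using hn.symm)
    have hw0 : w ≠ 0 := by
      rintro rfl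
      rw [zero_pow hp.out.ne_zero] at hw
      exact hg0 (leadingCoeff_eq_zero.1 hw.symm)
    set u : K[X] := C w * X ^ m with hu
    have hup : u ^ p = C g.leadingCoeff * X ^ (p * m) := by
      rw [hu, mul_pow, ← C_pow, hw, ← pow_mul, mul_comm m p]
    have hlt : (g - (u ^ p - u)).natDegree < p * m := by
      have h1 : (g - u ^ p).natDegree < p * m := by
        rw [hup, ← hn]
        have h3 : (g - C g.leadingCoeff * X ^ g.natDegree) = g.eraseLead := by
          rw [← self_sub_C_mul_X_pow]
        rw [h3]
        exact lt_of_le_of_lt g.eraseLead_natDegree_le (by omega)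
      have h2 : u.natDegree < p * m := by
        rw [hu, natDegree_C_mul_X_pow _ _ hw0]
        exact lt_mul_left hm hp.out.one_lt
      rw [sub_sub_eq_add_sub, add_sub_right_comm]
      exact lt_of_le_of_lt (natDegree_add_le _ _) (max_lt h1 h2)
    obtain ⟨r, hr⟩ := ih _ hlt _ rfl
    refine ⟨r + u, ?_⟩
    have : g - ((r + u) ^ p - (r + u)) = g - (u ^ p - u) - (r ^ p - r) := by
      rw [add_pow_char]; ring
    rwa [this]
  · exact ⟨0, Or.inr (by simpa [hp.out.ne_zero, hn] using hdvd)⟩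

end ArtinSchreierOperator

/-! ### The polynomial with a given finite additive group of zeros -/

namespace AddSubgroup

variable {K : Type*} [Field K] (V : AddSubgroup K) [Fintype V]

/-- The polynomial `π_V = ∏_{c ∈ V} (X - c)`. -/
noncomputable def vanishingPoly : K[X] := ∏ c : V, (X - C (c : K))

theorem monic_vanishingPoly : V.vanishingPoly.Monic := 
  monic_prod_of_monic _ _ fun _ _ => monic_X_sub_C _

theorem natDegree_vanishingPoly : V.vanishingPoly.natDegree = Fintype.card V := by
  unfold vanishingPoly
  rw [natDegree_prod_of_monic _ _ fun _ _ => monic_X_sub_C _]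
  simp

theorem eval_vanishingPoly_eq_zero_iff {t : K} : V.vanishingPoly.eval t = 0 ↔ t ∈ V := by
  unfold vanishingPoly
  rw [eval_prod, Finset.prod_eq_zero_iff]
  constructor
  · rintro ⟨c, -, hc⟩
    simp only [eval_sub, eval_X, eval_C, sub_eq_zero] at hc
    rw [hc]; exact c.2
  · intro ht
    exact ⟨⟨t, ht⟩, Finset.mem_univ _, by simp⟩

theorem vanishingPoly_comp_of_mem (c : V) :
    V.vanishingPoly.comp (X + C (c : K)) = V.vanishingPoly := by
  unfold vanishingPoly
  rw [prod_comp]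
  refine Fintype.prod_equiv (Equiv.subRight c) _ _ fun d => ?_
  simp only [sub_comp, X_comp, C_comp, Equiv.subRight_apply, AddSubgroup.coe_sub, C_sub]
  ring

variable {V} in
theorem vanishingPoly_dvd {g : K[X]} (hg : ∀ c : V, g.eval (c : K) = 0) :
    V.vanishingPoly ∣ g := by
  refine Fintype.prod_dvd_of_coprime ?_ fun c => dvd_iff_isRoot.2 (hg c)
  exact pairwise_coprime_X_sub_C Subtype.val_injective

theorem vanishingPoly_comp (t : K) :
    V.vanishingPoly.comp (X + C t) = V.vanishingPoly + C (V.vanishingPoly.eval t) := by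
  have hcard : 0 < Fintype.card V := Fintype.card_pos
  rw [← sub_eq_zero]
  have hdvd : V.vanishingPoly ∣ V.vanishingPoly.comp (X + C t) -
      (V.vanishingPoly + C (V.vanishingPoly.eval t)) := by
    refine vanishingPoly_dvd fun c => ?_
    have := congrArg (eval t) (V.vanishingPoly_comp_of_mem c)
    simp only [eval_comp, eval_add, eval_X, eval_C] at this
    simp only [eval_sub, eval_comp, eval_add, eval_X, eval_C,
      V.eval_vanishingPoly_eq_zero_iff.2 c.2]
    rw [add_comm (c : K) t, this, zero_add, sub_self]
  have hmon : (V.vanishingPoly.comp (X + C t)).Monic := V.monic_vanishingPoly.comp_X_add_C t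
  have hnd : (V.vanishingPoly.comp (X + C t)).natDegree = V.vanishingPoly.natDegree := by
    rw [natDegree_comp, natDegree_X_add_C, mul_one]
  by_contra hne
  refine absurd (degree_le_of_dvd hdvd hne) (not_le.2 ?_)
  rw [sub_add_eq_sub_sub]
  have hpos : 0 < V.vanishingPoly.degree := by
    rw [← natDegree_pos_iff_degree_pos, natDegree_vanishingPoly]; exact hcard
  refine lt_of_le_of_lt (degree_sub_le _ _) (max_lt ?_ (lt_of_le_of_lt degree_C_le hpos))
  have := degree_sub_lt_left (p := V.vanishingPoly.comp (X + C t)) (q := V.vanishingPoly)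
    (by rw [degree_eq_natDegree hmon.ne_zero, degree_eq_natDegree V.monic_vanishingPoly.ne_zero,
      hnd])
    hmon.ne_zero (by rw [hmon.leadingCoeff, V.monic_vanishingPoly.leadingCoeff])
  rwa [degree_eq_natDegree hmon.ne_zero, hnd,
    ← degree_eq_natDegree V.monic_vanishingPoly.ne_zero] at this

/-- The coefficient of `X` in `π_V`. It is the constant derivative of the additive polynomial `π_V`
and the product of the negatives of the nonzero elements of `V`. -/
noncomputable def slope : K := V.vanishingPoly.coeff 1

theorem derivative_vanishingPoly : derivative V.vanishingPoly = C V.slope := by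
  have hroot : ∀ c : V, (derivative V.vanishingPoly - C V.slope).eval (c : K) = 0 := by
    intro c
    have := congrArg (fun g => (derivative g).eval 0) (V.vanishingPoly_comp_of_mem c)
    simp only [derivative_comp, derivative_add, derivative_X, derivative_C, add_zero, one_mul,
      eval_comp, eval_add, eval_X, eval_C, zero_add] at this
    rw [eval_sub, this, eval_C, ← coeff_zero_eq_eval_zero, coeff_derivative, slope]
    simp
  rw [← sub_eq_zero]
  by_contra hne
  have h1 := natDegree_le_of_dvd (vanishingPoly_dvd hroot) hne
  rw [natDegree_vanishingPoly] at h1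
  have h2 : (derivative V.vanishingPoly - C V.slope).natDegree ≤ Fintype.card V - 1 := by
    refine (natDegree_sub_le _ _).trans (max_le ?_ (by simp))
    exact (natDegree_derivative_le _).trans (by rw [natDegree_vanishingPoly])
  have : 0 < Fintype.card V := Fintype.card_pos
  omega

theorem coeff_zero_vanishingPoly : V.vanishingPoly.coeff 0 = 0 := by
  rw [coeff_zero_eq_eval_zero]
  exact V.eval_vanishingPoly_eq_zero_iff.2 V.zero_mem

theorem divX_vanishingPoly_comp [DecidableEq V] (c : V) :
    V.vanishingPoly.divX.comp (X - C (c : K)) = ∏ d ∈ Finset.univ.erase c, (X - C (d : K)) := by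
  apply mul_left_cancel₀ (X_sub_C_ne_zero (c : K))
  rw [Finset.mul_prod_erase _ (fun d : V => X - C (d : K)) (Finset.mem_univ c)]
  have h1 := congrArg (fun g => g.comp (X - C (c : K))) V.vanishingPoly.X_mul_divX_add
  simp only [coeff_zero_vanishingPoly, C_0, add_zero, mul_comp, X_comp] at h1
  rw [h1]
  have := V.vanishingPoly_comp_of_mem (-c)
  rwa [AddSubgroup.coe_neg, C_neg, ← sub_eq_add_neg] at this

/-- The polynomial `π_V / X` has constant trace for the translations by `V`. -/
theorem sum_divX_vanishingPoly_comp :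
    ∑ c : V, V.vanishingPoly.divX.comp (X + C (c : K)) = C V.slope := by
  classical
  rw [← derivative_vanishingPoly, vanishingPoly, derivative_prod_finset]
  refine Fintype.sum_equiv (Equiv.neg V) _ _ fun c => ?_
  rw [Equiv.neg_apply, ← divX_vanishingPoly_comp]
  simp [vanishingPoly]

theorem slope_eq : V.slope = ∏ᶠ c ∈ (V : Set K) \ {0}, -c := by
  classical
  have h := V.divX_vanishingPoly_comp 0
  have h2 := congrArg (eval 0) h
  simp only [ZeroMemClass.coe_zero, C_0, sub_zero, comp_X, ← coeff_zero_eq_eval_zero, coeff_divX,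
    zero_add] at h2
  rw [slope, h2, coeff_zero_eq_eval_zero, eval_prod]
  simp only [eval_sub, eval_X, eval_C, zero_sub]
  have hs : (V : Set K) \ {0} =
      ((Finset.univ.erase (0 : V)).map ⟨Subtype.val, Subtype.val_injective⟩ : Finset K) := by
    ext t; simp
  rw [hs, finprod_mem_coe_finset, Finset.prod_map]
  rfl

theorem slope_ne_zero : V.slope ≠ 0 := by
  classical
  have h2 := congrArg (eval 0) (V.divX_vanishingPoly_comp 0)
  simp only [ZeroMemClass.coe_zero, C_0, sub_zero, comp_X, ← coeff_zero_eq_eval_zero, coeff_divX,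
    zero_add] at h2
  rw [slope, h2, coeff_zero_eq_eval_zero, eval_prod, Finset.prod_ne_zero_iff]
  intro c hc
  simpa using Finset.ne_of_mem_erase hc

variable {V} in
/-- The additive form of Hilbert's Theorem 90 for `V` acting on `K[X]` by translations. -/
theorem exists_comp_eq_sub (φ : V → K[X])
    (hφ : ∀ c d, φ (c + d) = φ c + (φ d).comp (X + C (c : K))) :
    ∃ Q : K[X], ∀ d : V, Q.comp (X + C (d : K)) = Q - φ d := by
  refine ⟨C V.slope⁻¹ * ∑ c : V, φ c * V.vanishingPoly.divX.comp (X + C (c : K)), fun d => ?_⟩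
  have h1 : (∑ c : V, φ c * V.vanishingPoly.divX.comp (X + C (c : K))).comp (X + C (d : K))
      = ∑ c : V, (φ c - φ d) * V.vanishingPoly.divX.comp (X + C (c : K)) := by
    rw [Polynomial.sum_comp]
    refine Fintype.sum_equiv (Equiv.addLeft d) _ _ fun c => ?_
    rw [Equiv.coe_addLeft, hφ, mul_comp, comp_assoc]
    simp only [add_comp, X_comp, C_comp, AddSubgroup.coe_add, C_add]
    ring_nf
  rw [mul_comp, C_comp, h1]
  simp only [sub_mul, Finset.sum_sub_distrib, ← Finset.mul_sum, sum_divX_vanishingPoly_comp]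
  rw [mul_sub, mul_left_comm, ← C_mul, inv_mul_cancel₀ V.slope_ne_zero, C_1, mul_one]

variable {V} in
/-- The `V`-invariant polynomials are the polynomials in `π_V`. -/
theorem exists_eq_comp_vanishingPoly (f : K[X]) (hf : ∀ c : V, f.comp (X + C (c : K)) = f) :
    ∃ g : K[X], f = g.comp V.vanishingPoly := by
  induction hn : f.natDegree using Nat.strong_induction_on generalizing f with
  | _ n ih =>
  by_cases h0 : n = 0
  · refine ⟨f, ?_⟩
    rw [eq_C_of_natDegree_eq_zero (hn.trans h0), C_comp]
  have hdvd : V.vanishingPoly ∣ f - C (f.coeff 0) := by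
    refine vanishingPoly_dvd fun c => ?_
    have := congrArg (eval 0) (hf c)
    simp only [eval_comp, eval_add, eval_X, eval_C, zero_add] at this
    rw [eval_sub, eval_C, this, coeff_zero_eq_eval_zero, sub_self]
  obtain ⟨f₁, hf₁⟩ := hdvd
  have hπ := V.monic_vanishingPoly.ne_zero
  have hf1 : f₁ ≠ 0 := by
    rintro rfl
    rw [mul_zero, sub_eq_zero] at hf₁
    rw [hf₁, natDegree_C] at hn
    exact h0 hn.symm
  have hdeg : f₁.natDegree < n := by
    have := congrArg natDegree hf₁
    rw [natDegree_sub_C, hn, natDegree_mul hπ hf1, natDegree_vanishingPoly] at this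
    have : 0 < Fintype.card V := Fintype.card_pos
    omega
  obtain ⟨g, hg⟩ := ih _ hdeg f₁ (fun c => by
    apply mul_left_cancel₀ hπ
    have := congrArg (fun g => g.comp (X + C (c : K))) hf₁
    simp only [sub_comp, C_comp, mul_comp, vanishingPoly_comp_of_mem] at this
    rw [← this, hf c, hf₁]) rfl
  refine ⟨C (f.coeff 0) + X * g, ?_⟩
  rw [add_comp, C_comp, mul_comp, X_comp, ← hg, ← hf₁]
  ring

theorem vanishingPoly_comp_neg_X (hodd : Odd (Fintype.card V)) :
    V.vanishingPoly.comp (-X) = -V.vanishingPoly := by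
  have h1 : ∏ c : V, (X - C (c : K)).comp (-X) = ∏ c : V, -1 * (X - C ((-c : V) : K)) := by
    refine Finset.prod_congr rfl fun c _ => ?_
    simp only [sub_comp, X_comp, C_comp, AddSubgroup.coe_neg, C_neg]
    ring
  unfold vanishingPoly
  rw [prod_comp, h1, Finset.prod_mul_distrib, Finset.prod_const, Finset.card_univ,
    hodd.neg_one_pow, neg_one_mul]
  congr 1
  exact Fintype.prod_equiv (Equiv.neg V) _ _ fun d => by rw [Equiv.neg_apply]

end AddSubgroup

/-! ### The polynomials `B_c` -/

namespace AdditivePolynomial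

variable {p h : ℕ} {F : Type*} [Field F] (R : AdditivePolynomial p h F)

/-- The polynomial `R` with its coefficients in an extension `K` of `F`. -/
noncomputable abbrev polyOver (K : Type*) [Field K] [Algebra F K] : K[X] :=
  R.toPoly.map (algebraMap F K)

variable {K : Type*} [Field K] [Algebra F K]

/-- The coefficient `a_i` in `K`, and zero for `i > h`. -/
noncomputable def coeffOver (K : Type*) [Field K] [Algebra F K] (i : ℕ) : K :=
  if hi : i < h + 1 then algebraMap F K (R.coeff ⟨i, hi⟩) else 0

theorem polyOver_eq_sum :
    R.polyOver K = ∑ i ∈ Finset.range (h + 1), C (R.coeffOver K i) * X ^ p ^ i := by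
  rw [Finset.sum_range, polyOver, toPoly, Polynomial.map_sum]
  refine Finset.sum_congr rfl fun i _ => ?_
  simp [coeffOver, show ¬ h < (i : ℕ) by omega]

theorem aeval_E (c : K) : aeval c R.E = (R.polyOver K).eval c ^ p ^ h +
    ∑ i ∈ Finset.range (h + 1), (R.coeffOver K i * c) ^ p ^ (h - i) := by
  rw [Finset.sum_range, E, map_add, map_pow, map_sum, polyOver, eval_map_algebraMap]
  congr 1
  refine Finset.sum_congr rfl fun i _ => ?_
  simp [coeffOver, show ¬ h < (i : ℕ) by omega]

/-- The coefficients `β_j` of `B_c = ∑_{j < h} β_j X ^ (p ^ j)`, determined from the lowest one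
upwards by comparing coefficients in `B_c ^ p - B_c = c R(X) + R(c) X`. The recursion is continued
beyond `j = h - 1`; the condition `β_h = 0` is `E(c) = 0`. -/
noncomputable def bCoeff (c : K) : ℕ → K
  | 0 => -((R.polyOver K).eval c + c * R.coeffOver K 0)
  | j + 1 => bCoeff c j ^ p - c * R.coeffOver K (j + 1)

/-- The polynomial `B_c`, given by explicit coefficients. -/
noncomputable def bPoly (c : K) : K[X] :=
  ∑ j ∈ Finset.range h, C (R.bCoeff c j) * X ^ p ^ j

theorem natDegree_polyOver [hp : Fact p.Prime] : (R.polyOver K).natDegree = p ^ h := by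
  rw [polyOver, natDegree_map, natDegree_toPoly]

theorem coeffOver_last : R.coeffOver K h = algebraMap F K R.lead := by
  simp [coeffOver, lead, Fin.last]

theorem coeff_polyOver [hp : Fact p.Prime] {i : ℕ} (hi : i ≤ h) :
    (R.polyOver K).coeff (p ^ i) = R.coeffOver K i := by
  rw [polyOver_eq_sum, finsetSum_coeff, Finset.sum_eq_single i]
  · simp
  · intro j _ hj
    rw [coeff_C_mul_X_pow, if_neg]
    exact fun h => hj (Nat.pow_right_injective hp.out.two_le h).symm
  · intro hi'
    exact absurd (Finset.mem_range.2 (by omega)) hi'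

variable [hp : Fact p.Prime] [CharP K p]

theorem polyOver_comp (c : K) :
    (R.polyOver K).comp (X + C c) = R.polyOver K + C ((R.polyOver K).eval c) := by
  simp only [polyOver_eq_sum, Polynomial.sum_comp, eval_finsetSum, map_sum,
    ← Finset.sum_add_distrib]
  refine Finset.sum_congr rfl fun i _ => ?_
  simp only [mul_comp, C_comp, pow_comp, X_comp, eval_mul, eval_C, eval_pow, eval_X,
    add_pow_char_pow, C_mul, C_pow]
  ring

theorem polyOver_eval_add (c d : K) :
    (R.polyOver K).eval (c + d) = (R.polyOver K).eval c + (R.polyOver K).eval d := by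
  have := congrArg (eval c) (R.polyOver_comp d)
  simpa using this

theorem polyOver_eval_neg (c : K) :
    (R.polyOver K).eval (-c) = -(R.polyOver K).eval c := by
  have h0 := R.polyOver_eval_add (0 : K) 0
  have h1 := R.polyOver_eval_add c (-c)
  rw [add_zero, left_eq_add] at h0
  rw [add_neg_cancel, h0] at h1
  linear_combination -h1

omit hp in
theorem derivative_polyOver : derivative (R.polyOver K) = C (R.coeffOver K 0) := by
  rw [polyOver_eq_sum, derivative_sum, Finset.sum_eq_single 0]
  · simp
  · intro j _ hj
    have : ((p ^ j : ℕ) : K[X]) = 0 := by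
      rw [Nat.cast_pow, CharP.cast_eq_zero, zero_pow hj]
    simp [derivative_pow, hj]
  · simp

theorem bCoeff_eq (c : K) (j : ℕ) : R.bCoeff c j = -((R.polyOver K).eval c ^ p ^ j +
    ∑ i ∈ Finset.range (j + 1), (R.coeffOver K i * c) ^ p ^ (j - i)) := by
  induction j with
  | zero => simp [bCoeff, mul_comm]
  | succ j ih =>
    have h1 : (-1 : K) ^ p = -1 := neg_one_pow_char K p
    rw [bCoeff, ih, neg_eq_neg_one_mul, mul_pow, h1, add_pow_char, sum_pow_char,
      Finset.sum_range_succ _ (j + 1)]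
    have : ∀ i ∈ Finset.range (j + 1), ((R.coeffOver K i * c) ^ p ^ (j - i)) ^ p =
        (R.coeffOver K i * c) ^ p ^ (j + 1 - i) := by
      intro i hi
      rw [← pow_mul, ← pow_succ, Nat.succ_sub (Nat.lt_succ_iff.1 (Finset.mem_range.1 hi))]
    rw [Finset.sum_congr rfl this, ← pow_mul, ← pow_succ]
    simp
    ring

/-- The defect of `B_c` from being a solution of its equation is `E(c)`. -/
theorem bPoly_pow_sub (c : K) : R.bPoly c ^ p - R.bPoly c =
    C c * R.polyOver K + C ((R.polyOver K).eval c) * X - C (aeval c R.E) * X ^ p ^ h := by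
  have key : ∀ m : ℕ, (∑ j ∈ Finset.range m, C (R.bCoeff c j) * X ^ p ^ j) ^ p -
      ∑ j ∈ Finset.range m, C (R.bCoeff c j) * X ^ p ^ j =
      C c * (∑ i ∈ Finset.range (m + 1), C (R.coeffOver K i) * X ^ p ^ i) +
        C ((R.polyOver K).eval c) * X + C (R.bCoeff c m) * X ^ p ^ m := by
    intro m
    induction m with
    | zero => simp [bCoeff, hp.out.ne_zero]; ring
    | succ m ih =>
      rw [Finset.sum_range_succ, add_pow_char, Finset.sum_range_succ _ (m + 1), bCoeff, mul_pow,
        ← C_pow, ← pow_mul, ← pow_succ]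
      simp only [C_sub, C_mul]
      linear_combination ih
  rw [bPoly, key h, ← polyOver_eq_sum, bCoeff_eq, ← aeval_E]
  simp only [C_neg]
  ring

theorem isB_bPoly {c : K} (hc : aeval c R.E = 0) : R.IsB c (R.bPoly c) := by
  refine ⟨?_, ?_⟩
  · rw [bPoly, finsetSum_coeff]
    refine Finset.sum_eq_zero fun i _ => ?_
    rw [coeff_C_mul_X_pow, if_neg (pow_pos hp.out.pos i).ne]
  · rw [bPoly_pow_sub, hc, ← eval_map_algebraMap]
    simp

omit hp [CharP K p] in
theorem isB_iff {c : K} {B : K[X]} : R.IsB c B ↔ B.coeff 0 = 0 ∧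
    B ^ p - B = C c * R.polyOver K + C ((R.polyOver K).eval c) * X := by
  rw [IsB, ← eval_map_algebraMap]

variable {R}

theorem IsB.unique {c : K} {B₁ B₂ : K[X]} (h₁ : R.IsB c B₁) (h₂ : R.IsB c B₂) : B₁ = B₂ := by
  rw [← sub_eq_zero]
  apply eq_zero_of_pow_eq_self (p := p)
  · rw [sub_pow_char]
    linear_combination h₁.2 - h₂.2
  · rw [coeff_sub, h₁.1, h₂.1, sub_zero]

theorem IsB.add {c d : K} {B₁ B₂ : K[X]} (h₁ : R.IsB c B₁) (h₂ : R.IsB d B₂) :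
    R.IsB (c + d) (B₁ + B₂) := by
  rw [isB_iff] at *
  refine ⟨by rw [coeff_add, h₁.1, h₂.1, add_zero], ?_⟩
  rw [add_pow_char, polyOver_eval_add, C_add, C_add]
  linear_combination h₁.2 + h₂.2

variable (R) in
theorem isB_zero : R.IsB (0 : K) 0 := by
  rw [isB_iff]
  refine ⟨coeff_zero _, ?_⟩
  have h0 := R.polyOver_eval_add (0 : K) 0
  rw [add_zero, left_eq_add] at h0
  rw [h0, zero_pow hp.out.ne_zero]
  simp

theorem IsB.neg {c : K} {B : K[X]} (h₁ : R.IsB c B) : R.IsB (-c) (-B) := by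
  rw [isB_iff] at *
  refine ⟨by rw [coeff_neg, h₁.1, neg_zero], ?_⟩
  have h2 : (-1 : K[X]) ^ p = -1 := neg_one_pow_char _ p
  rw [neg_eq_neg_one_mul, mul_pow, h2, polyOver_eval_neg, C_neg, C_neg]
  linear_combination -h₁.2

/-- The polynomial `B_c` is additive. -/
theorem IsB.comp {c : K} {B : K[X]} (hB : R.IsB c B) (t : K) :
    B.comp (X + C t) = B + C (B.eval t) := by
  rw [isB_iff] at hB
  rw [← sub_eq_zero]
  apply eq_zero_of_pow_eq_self (p := p)
  · have h1 := congrArg (fun g => g.comp (X + C t)) hB.2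
    have h2 := congrArg (fun g => C (g.eval t)) hB.2
    simp only [sub_comp, add_comp, pow_comp, mul_comp, C_comp, X_comp, polyOver_comp, eval_sub,
      eval_add, eval_mul, eval_C, eval_pow, eval_X, C_sub, C_add, C_mul, C_pow] at h1 h2
    rw [sub_pow_char, add_pow_char]
    linear_combination h1 - hB.2 - h2
  · simp [coeff_zero_eq_eval_zero, eval_comp]
    rw [← coeff_zero_eq_eval_zero, hB.1]

theorem IsB.eval_add {c : K} {B : K[X]} (hB : R.IsB c B) (s t : K) :
    B.eval (s + t) = B.eval s + B.eval t := by
  have := congrArg (eval s) (hB.comp t)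
  simpa using this

theorem IsB.eval_neg {c : K} {B : K[X]} (hB : R.IsB c B) (t : K) :
    B.eval (-t) = -B.eval t := by
  have h1 := hB.eval_add t (-t)
  rw [add_neg_cancel, ← coeff_zero_eq_eval_zero, hB.1] at h1
  linear_combination -h1

/-- If `c R(X) + R(c) X` is of the form `D ^ p - D`, then `c` is a zero of `E`. -/
theorem aeval_E_eq_zero_of_pow_sub [PerfectField K] {c : K} {D : K[X]}
    (hD : D ^ p - D = C c * R.polyOver K + C ((R.polyOver K).eval c) * X) : aeval c R.E = 0 := by
  have hexp : ExpChar K p := ExpChar.prime hp.out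
  obtain ⟨e, he⟩ := (bijective_iterateFrobenius K p h).2 (aeval c R.E)
  change e ^ p ^ h = _ at he
  have hT : ∀ m : ℕ, ∃ T : K[X], T ^ p - T = (C e * X) ^ p ^ m - C e * X := by
    intro m
    induction m with
    | zero => exact ⟨0, by simp [hp.out.ne_zero]⟩
    | succ m ih =>
      obtain ⟨T, hT⟩ := ih
      refine ⟨T + (C e * X) ^ p ^ m, ?_⟩
      rw [add_pow_char, ← pow_mul, ← pow_succ]
      linear_combination hT
  obtain ⟨T, hT⟩ := hT h
  have hb := R.bPoly_pow_sub c
  rw [← he, C_pow, ← mul_pow] at hb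
  have h1 : (R.bPoly c - D + T) ^ p - (R.bPoly c - D + T) = C (-e) * X := by
    rw [add_pow_char, sub_pow_char, C_neg]
    linear_combination hb - hD + hT
  have h2 := eq_C_of_pow_sub_self_natDegree_lt h1
    ((natDegree_C_mul_le _ _).trans_lt <| natDegree_X_le.trans_lt hp.out.one_lt)
  rw [h2, ← C_pow, ← C_sub] at h1
  have h3 := congrArg (fun g => g.coeff 1) h1
  simp only [coeff_C_succ, coeff_C_mul, coeff_X_one, mul_one, zero_eq_neg] at h3
  rw [← he, h3, zero_pow (pow_pos hp.out.pos h).ne']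

end AdditivePolynomial

/-! ### The polynomial identity behind the quotient curve -/

namespace AdditivePolynomial

variable {p h : ℕ} [hp : Fact p.Prime] [hp2 : Fact (p ≠ 2)] {F : Type*} [Field F]
  {R : AdditivePolynomial p h F} {K : Type*} [Field K] [Algebra F K] [CharP K p]

theorem two_ne_zero_of_charP (p : ℕ) [hp : Fact p.Prime] [hp2 : Fact (p ≠ 2)]
    (K : Type*) [Field K] [CharP K p] : (2 : K) ≠ 0 := by
  intro h
  have h1 : ((2 : ℕ) : K) = 0 := by exact_mod_cast h
  rw [CharP.cast_eq_zero_iff K p] at h1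
  exact hp2.out ((Nat.prime_dvd_prime_iff_eq hp.out Nat.prime_two).1 h1)

omit hp2 in
variable (p K) in
theorem two_pow_char : (2 : K) ^ p = 2 := by
  have := map_ofNat (frobenius K p) 2
  rwa [frobenius_def] at this

theorem three_le (p : ℕ) [hp : Fact p.Prime] [hp2 : Fact (p ≠ 2)] : 3 ≤ p := by
  have := hp.out.two_le
  have := hp2.out
  omega

omit hp2 [CharP K p] in
theorem natDegree_X_mul_polyOver : (X * R.polyOver K).natDegree = p ^ h + 1 := by
  have h1 := R.natDegree_polyOver (K := K)
  have hne : R.polyOver K ≠ 0 := by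
    intro h0
    rw [h0, natDegree_zero] at h1
    exact absurd h1 (pow_pos hp.out.pos h).ne
  rw [natDegree_X_mul hne, h1]

omit hp2 in
/-- If `Q(x + c) = Q(x) - B_c(x) - b`, then the function `x R(x) + Q(x) ^ p - Q(x)` is invariant
under `x ↦ x + c`. -/
theorem IsB.comp_eq {c b : K} {B Q : K[X]} (hB : R.IsB c B)
    (hb : b ^ p - b = c * (R.polyOver K).eval c) (hQ : Q.comp (X + C c) = Q - (B + C b)) :
    (X * R.polyOver K + (Q ^ p - Q)).comp (X + C c) = X * R.polyOver K + (Q ^ p - Q) := by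
  have h1 := (isB_iff R).1 hB |>.2
  have h2 := congrArg (C : K → K[X]) hb
  simp only [C_sub, C_pow, C_mul] at h2
  simp only [add_comp, sub_comp, pow_comp, mul_comp, X_comp, polyOver_comp, hQ]
  rw [sub_pow_char, add_pow_char]
  linear_combination -h1 - h2

/-- If `x R(x) + Q(x) ^ p - Q(x) = g(π_V(x))`, where `g` is constant or of degree prime to `p`, then
`g` is quadratic: compare degrees in the equation and in its derivative
`e g'(π_V) = R + a_0 x - Q'`, where `e = π_V'` and the term `Q ^ p` has disappeared. The leading
coefficients of the derivative also give `2 e g_2 = a_h`. -/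
theorem natDegree_eq_two_of_comp_vanishingPoly (hh : h ≠ 0) (V : AddSubgroup K) [Fintype V]
    (hV : Fintype.card V = p ^ h) {Q g : K[X]}
    (hg : X * R.polyOver K + (Q ^ p - Q) = g.comp V.vanishingPoly)
    (hred : g.natDegree = 0 ∨ ¬ p ∣ g.natDegree) :
    g.natDegree = 2 ∧ 2 * V.slope * g.coeff 2 = R.coeffOver K h := by
  have hp3 := three_le p
  obtain ⟨m, rfl⟩ : ∃ m, h = m + 1 := Nat.exists_eq_succ_of_ne_zero hh
  have hpm : 0 < p ^ m := pow_pos hp.out.pos m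
  have hps : p ^ (m + 1) = p ^ m * p := pow_succ p m
  have h3pm : 3 * p ^ m ≤ p ^ (m + 1) := by rw [hps, mul_comm]; exact Nat.mul_le_mul le_rfl hp3
  have hdπ : V.vanishingPoly.natDegree = p ^ (m + 1) := by rw [V.natDegree_vanishingPoly, hV]
  have hdg : (g.comp V.vanishingPoly).natDegree = g.natDegree * p ^ (m + 1) := by
    rw [natDegree_comp, hdπ]
  have hdR := natDegree_X_mul_polyOver (R := R) (K := K)
  -- the degree of `Q ^ p - Q`
  have hdQ : (Q ^ p - Q).natDegree = p * Q.natDegree := by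
    rcases Nat.eq_zero_or_pos Q.natDegree with h0 | h0
    · rw [h0, mul_zero, eq_C_of_natDegree_eq_zero h0, ← C_pow, ← C_sub, natDegree_C]
    · rw [natDegree_sub_eq_left_of_natDegree_lt, natDegree_pow]
      rw [natDegree_pow]
      exact lt_mul_left h0 hp.out.one_lt
  have hder : C V.slope * (derivative g).comp V.vanishingPoly =
      R.polyOver K + X * C (R.coeffOver K 0) - derivative Q := by
    have := congrArg derivative hg
    rw [derivative_comp, V.derivative_vanishingPoly] at this
    rw [← this]
    simp only [derivative_add, derivative_mul, derivative_X, derivative_polyOver, derivative_sub,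
      derivative_pow, CharP.cast_eq_zero, C_0]
    ring
  have hcoef := congrArg (fun f => f.coeff (p ^ (m + 1))) hder
  have hne1 : p ^ (m + 1) ≠ 1 := by omega
  have hX : (X * C (R.coeffOver K 0)).coeff (p ^ (m + 1)) = 0 := by
    rw [coeff_mul_C, coeff_X, if_neg (Ne.symm hne1), zero_mul]
  simp only [coeff_C_mul, coeff_add, coeff_sub, R.coeff_polyOver le_rfl, hX, add_zero] at hcoef
  have hlast : R.coeffOver K (m + 1) ≠ 0 := by
    rw [coeffOver_last]
    exact (_root_.map_ne_zero _).2 R.coeff_last_ne_zero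
  -- the degree of `Q` if `g` is not linear
  have hQ : 2 ≤ g.natDegree → Q.natDegree = g.natDegree * p ^ m := by
    intro h2
    have h3 : (Q ^ p - Q).natDegree = g.natDegree * p ^ (m + 1) := by
      rw [← hdg, ← add_sub_cancel_left (X * R.polyOver K) (Q ^ p - Q), hg]
      apply natDegree_sub_eq_left_of_natDegree_lt
      rw [hdR, hdg]
      have := Nat.mul_le_mul_right (p ^ (m + 1)) h2
      omega
    rw [hdQ, hps, ← mul_assoc, mul_comm] at h3
    exact Nat.eq_of_mul_eq_mul_right hp.out.pos h3
  have hQ' : (derivative Q).natDegree ≤ Q.natDegree - 1 := natDegree_derivative_le Q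
  have hle : g.natDegree ≤ 2 := by
    by_contra! h3
    have hq := hQ (by omega)
    have h4 : g.natDegree - 1 ≤ (derivative g).natDegree := by
      apply le_natDegree_of_ne_zero
      rw [coeff_derivative, Nat.sub_add_cancel (by omega)]
      refine mul_ne_zero (leadingCoeff_ne_zero.2 (by rintro rfl; simp at h3)) ?_
      have : ((g.natDegree : ℕ) : K) ≠ 0 := by
        rw [Ne, CharP.cast_eq_zero_iff K p]
        exact hred.resolve_left (by omega)
      rwa [Nat.cast_sub (by omega), Nat.cast_one, sub_add_cancel]
    have h5 := congrArg natDegree hder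
    rw [natDegree_C_mul V.slope_ne_zero, natDegree_comp, hdπ] at h5
    have h6 : (R.polyOver K + X * C (R.coeffOver K 0) - derivative Q).natDegree ≤
        max (p ^ (m + 1)) (g.natDegree * p ^ m) := by
      refine (natDegree_sub_le _ _).trans (max_le_max ?_ (by omega))
      refine (natDegree_add_le _ _).trans (max_le R.natDegree_polyOver.le ?_)
      refine (natDegree_mul_C_le _ _).trans (natDegree_X_le.trans (by omega))
    rw [← h5] at h6
    have h7 := (Nat.mul_le_mul_right (p ^ (m + 1)) h4).trans h6
    have h8 : 2 * p ^ (m + 1) ≤ (g.natDegree - 1) * p ^ (m + 1) :=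
      Nat.mul_le_mul_right _ (by omega)
    rcases le_max_iff.1 h7 with h9 | h9
    · omega
    · have h10 : (g.natDegree - 1) * (3 * p ^ m) ≤ (g.natDegree - 1) * p ^ (m + 1) :=
        Nat.mul_le_mul_left _ h3pm
      have h11 : g.natDegree * p ^ m < (g.natDegree - 1) * 3 * p ^ m :=
        Nat.mul_lt_mul_of_pos_right (by omega) hpm
      rw [← mul_assoc] at h10
      omega
  have hge : 2 ≤ g.natDegree := by
    by_contra! h2
    have h4 : derivative g = C ((derivative g).coeff 0) := by
      apply eq_C_of_natDegree_eq_zero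
      have := natDegree_derivative_le g
      omega
    rw [h4, C_comp, coeff_C_of_ne_zero (by omega), mul_zero] at hcoef
    have h5 : p ^ (m + 1) ≤ (derivative Q).natDegree := by
      apply le_natDegree_of_ne_zero
      rwa [← sub_eq_zero.1 hcoef.symm]
    have h6 : (Q ^ p - Q + X * R.polyOver K).natDegree = p * Q.natDegree := by
      rw [natDegree_add_eq_left_of_natDegree_lt, hdQ]
      rw [hdR, hdQ]
      have := Nat.mul_le_mul hp3 (show p ^ (m + 1) + 1 ≤ Q.natDegree by omega)
      omega
    rw [add_comm, hg, hdg] at h6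
    have h7 := Nat.mul_le_mul hp3 (show p ^ (m + 1) + 1 ≤ Q.natDegree by omega)
    have h8 := Nat.mul_le_mul_right (p ^ (m + 1)) (show g.natDegree ≤ 1 by omega)
    omega
  have h2 : g.natDegree = 2 := le_antisymm hle hge
  refine ⟨h2, ?_⟩
  have hq := hQ hge
  rw [h2] at hq
  have hQ0 : (derivative Q).coeff (p ^ (m + 1)) = 0 :=
    coeff_eq_zero_of_natDegree_lt (by omega)
  have hg' : derivative g = C (2 * g.coeff 2) * X + C (g.coeff 1) := by
    have h4 : (derivative g).natDegree ≤ 1 := by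
      have := natDegree_derivative_le g
      omega
    rw [eq_X_add_C_of_natDegree_le_one h4, coeff_derivative, coeff_derivative]
    norm_num
    ring
  have hπ : V.vanishingPoly.coeff (p ^ (m + 1)) = 1 := by
    rw [← hdπ]; exact V.monic_vanishingPoly
  rw [hQ0, sub_zero, hg'] at hcoef
  simp only [add_comp, mul_comp, C_comp, X_comp, coeff_add, coeff_C_mul, hπ,
    coeff_C_of_ne_zero (pow_pos hp.out.pos (m + 1)).ne', add_zero, mul_one] at hcoef
  rw [← hcoef]
  ring

/-- For a group of automorphisms `σ_{b(c),c}`, with `c` running through a group `V` of order `p ^ h`,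
there is an invariant function `Y = y + Q(x)`, by Hilbert 90, and it satisfies
`Y ^ p - Y = a (π_V(x) + s) ^ 2 - a s ^ 2`. -/
theorem exists_quotient_equation [PerfectField K] (V : AddSubgroup K) [Fintype V]
    (hV : Fintype.card V = p ^ h) (b : V → K) (B : V → K[X]) (hB : ∀ c : V, R.IsB (c : K) (B c))
    (hb : ∀ c : V, b c ^ p - b c = c * (R.polyOver K).eval (c : K))
    (hadd : ∀ c d : V, b (c + d) = b c + b d + (B d).eval (c : K)) :
    ∃ (Q : K[X]) (a s : K), (∀ c : V, Q.comp (X + C (c : K)) = Q - (B c + C (b c))) ∧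
      Q.coeff 0 = 0 ∧
      a * V.slope ^ 2 = (if h = 0 then R.coeffOver K 0 else R.coeffOver K h / 2 * V.slope) ∧
      X * R.polyOver K + (Q ^ p - Q) = C a * (V.vanishingPoly + C s) ^ 2 - C (a * s ^ 2) := by
  have h2 := two_ne_zero_of_charP p K
  have hcocycle : ∀ c d : V, B (c + d) + C (b (c + d)) =
      B c + C (b c) + (B d + C (b d)).comp (X + C (c : K)) := by
    intro c d
    have h1 : B (c + d) = B c + B d := (hB (c + d)).unique ((hB c).add (hB d))
    rw [h1, hadd, add_comp, C_comp, (hB d).comp, C_add, C_add]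
    ring
  obtain ⟨Q₀, hQ₀⟩ := AddSubgroup.exists_comp_eq_sub (fun c => B c + C (b c)) hcocycle
  by_cases hh : h = 0
  · -- `V` is trivial
    subst hh
    rw [pow_zero, Fintype.card_eq_one_iff_nonempty_unique] at hV
    obtain ⟨hu⟩ := hV
    have hπ : V.vanishingPoly = X := by
      have h0 : ((default : V) : K) = 0 := by
        rw [← Subsingleton.elim (0 : V) default]; rfl
      rw [AddSubgroup.vanishingPoly, Fintype.prod_unique, h0, C_0, sub_zero]
    refine ⟨0, R.coeffOver K 0, 0, fun c => ?_, coeff_zero _, ?_, ?_⟩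
    · have h1 := hcocycle 0 0
      simp only [add_zero, ZeroMemClass.coe_zero, C_0, comp_X, left_eq_add] at h1
      rw [Subsingleton.elim c 0, h1, zero_comp, sub_zero]
    · rw [AddSubgroup.slope, hπ]; simp
    · rw [hπ, polyOver_eq_sum]
      simp [hp.out.ne_zero]
      ring
  rw [if_neg hh]
  obtain ⟨g₀, hg₀⟩ := AddSubgroup.exists_eq_comp_vanishingPoly (V := V)
    (X * R.polyOver K + (Q₀ ^ p - Q₀)) fun c => (hB c).comp_eq (hb c) (hQ₀ c)
  obtain ⟨r, hr⟩ := exists_reduced (p := p) g₀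
  set g₁ := g₀ - (r ^ p - r) with hg₁
  set Q₁ := Q₀ - r.comp V.vanishingPoly with hQ₁
  have hQ₁V : ∀ c : V, Q₁.comp (X + C (c : K)) = Q₁ - (B c + C (b c)) := by
    intro c
    rw [hQ₁, sub_comp, hQ₀, comp_assoc, V.vanishingPoly_comp_of_mem]
    ring
  have hg₁ : X * R.polyOver K + (Q₁ ^ p - Q₁) = g₁.comp V.vanishingPoly := by
    rw [hg₁, hQ₁, sub_pow_char, sub_comp, ← hg₀, sub_comp, pow_comp]
    ring
  obtain ⟨hdeg, hlead⟩ := natDegree_eq_two_of_comp_vanishingPoly hh V hV hg₁ hr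
  set a := g₁.coeff 2 with ha
  have ha0 : a ≠ 0 := by
    rw [ha, ← hdeg]
    exact leadingCoeff_ne_zero.2 (by intro h0; rw [h0] at hdeg; simp at hdeg)
  have hg₁eq : g₁ = C a * X ^ 2 + C (g₁.coeff 1) * X + C (g₁.coeff 0) := by
    conv_lhs => rw [g₁.as_sum_range_C_mul_X_pow, hdeg]
    simp [Finset.sum_range_succ]
    ring
  set s := g₁.coeff 1 / (2 * a) with hs
  have hg1s : g₁.coeff 1 = 2 * a * s := by rw [hs]; field_simp
  have hconst : Q₁.coeff 0 ^ p - Q₁.coeff 0 = g₁.coeff 0 := by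
    have := congrArg (eval 0) hg₁
    rw [eval_comp, ← coeff_zero_eq_eval_zero V.vanishingPoly, V.coeff_zero_vanishingPoly] at this
    simpa [coeff_zero_eq_eval_zero] using this
  refine ⟨Q₁ - C (Q₁.coeff 0), a, s, fun c => ?_, by simp, ?_, ?_⟩
  · rw [sub_comp, hQ₁V, C_comp]; ring
  · rw [← hlead]; field_simp
  · rw [sub_pow_char, ← C_pow]
    have h3 := congrArg (C : K → K[X]) hconst
    rw [C_sub] at h3
    have h4 : (C a * X ^ 2 + C (g₁.coeff 1) * X + C (g₁.coeff 0)).comp V.vanishingPoly =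
        C a * (V.vanishingPoly + C s) ^ 2 - C (a * s ^ 2) + C (g₁.coeff 0) := by
      rw [hg1s]
      simp only [add_comp, mul_comp, C_comp, X_comp, pow_comp, C_mul, C_pow]
      simp only [map_ofNat]
      ring
    rw [hg₁eq, h4] at hg₁
    linear_combination hg₁ - h3

end AdditivePolynomial

namespace AdditivePolynomial

variable {p h : ℕ} [hp : Fact p.Prime] [hp2 : Fact (p ≠ 2)] {F : Type*} [Field F]
  {R : AdditivePolynomial p h F} {K : Type*} [Field K] [Algebra F K] [CharP K p]

omit [CharP K p] in
theorem polyOver_comp_neg_X : (R.polyOver K).comp (-X) = -R.polyOver K := by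
  simp only [polyOver_eq_sum, Polynomial.sum_comp, ← Finset.sum_neg_distrib]
  refine Finset.sum_congr rfl fun i _ => ?_
  rw [mul_comp, C_comp, pow_comp, X_comp, Odd.neg_pow, mul_neg]
  exact (hp.out.odd_of_ne_two hp2.out).pow

/-- A point `t` with `π(t) = -s` is a zero of `E`. Since `x R(x)` is even and `π` is odd, the odd
part of the quotient equation shows that `2 a s π` is of the form `D ^ p - D`, and the even part
that `x R(x)` and `a π ^ 2` differ by such a term. Hence so do `(x + t) R(x + t)` and
`a π(x + t) ^ 2 = a π ^ 2 - 2 a s π + a s ^ 2`, and `t R(x) + R(t) x` is of the form `D ^ p - D`. -/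
theorem aeval_E_eq_zero_of_quotient_equation [IsAlgClosed K] {Q π : K[X]} {a s t : K}
    (hπ : π.comp (-X) = -π) (hadd : π.comp (X + C t) = π + C (π.eval t)) (ht : π.eval t = -s)
    (hQ : X * R.polyOver K + (Q ^ p - Q) = C a * (π + C s) ^ 2 - C (a * s ^ 2)) :
    aeval t R.E = 0 := by
  have h2 := two_ne_zero_of_charP p K
  have hi : (2⁻¹ : K) ^ p = 2⁻¹ := by rw [inv_pow, two_pow_char]
  have hi2 : (C 2⁻¹ : K[X]) ^ p = C 2⁻¹ := by rw [← C_pow, hi]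
  have h2i : (C 2⁻¹ : K[X]) * 2 = 1 := by
    rw [← map_ofNat (C : K →+* K[X]) 2, ← C_mul, inv_mul_cancel₀ h2, C_1]
  have hQ' := congrArg (fun g => g.comp (-X)) hQ
  simp only [add_comp, sub_comp, mul_comp, pow_comp, X_comp, C_comp, hπ,
    polyOver_comp_neg_X] at hQ'
  set Q' := Q.comp (-X)
  -- the even and the odd part of the equation
  have heven : X * R.polyOver K + ((C 2⁻¹ * (Q + Q')) ^ p - C 2⁻¹ * (Q + Q')) =
      C a * π ^ 2 := by
    rw [mul_pow, hi2, add_pow_char]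
    simp only [C_mul, C_pow] at hQ hQ' ⊢
    linear_combination C 2⁻¹ * hQ + C 2⁻¹ * hQ' + (C a * π ^ 2 - X * R.polyOver K) * h2i
  have hodd : (C 2⁻¹ * (Q - Q')) ^ p - C 2⁻¹ * (Q - Q') = C (2 * a * s) * π := by
    rw [mul_pow, hi2, sub_pow_char]
    simp only [C_mul, C_pow, map_ofNat] at hQ hQ' ⊢
    linear_combination C 2⁻¹ * hQ - C 2⁻¹ * hQ' + 2 * C a * C s * π * h2i
  set Qe := C 2⁻¹ * (Q + Q')
  set Qo := C 2⁻¹ * (Q - Q')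
  have hshift := congrArg (fun g => g.comp (X + C t)) heven
  simp only [add_comp, sub_comp, mul_comp, pow_comp, X_comp, C_comp, hadd, ht,
    polyOver_comp] at hshift
  obtain ⟨κ, hκ⟩ := exists_pow_sub_eq p (a * s ^ 2 - t * (R.polyOver K).eval t)
  apply aeval_E_eq_zero_of_pow_sub (D := Qe - Qe.comp (X + C t) - Qo + C κ)
  rw [add_pow_char, sub_pow_char, sub_pow_char, ← C_pow]
  have h3 := congrArg (C : K → K[X]) hκ
  simp only [C_sub, C_mul, C_pow, C_neg, map_ofNat] at h3 hshift hodd ⊢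
  linear_combination h3 - hodd - hshift + heven

omit hp2 in
/-- For a solution of `b ^ p - b = c R(c)`, the element `b - B_c(c) / 2` lies in the prime field. -/
theorem IsB.sub_half_pow (h2 : (2 : K) ≠ 0) {c b : K} {B : K[X]} (hB : R.IsB c B)
    (hb : b ^ p - b = c * (R.polyOver K).eval c) :
    (b - B.eval c / 2) ^ p = b - B.eval c / 2 := by
  have h1 := congrArg (eval c) ((isB_iff R).1 hB).2
  simp only [eval_sub, eval_pow, Polynomial.eval_add, eval_mul, eval_C, eval_X] at h1
  rw [sub_pow_char, div_pow, two_pow_char]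
  field_simp
  linear_combination 2 * hb - h1

/-- Let `σ = σ_{b,c}` and `Y = y + Q(x)`. If `D = σ(Y) - Y` is `V`-invariant, then `c ∈ V`: the
polynomial `D` is a polynomial in `π_V`, and `D ^ p - D = 2 a π_V(c) π_V + const` is of degree at
most one in `π_V`, so that `D` is constant and `π_V(c) = 0`. -/
theorem mem_of_comp_eq (V : AddSubgroup K) [Fintype V] {Q : K[X]} {a s : K} (ha : a ≠ 0)
    (hQ : X * R.polyOver K + (Q ^ p - Q) = C a * (V.vanishingPoly + C s) ^ 2 - C (a * s ^ 2))
    {c b : K} {B : K[X]} (hB : R.IsB c B) (hb : b ^ p - b = c * (R.polyOver K).eval c)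
    (hD : ∀ d : V, (B + C b + Q.comp (X + C c) - Q).comp (X + C (d : K)) =
      B + C b + Q.comp (X + C c) - Q) : c ∈ V := by
  obtain ⟨g, hg⟩ := AddSubgroup.exists_eq_comp_vanishingPoly _ hD
  have hshift := congrArg (fun g => g.comp (X + C c)) hQ
  simp only [add_comp, sub_comp, mul_comp, pow_comp, X_comp, C_comp, V.vanishingPoly_comp,
    polyOver_comp] at hshift
  set e := V.vanishingPoly.eval c with he
  have h1 : (B + C b + Q.comp (X + C c) - Q) ^ p - (B + C b + Q.comp (X + C c) - Q) =
      C (2 * a * e) * V.vanishingPoly + C (a * (e ^ 2 + 2 * e * s)) := by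
    have h3 := congrArg (C : K → K[X]) hb
    rw [sub_pow_char, add_pow_char, add_pow_char]
    simp only [C_sub, C_mul, C_pow, C_add, map_ofNat] at h3 hshift hQ ⊢
    linear_combination ((isB_iff R).1 hB).2 + h3 + hshift - hQ
  have h2 : (g ^ p - g - (C (2 * a * e) * X + C (a * (e ^ 2 + 2 * e * s)))).comp
      V.vanishingPoly = 0 := by
    rw [hg] at h1
    simp only [sub_comp, add_comp, mul_comp, pow_comp, X_comp, C_comp, h1, sub_self]
  rw [comp_eq_zero_iff] at h2
  have h3 : g ^ p - g = C (2 * a * e) * X + C (a * (e ^ 2 + 2 * e * s)) := by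
    rcases h2 with h2 | h2
    · exact sub_eq_zero.1 h2
    · have h4 := congrArg natDegree h2.2
      rw [natDegree_C, V.natDegree_vanishingPoly] at h4
      exact absurd h4 Fintype.card_ne_zero
  have h4 := eq_C_of_pow_sub_self_natDegree_lt h3 (natDegree_linear_le.trans_lt hp.out.one_lt)
  rw [h4, ← C_pow, ← C_sub] at h3
  have h5 := congrArg (fun f => f.coeff 1) h3
  simp only [coeff_C_succ, coeff_add, coeff_C_mul, coeff_X_one, mul_one, add_zero] at h5
  rw [← V.eval_vanishingPoly_eq_zero_iff, ← he]
  exact (mul_eq_zero.1 h5.symm).resolve_left (mul_ne_zero (two_ne_zero_of_charP p K) ha)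

end AdditivePolynomial

/-! ### Function fields of Artin-Schreier curves -/

theorem IntermediateField.aeval_mem_of_mem {K L : Type*} [Field K] [Field L] [Algebra K L]
    (S : IntermediateField K L) {z : L} (hz : z ∈ S) (q : K[X]) : aeval z q ∈ S := by
  induction q using Polynomial.induction_on' with
  | add q₁ q₂ h₁ h₂ => rw [map_add]; exact add_mem h₁ h₂
  | monomial n a => rw [aeval_monomial]; exact mul_mem (S.algebraMap_mem a) (pow_mem hz n)

namespace ArtinSchreierField

variable {p : ℕ} {k : Type*} [Field k] (f : k[X])

/-- The coordinate function `x`. -/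
noncomputable def x (p : ℕ) {k : Type*} [Field k] (f : k[X]) : ArtinSchreierField p f :=
  AdjoinRoot.of _ RatFunc.X

/-- The coordinate function `y`. -/
noncomputable def y (p : ℕ) {k : Type*} [Field k] (f : k[X]) : ArtinSchreierField p f :=
  AdjoinRoot.root _

theorem aeval_x (q : k[X]) : aeval (x p f) q =
    AdjoinRoot.of (artinSchreierPoly p f) (algebraMap k[X] (RatFunc k) q) := by
  rw [x, ← RatFunc.aeval_X_left_eq_algebraMap, ← AdjoinRoot.algebraMap_eq, aeval_algebraMap_apply]

theorem algebraMap_eq_aeval_x (q : k[X]) :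
    algebraMap k[X] (ArtinSchreierField p f) q = aeval (x p f) q := by
  rw [aeval_x, IsScalarTower.algebraMap_apply k[X] (RatFunc k) (ArtinSchreierField p f)]
  rfl

theorem y_pow_sub : y p f ^ p - y p f = aeval (x p f) f := by
  have h : AdjoinRoot.mk (artinSchreierPoly p f) (artinSchreierPoly p f) = 0 := AdjoinRoot.mk_self
  rw [map_sub, map_sub, map_pow, AdjoinRoot.mk_X, AdjoinRoot.mk_C] at h
  rw [aeval_x]
  exact sub_eq_zero.1 h

variable {f}

theorem monic [hp : Fact p.Prime] : (artinSchreierPoly p f).Monic := by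
  rw [artinSchreierPoly, sub_sub]
  exact monic_X_pow_sub (by rw [degree_X_add_C]; exact_mod_cast hp.out.one_lt)

theorem natDegree_eq [hp : Fact p.Prime] : (artinSchreierPoly p f).natDegree = p := by
  rw [artinSchreierPoly, sub_sub]
  apply natDegree_eq_of_degree_eq_some
  rw [degree_sub_eq_left_of_degree_lt, degree_X_pow]
  rw [degree_X_pow, degree_X_add_C]
  exact_mod_cast hp.out.one_lt

/-- Every function has a representative of degree less than `p` in `Y`. -/
theorem exists_mk_eq [hp : Fact p.Prime] (z : ArtinSchreierField p f) :
    ∃ g : (RatFunc k)[X], g.natDegree < p ∧ AdjoinRoot.mk (artinSchreierPoly p f) g = z := by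
  obtain ⟨g, rfl⟩ := AdjoinRoot.mk_surjective z
  refine ⟨g %ₘ artinSchreierPoly p f, ?_, ?_⟩
  · have := natDegree_modByMonic_lt g (monic (p := p) (f := f)) (by
      intro h
      have := natDegree_eq (p := p) (f := f)
      rw [h, natDegree_one] at this
      exact hp.out.ne_zero this.symm)
    rwa [natDegree_eq] at this
  · exact (AdjoinRoot.mk_eq_mk.2 (by
      rw [← dvd_neg, neg_sub]
      exact ⟨g /ₘ artinSchreierPoly p f, by
        have := modByMonic_add_div g (artinSchreierPoly p f)
        linear_combination -this⟩))

theorem mk_eq_sum {g : (RatFunc k)[X]} (hg : g.natDegree < p) :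
    AdjoinRoot.mk (artinSchreierPoly p f) g =
      ∑ i ∈ Finset.range p, AdjoinRoot.of (artinSchreierPoly p f) (g.coeff i) * y p f ^ i := by
  conv_lhs => rw [g.as_sum_range' p hg, map_sum]
  refine Finset.sum_congr rfl fun i _ => ?_
  rw [← C_mul_X_pow_eq_monomial, map_mul, map_pow, AdjoinRoot.mk_C, AdjoinRoot.mk_X]
  rfl

theorem algHom_ext {M : Type*} [Field M] [Algebra k M] {φ ψ : ArtinSchreierField p f →ₐ[k] M}
    (hx : φ (x p f) = ψ (x p f)) (hy : φ (y p f) = ψ (y p f)) : φ = ψ := by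
  have h1 : ∀ r : RatFunc k, φ (AdjoinRoot.of _ r) = ψ (AdjoinRoot.of _ r) := by
    have : ((φ : ArtinSchreierField p f →+* M).comp (AdjoinRoot.of _)) =
        (ψ : ArtinSchreierField p f →+* M).comp (AdjoinRoot.of _) := by
      apply IsFractionRing.injective_comp_algebraMap (A := k[X])
      refine RingHom.ext fun q => ?_
      simp only [RingHom.comp_apply]
      rw [← aeval_x]
      change φ _ = ψ _
      rw [← aeval_algHom_apply, ← aeval_algHom_apply, hx]
    exact fun r => RingHom.congr_fun this r
  refine AlgHom.ext fun z => ?_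
  obtain ⟨g, rfl⟩ := AdjoinRoot.mk_surjective z
  induction g using Polynomial.induction_on' with
  | add g₁ g₂ h₁ h₂ => rw [map_add, map_add, map_add, h₁, h₂]
  | monomial n a =>
    rw [← C_mul_X_pow_eq_monomial, map_mul, map_pow, AdjoinRoot.mk_C, AdjoinRoot.mk_X, map_mul,
      map_mul, h1, map_pow, map_pow]
    change _ * φ (y p f) ^ n = _ * ψ (y p f) ^ n
    rw [hy]

theorem exists_algHom {M : Type*} [Field M] [Algebra k M] {x' y' : M} (hx : Transcendental k x')
    (hy : y' ^ p - y' = aeval x' f) :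
    ∃ φ : ArtinSchreierField p f →ₐ[k] M, φ (x p f) = x' ∧ φ (y p f) = y' := by
  have hinj : Function.Injective (aeval x' : k[X] →ₐ[k] M) := transcendental_iff_injective.1 hx
  set i : RatFunc k →ₐ[k] M := IsFractionRing.liftAlgHom hinj with hi
  have hiq : ∀ q : k[X], i (algebraMap k[X] (RatFunc k) q) = aeval x' q := fun q => by
    rw [hi, IsFractionRing.liftAlgHom_apply]
    exact IsFractionRing.lift_algebraMap (K := RatFunc k)
      (g := ((aeval x' : k[X] →ₐ[k] M) : k[X] →+* M)) hinj q
  refine ⟨AdjoinRoot.liftAlgHom _ i y' ?_, ?_, ?_⟩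
  · rw [artinSchreierPoly, eval₂_sub, eval₂_sub, eval₂_pow, eval₂_X, eval₂_C]
    change _ - _ - i _ = 0
    rw [hiq, hy, sub_self]
  · rw [x, AdjoinRoot.liftAlgHom_of, ← RatFunc.algebraMap_X, hiq, aeval_X]
  · exact AdjoinRoot.liftAlgHom_root _ _ _ _

variable (f) in
theorem transcendental_x [hp : Fact p.Prime] : Transcendental k (x p f) := by
  rw [transcendental_iff_injective]
  intro q r h
  rw [aeval_x, aeval_x] at h
  refine RatFunc.algebraMap_injective k (AdjoinRoot.of.injective_of_degree_ne_zero ?_ h)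
  rw [degree_eq_natDegree monic.ne_zero, natDegree_eq]
  exact_mod_cast hp.out.ne_zero

theorem adjoin_eq_top [hp : Fact p.Prime] [Fact (Irreducible (artinSchreierPoly p f))] :
    IntermediateField.adjoin k {x p f, y p f} = ⊤ := by
  rw [eq_top_iff]
  rintro z -
  obtain ⟨g, hg, rfl⟩ := exists_mk_eq z
  rw [mk_eq_sum hg]
  have hx : x p f ∈ IntermediateField.adjoin k {x p f, y p f} :=
    IntermediateField.subset_adjoin _ _ (by simp)
  have hy : y p f ∈ IntermediateField.adjoin k {x p f, y p f} :=
    IntermediateField.subset_adjoin _ _ (by simp)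
  refine sum_mem fun i _ => mul_mem ?_ (pow_mem hy i)
  conv in g.coeff i => rw [← RatFunc.num_div_denom (g.coeff i)]
  rw [map_div₀, ← aeval_x, ← aeval_x]
  exact div_mem (IntermediateField.aeval_mem_of_mem _ hx _)
    (IntermediateField.aeval_mem_of_mem _ hx _)
section Integral

variable [hp : Fact p.Prime] [CharP k p] [Fact (Irreducible (artinSchreierPoly p f))]

omit [CharP k p] in
theorem isIntegral_y : IsIntegral k[X] (y p f) := by
  refine ⟨X ^ p - (X + C f), monic_X_pow_sub ?_, ?_⟩
  · rw [degree_X_add_C]; exact_mod_cast hp.out.one_lt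
  · rw [eval₂_sub, eval₂_pow, eval₂_add, eval₂_X, eval₂_C, algebraMap_eq_aeval_x, ← y_pow_sub]
    ring

/-- A function that is integral over `k[x]` has polynomial coefficients with respect to
`1, y, …, y ^ (p - 1)`. Applying the difference operator of the automorphism `y ↦ y + 1` lowers
the degree in `y` and multiplies the leading coefficient by a nonzero integer. -/
theorem coeff_mem_range_of_isIntegral (m : ℕ) (hm : m < p) (g : (RatFunc k)[X])
    (hg : g.natDegree ≤ m) (hint : IsIntegral k[X] (AdjoinRoot.mk (artinSchreierPoly p f) g))
    (i : ℕ) : g.coeff i ∈ Set.range (algebraMap k[X] (RatFunc k)) := by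
  induction m generalizing g i with
  | zero =>
    rw [Nat.le_zero] at hg
    rw [eq_C_of_natDegree_eq_zero hg] at hint ⊢
    rcases Nat.eq_zero_or_pos i with rfl | hi
    · rw [coeff_C_zero]
      rw [AdjoinRoot.mk_C] at hint
      apply IsIntegrallyClosed.isIntegral_iff.1
      exact (isIntegral_algHom_iff (IsScalarTower.toAlgHom k[X] (RatFunc k)
        (ArtinSchreierField p f)) (algebraMap (RatFunc k) (ArtinSchreierField p f)).injective).1 hint
    · rw [coeff_C_of_ne_zero hi.ne']
      exact ⟨0, map_zero _⟩
  | succ m ih =>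
    have : CharP (RatFunc k) p :=
      charP_of_injective_algebraMap (algebraMap k (RatFunc k)).injective p
    -- the automorphism `y ↦ y + 1`
    have hτ : (artinSchreierPoly p f).eval₂
        (Algebra.ofId (RatFunc k) (ArtinSchreierField p f)) (y p f + 1) = 0 := by
      have : CharP (ArtinSchreierField p f) p :=
        charP_of_injective_algebraMap (algebraMap k (ArtinSchreierField p f)).injective p
      rw [eval₂_sub, eval₂_sub, eval₂_pow, eval₂_X, eval₂_C, add_pow_char,
        one_pow]
      have h1 := y_pow_sub (p := p) f
      rw [aeval_x] at h1
      change _ - _ - AdjoinRoot.of _ _ = 0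
      linear_combination h1
    set τ := AdjoinRoot.liftAlgHom _ (Algebra.ofId (RatFunc k) (ArtinSchreierField p f)) _ hτ
    have hτg : τ (AdjoinRoot.mk _ g) = AdjoinRoot.mk _ (taylor 1 g) := by
      rw [AdjoinRoot.liftAlgHom_mk, taylor_apply]
      rw [comp, hom_eval₂, map_add, C_1, map_one, AdjoinRoot.mk_X]
      rfl
    have hΔ : IsIntegral k[X] (AdjoinRoot.mk (artinSchreierPoly p f) (taylor 1 g - g)) := by
      rw [map_sub, ← hτg]
      exact (hint.map (τ.restrictScalars k[X])).sub hint
    have hcoeff : ∀ n, n ≤ 1 → (taylor 1 g - g).coeff (m + n) =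
        if n = 0 then ((m + 1 : ℕ) : RatFunc k) * g.coeff (m + 1) else 0 := by
      intro n hn
      have hd : (hasseDeriv (m + n) g).natDegree < 2 := by
        have := natDegree_hasseDeriv_le g (m + n)
        omega
      rw [coeff_sub, taylor_coeff, eval_eq_sum_range' hd]
      simp only [Finset.sum_range_succ, Finset.sum_range_zero, hasseDeriv_coeff]
      interval_cases n
      · simp [add_comm 1 m]
      · have : g.coeff (1 + (m + 1)) = 0 := coeff_eq_zero_of_natDegree_lt (by omega)
        simp [this]
    have hdeg : (taylor 1 g - g).natDegree ≤ m := by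
      rw [natDegree_le_iff_coeff_eq_zero]
      intro N hN
      rcases (show N = m + 1 ∨ m + 1 < N by omega) with rfl | h
      · simpa using hcoeff 1 le_rfl
      · rw [coeff_sub, coeff_eq_zero_of_natDegree_lt (by rw [natDegree_taylor]; omega),
          coeff_eq_zero_of_natDegree_lt (by omega), sub_zero]
    obtain ⟨q, hq⟩ := ih (by omega) _ hdeg hΔ m
    have h0 := hcoeff 0 zero_le_one
    rw [add_zero, if_pos rfl] at h0
    rw [h0] at hq
    have hm0 : ((m + 1 : ℕ) : k) ≠ 0 := by
      rw [Ne, CharP.cast_eq_zero_iff k p]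
      exact Nat.not_dvd_of_pos_of_lt (by omega) hm
    have hlead : g.coeff (m + 1) = algebraMap k[X] (RatFunc k) (C ((m + 1 : ℕ) : k)⁻¹ * q) := by
      have hm1 : ((m + 1 : ℕ) : RatFunc k) ≠ 0 := by
        rw [Ne, CharP.cast_eq_zero_iff (RatFunc k) p]
        exact Nat.not_dvd_of_pos_of_lt (by omega) hm
      rw [map_mul, hq]
      apply mul_left_cancel₀ hm1
      rw [← mul_assoc, ← map_natCast (algebraMap k[X] (RatFunc k)), ← map_mul, ← map_natCast C,
        ← C_mul, mul_inv_cancel₀ hm0, C_1, map_one, one_mul]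
    set g' := g - C (g.coeff (m + 1)) * X ^ (m + 1) with hg'
    have hg'int : IsIntegral k[X] (AdjoinRoot.mk (artinSchreierPoly p f) g') := by
      rw [hg', map_sub, map_mul, map_pow, AdjoinRoot.mk_C, AdjoinRoot.mk_X]
      refine hint.sub (IsIntegral.mul ?_ (isIntegral_y.pow _))
      rw [hlead, ← aeval_x, ← algebraMap_eq_aeval_x]
      exact isIntegral_algebraMap
    have hg'deg : g'.natDegree ≤ m := by
      rw [natDegree_le_iff_coeff_eq_zero]
      intro N hN
      rw [hg', coeff_sub, coeff_C_mul_X_pow]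
      split_ifs with h
      · rw [h, sub_self]
      · rw [coeff_eq_zero_of_natDegree_lt (by omega), sub_zero]
    obtain ⟨q', hq'⟩ := ih (by omega) g' hg'deg hg'int i
    rw [hg', coeff_sub, coeff_C_mul_X_pow] at hq'
    split_ifs at hq' with h
    · exact ⟨_, by rw [h, hlead]⟩
    · exact ⟨q', by rw [hq', sub_zero]⟩

/-- The functions without poles outside infinity are the polynomials in `x` and `y`. -/
theorem exists_eq_sum_of_forall_mem {z : ArtinSchreierField p f}
    (hz : ∀ V : ValuationSubring (ArtinSchreierField p f),
      (∀ c : k, algebraMap k _ c ∈ V) → x p f ∈ V → y p f ∈ V → z ∈ V) :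
    ∃ q : ℕ → k[X], z = ∑ i ∈ Finset.range p, aeval (x p f) (q i) * y p f ^ i := by
  have hint : IsIntegral k[X] z := by
    by_contra hni
    have : IsIntegrallyClosedIn (integralClosure k[X] (ArtinSchreierField p f)).toSubring
        (ArtinSchreierField p f) :=
      inferInstanceAs (IsIntegrallyClosedIn (integralClosure k[X] (ArtinSchreierField p f))
        (ArtinSchreierField p f))
    obtain ⟨V, hV, hzV⟩ := Subring.exists_le_valuationSubring_of_isIntegrallyClosedIn
      (R := (integralClosure k[X] (ArtinSchreierField p f)).toSubring) (x := z) hni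
    refine hzV (hz V (fun c => hV ?_) (hV ?_) (hV ?_))
    · change IsIntegral k[X] _
      rw [IsScalarTower.algebraMap_apply k k[X] (ArtinSchreierField p f)]
      exact isIntegral_algebraMap
    · change IsIntegral k[X] _
      have := isIntegral_algebraMap (R := k[X]) (A := ArtinSchreierField p f) (x := X)
      rwa [algebraMap_eq_aeval_x, aeval_X] at this
    · exact isIntegral_y
  obtain ⟨g, hg, rfl⟩ := exists_mk_eq z
  choose q hq using coeff_mem_range_of_isIntegral (p - 1) (Nat.sub_lt hp.out.pos one_pos) g
    (by omega) hint
  refine ⟨q, ?_⟩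
  rw [mk_eq_sum hg]
  refine Finset.sum_congr rfl fun i _ => ?_
  rw [aeval_x, hq]

end Integral

end ArtinSchreierField

/-! ### The place at infinity -/

namespace ArtinSchreierField

variable {p : ℕ} [hp : Fact p.Prime] {k : Type*} [Field k] {f : k[X]}
  [Fact (Irreducible (artinSchreierPoly p f))]

/-- A valuation ring of the function field, containing the constants, at which `x` has a pole. -/
structure IsAtInfinity (V : ValuationSubring (ArtinSchreierField p f)) : Prop where
  algebraMap_mem : ∀ c : k, algebraMap k (ArtinSchreierField p f) c ∈ V
  x_notMem : x p f ∉ V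

/-- The pole order at infinity of the function `r(x) y ^ i`. -/
noncomputable def poleOrder (p : ℕ) (f : k[X]) (r : RatFunc k) (i : ℕ) : ℤ :=
  p * r.intDegree + f.natDegree * i

/-- A function with a pole of order one at infinity: `x ^ a y ^ b` with `a p + b deg f = 1`. -/
noncomputable def invUniformizer (p : ℕ) (f : k[X]) [Fact (Irreducible (artinSchreierPoly p f))] :
    ArtinSchreierField p f :=
  x p f ^ Int.gcdA p f.natDegree * y p f ^ Int.gcdB p f.natDegree

omit hp in
theorem aeval_x_mem {V : ValuationSubring (ArtinSchreierField p f)}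
    (hV : ∀ c : k, algebraMap k (ArtinSchreierField p f) c ∈ V) (hx : x p f ∈ V) (q : k[X]) :
    aeval (x p f) q ∈ V := by
  induction q using Polynomial.induction_on' with
  | add q₁ q₂ h₁ h₂ => rw [map_add]; exact add_mem h₁ h₂
  | monomial n a => rw [aeval_monomial]; exact mul_mem (hV a) (pow_mem hx n)

theorem valuation_pow_sub {V : ValuationSubring (ArtinSchreierField p f)}
    {z : ArtinSchreierField p f} (hz : z ∉ V) : V.valuation (z ^ p - z) = V.valuation z ^ p := by
  rw [← V.valuation_le_one_iff, not_le] at hz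
  rw [Valuation.map_sub_eq_of_lt_left, map_pow]
  rw [map_pow]
  exact lt_self_pow₀ hz hp.out.one_lt

theorem y_mem {V : ValuationSubring (ArtinSchreierField p f)}
    (hV : ∀ c : k, algebraMap k (ArtinSchreierField p f) c ∈ V) (hx : x p f ∈ V) :
    y p f ∈ V := by
  by_contra hy
  have h1 := valuation_pow_sub hy
  rw [y_pow_sub] at h1
  have h2 := (V.valuation_le_one_iff _).2 (aeval_x_mem hV hx f)
  rw [← V.valuation_le_one_iff, not_le] at hy
  rw [h1] at h2
  exact absurd h2 (not_le.2 (one_lt_pow₀ hy hp.out.ne_zero))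

namespace IsAtInfinity

variable {V : ValuationSubring (ArtinSchreierField p f)}

omit hp in
theorem one_lt_valuation_x (hV : IsAtInfinity V) : 1 < V.valuation (x p f) := by
  rw [← not_le, V.valuation_le_one_iff]; exact hV.x_notMem

omit hp in
theorem valuation_algebraMap (hV : IsAtInfinity V) {c : k} (hc : c ≠ 0) :
    V.valuation (algebraMap k _ c) = 1 := by
  apply le_antisymm ((V.valuation_le_one_iff _).2 (hV.algebraMap_mem c))
  have h1 := (V.valuation_le_one_iff _).2 (hV.algebraMap_mem c⁻¹)
  have h0 : algebraMap k (ArtinSchreierField p f) c ≠ 0 := (_root_.map_ne_zero _).2 hc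
  rw [map_inv₀, map_inv₀] at h1
  exact (inv_le_one₀ (zero_lt_iff.2 ((Valuation.ne_zero_iff _).2 h0))).1 h1

omit hp in
theorem valuation_aeval_x (hV : IsAtInfinity V) {q : k[X]} (hq : q ≠ 0) :
    V.valuation (aeval (x p f) q) = V.valuation (x p f) ^ q.natDegree := by
  have hterm : ∀ i, q.coeff i ≠ 0 →
      V.valuation (algebraMap k _ (q.coeff i) * x p f ^ i) = V.valuation (x p f) ^ i := by
    intro i hi
    rw [map_mul, hV.valuation_algebraMap hi, one_mul, map_pow]
  have hlead : q.coeff q.natDegree ≠ 0 := leadingCoeff_ne_zero.2 hq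
  have hx := hV.one_lt_valuation_x
  rw [aeval_eq_sum_range]
  simp only [Algebra.smul_def]
  rw [Valuation.map_sum_eq_of_lt _ (j := q.natDegree) (Finset.mem_range.2 (by omega)),
    hterm _ hlead]
  intro i hi
  rw [Finset.mem_sdiff, Finset.mem_range, Finset.mem_singleton] at hi
  rw [hterm _ hlead]
  by_cases h0 : q.coeff i = 0
  · rw [h0, map_zero, zero_mul, map_zero]
    exact pow_pos (zero_lt_one.trans hx) _
  · rw [hterm _ h0]
    exact pow_lt_pow_right₀ hx (by omega)

omit hp in
theorem valuation_of (hV : IsAtInfinity V) {r : RatFunc k} (hr : r ≠ 0) :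
    V.valuation (AdjoinRoot.of (artinSchreierPoly p f) r) =
      V.valuation (x p f) ^ r.intDegree := by
  have hx0 : V.valuation (x p f) ≠ 0 := (zero_lt_one.trans hV.one_lt_valuation_x).ne'
  conv_lhs => rw [← RatFunc.num_div_denom r]
  rw [map_div₀, ← aeval_x, ← aeval_x, map_div₀, hV.valuation_aeval_x (RatFunc.num_ne_zero hr),
    hV.valuation_aeval_x r.denom_ne_zero, RatFunc.intDegree, zpow_sub₀ hx0, zpow_natCast,
    zpow_natCast]

variable (hf : ¬ p ∣ f.natDegree)
include hf

theorem valuation_y (hV : IsAtInfinity V) :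
    V.valuation (y p f) ^ p = V.valuation (x p f) ^ f.natDegree := by
  have hf0 : f ≠ 0 := by rintro rfl; exact hf (by simp)
  have hx := hV.one_lt_valuation_x
  have h1 := hV.valuation_aeval_x hf0
  rw [← y_pow_sub] at h1
  rw [← h1, valuation_pow_sub]
  intro hy
  have h2 := (V.valuation_le_one_iff _).2 (sub_mem (pow_mem hy p) hy)
  rw [h1] at h2
  refine absurd h2 (not_le.2 (one_lt_pow₀ hx ?_))
  intro h0
  exact hf (by rw [h0]; exact dvd_zero p)

omit hf [Fact (Irreducible (artinSchreierPoly p f))] in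
theorem bezout (hf : ¬ p ∣ f.natDegree) :
    (p : ℤ) * Int.gcdA p f.natDegree + f.natDegree * Int.gcdB p f.natDegree = 1 := by
  have := Int.gcd_eq_gcd_ab p f.natDegree
  rw [Int.gcd_natCast_natCast, (Nat.Prime.coprime_iff_not_dvd hp.out).2 hf] at this
  exact_mod_cast this.symm

theorem valuation_invUniformizer (hV : IsAtInfinity V) :
    V.valuation (x p f) = V.valuation (invUniformizer p f) ^ p ∧
      V.valuation (y p f) = V.valuation (invUniformizer p f) ^ f.natDegree := by
  have hb := bezout hf
  have hy := hV.valuation_y hf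
  have hx0 : V.valuation (x p f) ≠ 0 := (zero_lt_one.trans hV.one_lt_valuation_x).ne'
  have hy0 : V.valuation (y p f) ≠ 0 := by
    intro h0
    rw [h0, zero_pow hp.out.ne_zero] at hy
    exact pow_ne_zero _ hx0 hy.symm
  rw [← zpow_natCast, ← zpow_natCast] at hy
  rw [invUniformizer, map_mul, map_zpow₀, map_zpow₀]
  set a := Int.gcdA p f.natDegree
  set b := Int.gcdB p f.natDegree
  set vx := V.valuation (x p f)
  set vy := V.valuation (y p f)
  constructor
  · rw [← zpow_natCast, mul_zpow, ← zpow_mul, ← zpow_mul, mul_comm b, zpow_mul vy, hy, ← zpow_mul,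
      ← zpow_add₀ hx0, mul_comm a, hb, zpow_one]
  · rw [← zpow_natCast, mul_zpow, ← zpow_mul, ← zpow_mul, mul_comm a, zpow_mul vx, ← hy, ← zpow_mul,
      ← zpow_add₀ hy0, mul_comm b, hb, zpow_one]

theorem one_lt_valuation_invUniformizer (hV : IsAtInfinity V) :
    1 < V.valuation (invUniformizer p f) := by
  by_contra! h
  have := hV.one_lt_valuation_x
  rw [(hV.valuation_invUniformizer hf).1] at this
  exact absurd this (not_lt.2 (pow_le_one₀ zero_le h))

theorem valuation_of_mul_y_pow (hV : IsAtInfinity V) {r : RatFunc k} (hr : r ≠ 0) (i : ℕ) :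
    V.valuation (AdjoinRoot.of (artinSchreierPoly p f) r * y p f ^ i) =
      V.valuation (invUniformizer p f) ^ poleOrder p f r i := by
  have ht0 : V.valuation (invUniformizer p f) ≠ 0 :=
    (zero_lt_one.trans (hV.one_lt_valuation_invUniformizer hf)).ne'
  obtain ⟨hx, hy⟩ := hV.valuation_invUniformizer hf
  rw [map_mul, map_pow, hV.valuation_of hr, hx, hy, poleOrder, zpow_add₀ ht0, zpow_mul, zpow_mul,
    zpow_natCast, zpow_natCast, zpow_natCast]

end IsAtInfinity

omit [Fact (Irreducible (artinSchreierPoly p f))] in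
theorem poleOrder_ne (hf : ¬ p ∣ f.natDegree) {r s : RatFunc k} {i j : ℕ} (hi : i < p) (hj : j < p)
    (hij : i ≠ j) : poleOrder p f r i ≠ poleOrder p f s j := by
  intro h
  have hcop : IsCoprime (p : ℤ) f.natDegree :=
    Nat.isCoprime_iff_coprime.2 ((Nat.Prime.coprime_iff_not_dvd hp.out).2 hf)
  have h1 : (p : ℤ) ∣ f.natDegree * ((i : ℤ) - j) :=
    ⟨s.intDegree - r.intDegree, by unfold poleOrder at h; linear_combination h⟩
  obtain ⟨m, hm⟩ := hcop.dvd_of_dvd_mul_left h1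
  have h2 : (i : ℤ) - j < p := by omega
  have h3 : -(p : ℤ) < (i : ℤ) - j := by omega
  rw [hm] at h2 h3
  have hp0 : (0 : ℤ) < p := by exact_mod_cast hp.out.pos
  have h4 : m < 1 := by by_contra!; nlinarith
  have h5 : -1 < m := by by_contra!; nlinarith
  have : m = 0 := by omega
  rw [this, mul_zero] at hm
  omega

/-- The pole order of a sum `∑ r_i(x) y ^ i` is the largest pole order of its terms, since these are
different. -/
theorem exists_valuation_sum_eq (hf : ¬ p ∣ f.natDegree) {r : ℕ → RatFunc k}
    (hr : ∃ i < p, r i ≠ 0) :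
    ∃ j < p, r j ≠ 0 ∧ (∀ i < p, r i ≠ 0 → poleOrder p f (r i) i ≤ poleOrder p f (r j) j) ∧
      ∀ V : ValuationSubring (ArtinSchreierField p f), IsAtInfinity V →
        V.valuation (∑ i ∈ Finset.range p, AdjoinRoot.of (artinSchreierPoly p f) (r i) * y p f ^ i)
          = V.valuation (invUniformizer p f) ^ poleOrder p f (r j) j := by
  classical
  obtain ⟨i₀, hi₀, hri₀⟩ := hr
  obtain ⟨j, hj, hmax⟩ := Finset.exists_max_image ((Finset.range p).filter fun i => r i ≠ 0)
    (fun i => poleOrder p f (r i) i) ⟨i₀, by simp [hi₀, hri₀]⟩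
  simp only [Finset.mem_filter, Finset.mem_range] at hj hmax
  refine ⟨j, hj.1, hj.2, fun i hi h => hmax i ⟨hi, h⟩, fun V hV => ?_⟩
  have ht := hV.one_lt_valuation_invUniformizer hf
  rw [Valuation.map_sum_eq_of_lt _ (j := j) (Finset.mem_range.2 hj.1),
    hV.valuation_of_mul_y_pow hf hj.2]
  intro i hi
  rw [Finset.mem_sdiff, Finset.mem_range, Finset.mem_singleton] at hi
  rw [hV.valuation_of_mul_y_pow hf hj.2]
  by_cases h0 : r i = 0
  · rw [h0, map_zero, zero_mul, map_zero]
    exact zpow_pos (zero_lt_one.trans ht) _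
  · rw [hV.valuation_of_mul_y_pow hf h0]
    exact zpow_lt_zpow_right₀ ht
      (lt_of_le_of_ne (hmax i ⟨hi.1, h0⟩) (poleOrder_ne hf hi.1 hj.1 hi.2))

theorem exists_valuation_eq_zpow (hf : ¬ p ∣ f.natDegree) {z : ArtinSchreierField p f}
    (hz : z ≠ 0) : ∃ m : ℤ, ∀ V : ValuationSubring (ArtinSchreierField p f), IsAtInfinity V →
      V.valuation z = V.valuation (invUniformizer p f) ^ m := by
  obtain ⟨g, hg, rfl⟩ := exists_mk_eq z
  have hg0 : ∃ i < p, g.coeff i ≠ 0 := by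
    refine ⟨g.natDegree, hg, leadingCoeff_ne_zero.2 ?_⟩
    rintro rfl
    exact hz (map_zero _)
  obtain ⟨j, -, -, -, h⟩ := exists_valuation_sum_eq hf hg0
  rw [mk_eq_sum hg]
  exact ⟨_, h⟩

/-- There is at most one place at infinity. -/
theorem IsAtInfinity.unique (hf : ¬ p ∣ f.natDegree)
    {V V' : ValuationSubring (ArtinSchreierField p f)} (hV : IsAtInfinity V)
    (hV' : IsAtInfinity V') : V = V' := by
  have key : ∀ {V V' : ValuationSubring (ArtinSchreierField p f)}, IsAtInfinity V →
      IsAtInfinity V' → ∀ z ∈ V, z ∈ V' := by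
    intro V V' hV hV' z hz
    by_cases h0 : z = 0
    · rw [h0]; exact zero_mem _
    obtain ⟨m, hm⟩ := exists_valuation_eq_zpow hf h0
    rw [← V.valuation_le_one_iff, hm V hV,
      zpow_le_one_iff_right₀ (hV.one_lt_valuation_invUniformizer hf)] at hz
    rwa [← V'.valuation_le_one_iff, hm V' hV',
      zpow_le_one_iff_right₀ (hV'.one_lt_valuation_invUniformizer hf)]
  exact SetLike.ext fun z => ⟨key hV hV' z, key hV' hV z⟩

variable (p f) in
/-- There is a place at infinity: a valuation ring that dominates the local ring of `k[1/x]` at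
`1/x`. -/
theorem exists_isAtInfinity : ∃ V : ValuationSubring (ArtinSchreierField p f), IsAtInfinity V := by
  set A := (Algebra.adjoin k {(x p f)⁻¹}).toSubring
  set w : A := ⟨(x p f)⁻¹, Algebra.subset_adjoin rfl⟩
  have hI : Ideal.span {w} ≠ ⊤ := by
    rw [Ne, Ideal.eq_top_iff_one, Ideal.mem_span_singleton']
    rintro ⟨⟨u, hu⟩, h⟩
    have h1 : u * (x p f)⁻¹ = 1 := congrArg Subtype.val h
    have hu' : u ∈ Algebra.adjoin k {(x p f)⁻¹} := hu
    rw [Algebra.adjoin_singleton_eq_range_aeval] at hu'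
    obtain ⟨q, hq⟩ := hu'
    have htr : Transcendental k (x p f)⁻¹ := fun h => transcendental_x f (inv_inv (x p f) ▸ h.inv)
    rw [transcendental_iff] at htr
    have h2 := htr (q * X - 1) (by
      rw [map_sub, map_mul, aeval_X, map_one, sub_eq_zero, ← h1, ← hq]
      rfl)
    have h3 := congrArg (fun g => g.coeff 0) h2
    simp at h3
  obtain ⟨V, hAV, hVI⟩ := Ideal.image_subset_nonunits_valuationSubring _ hI
  refine ⟨V, fun c => hAV (Subalgebra.algebraMap_mem _ c), ?_⟩
  have h1 : (x p f)⁻¹ ∈ V.nonunits := hVI ⟨w, Ideal.subset_span rfl, rfl⟩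
  rw [ValuationSubring.mem_nonunits_iff] at h1
  have hx0 : x p f ≠ 0 := fun h => transcendental_x (p := p) f (h ▸ isAlgebraic_zero)
  rw [← V.valuation_le_one_iff, not_le, ← inv_inv (x p f), map_inv₀]
  exact (one_lt_inv₀ (zero_lt_iff.2 ((Valuation.ne_zero_iff _).2 (inv_ne_zero hx0)))).2 h1

end ArtinSchreierField

/-! ### Automorphisms that fix the place at infinity -/

namespace ArtinSchreierField

variable {p : ℕ} [hp : Fact p.Prime] {k : Type*} [Field k] {f : k[X]}
  [Fact (Irreducible (artinSchreierPoly p f))]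
  {σ : ArtinSchreierField p f ≃ₐ[k] ArtinSchreierField p f}

omit hp in
theorem apply_mem_of_smul_eq {V : ValuationSubring (ArtinSchreierField p f)} (hσ : σ • V = V)
    (z : ArtinSchreierField p f) : σ z ∈ V ↔ z ∈ V := by
  conv_lhs => rw [← hσ]
  exact ValuationSubring.smul_mem_pointwise_smul_iff (g := σ) (S := V) (x := z)

/-- An automorphism that fixes the place at infinity preserves pole orders there. -/
theorem valuation_apply (hf : ¬ p ∣ f.natDegree) {V : ValuationSubring (ArtinSchreierField p f)}
    (hV : IsAtInfinity V) (hσ : σ • V = V) (z : ArtinSchreierField p f) :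
    V.valuation (σ z) = V.valuation z := by
  have hle : ∀ a b : ArtinSchreierField p f, b ≠ 0 →
      (V.valuation (σ a) ≤ V.valuation (σ b) ↔ V.valuation a ≤ V.valuation b) := by
    have hdiv : ∀ a b : ArtinSchreierField p f, b ≠ 0 →
        (V.valuation a ≤ V.valuation b ↔ a / b ∈ V) := by
      intro a b hb
      rw [← V.valuation_le_one_iff, map_div₀,
        div_le_one₀ (zero_lt_iff.2 ((Valuation.ne_zero_iff _).2 hb))]
    intro a b hb
    rw [hdiv _ _ ((map_ne_zero_iff _ σ.injective).2 hb), hdiv _ _ hb, ← map_div₀,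
      apply_mem_of_smul_eq hσ]
  have heq : ∀ a b : ArtinSchreierField p f, a ≠ 0 → b ≠ 0 →
      V.valuation a = V.valuation b → V.valuation (σ a) = V.valuation (σ b) :=
    fun a b ha hb h => le_antisymm ((hle a b hb).2 h.le) ((hle b a ha).2 h.ge)
  set t := invUniformizer p f with ht
  have ht1 := hV.one_lt_valuation_invUniformizer hf
  rw [← ht] at ht1
  have hvt0 : V.valuation t ≠ 0 := (zero_lt_one.trans ht1).ne'
  have ht0 : t ≠ 0 := (Valuation.ne_zero_iff _).1 hvt0
  have hσt0 : σ t ≠ 0 := (map_ne_zero_iff _ σ.injective).2 ht0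
  obtain ⟨m, hm⟩ := exists_valuation_eq_zpow hf hσt0
  have hm := hm V hV
  have key : ∀ w : ArtinSchreierField p f, w ≠ 0 → ∀ n : ℤ, V.valuation w = V.valuation t ^ n →
      V.valuation (σ w) = V.valuation t ^ (m * n) := by
    intro w hw n hn
    rw [← map_zpow₀] at hn
    rw [heq w (t ^ n) hw (zpow_ne_zero _ ht0) hn, map_zpow₀, map_zpow₀, hm, ← zpow_mul]
  have hs0 : σ.symm t ≠ 0 := (map_ne_zero_iff _ σ.symm.injective).2 ht0
  obtain ⟨n, hn⟩ := exists_valuation_eq_zpow hf hs0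
  have h1 := key _ hs0 n (hn V hV)
  have hinj : Function.Injective fun n : ℤ => V.valuation t ^ n := zpow_right_injective₀
    (zero_lt_one.trans ht1) ht1.ne'
  rw [AlgEquiv.apply_symm_apply] at h1
  have h2 : m * n = 1 := (hinj (by simpa using h1)).symm
  have hm0 : 0 < m := by
    have h3 : 1 < V.valuation (σ t) := by
      rw [← not_le, V.valuation_le_one_iff, apply_mem_of_smul_eq hσ, ← V.valuation_le_one_iff,
        not_le]
      exact ht1
    rw [hm] at h3
    exact (one_lt_zpow_iff_right₀ ht1).1 h3
  have hm1 : m = 1 := Int.eq_one_of_mul_eq_one_right hm0.le h2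
  by_cases hz : z = 0
  · rw [hz, map_zero]
  obtain ⟨n, hn⟩ := exists_valuation_eq_zpow hf hz
  rw [key z hz n (hn V hV), hn V hV, hm1, one_mul]

/-- Let `σ` fix the place at infinity, and let `w` be a polynomial in `x` and `y`. Then `σ(w)` is a
polynomial in `x` and `y` as well, with the same pole order `N` at infinity. -/
theorem exists_apply_eq_sum [CharP k p] (hf : ¬ p ∣ f.natDegree)
    (hσ : ∀ V : ValuationSubring (ArtinSchreierField p f), IsAtInfinity V → σ • V = V)
    {w : ArtinSchreierField p f}
    (hw : ∀ V : ValuationSubring (ArtinSchreierField p f), x p f ∈ V → y p f ∈ V → w ∈ V)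
    (N : ℕ) (hN : ∀ V : ValuationSubring (ArtinSchreierField p f), IsAtInfinity V →
      V.valuation w = V.valuation (invUniformizer p f) ^ N) :
    ∃ q : ℕ → k[X], σ w = ∑ i ∈ Finset.range p, aeval (x p f) (q i) * y p f ^ i ∧
      (∀ i < p, q i ≠ 0 → p * (q i).natDegree + f.natDegree * i ≤ N) ∧
      ∃ j < p, q j ≠ 0 ∧ p * (q j).natDegree + f.natDegree * j = N := by
  obtain ⟨V, hV⟩ := exists_isAtInfinity p f
  obtain ⟨q, hq⟩ := exists_eq_sum_of_forall_mem (f := f) (p := p) (z := σ w) (by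
    intro V' hc hx hy
    change σ • w ∈ V'
    rw [← ValuationSubring.mem_inv_pointwise_smul_iff]
    have hc' : ∀ c : k, algebraMap k (ArtinSchreierField p f) c ∈ σ⁻¹ • V' := fun c => by
      rw [ValuationSubring.mem_inv_pointwise_smul_iff, AlgEquiv.smul_def, AlgEquiv.commutes]
      exact hc c
    have hx' : x p f ∈ σ⁻¹ • V' := by
      by_contra hx'
      have h1 := hσ _ ⟨hc', hx'⟩
      rw [smul_inv_smul] at h1
      exact hx' (h1 ▸ hx)
    exact hw _ hx' (y_mem hc' hx'))
  have ht1 := hV.one_lt_valuation_invUniformizer hf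
  have hinj : Function.Injective fun n : ℤ => V.valuation (invUniformizer p f) ^ n :=
    zpow_right_injective₀ (zero_lt_one.trans ht1) ht1.ne'
  have hval := (valuation_apply hf hV (hσ V hV) w).trans (hN V hV)
  have hqsum := hq
  simp only [aeval_x] at hq
  have hpo : ∀ i, poleOrder p f (algebraMap k[X] (RatFunc k) (q i)) i =
      ((p * (q i).natDegree + f.natDegree * i : ℕ) : ℤ) := by
    intro i
    rw [poleOrder, RatFunc.intDegree_polynomial]
    push_cast
    ring
  have hne : ∀ i, algebraMap k[X] (RatFunc k) (q i) ≠ 0 ↔ q i ≠ 0 := fun i =>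
    (map_ne_zero_iff _ (RatFunc.algebraMap_injective k))
  obtain ⟨j, hj, hqj, hmax, hvj⟩ := exists_valuation_sum_eq (f := f) hf
    (r := fun i => algebraMap k[X] (RatFunc k) (q i)) (by
      by_contra! h
      rw [hq, Finset.sum_eq_zero fun i hi => by rw [h i (Finset.mem_range.1 hi), map_zero, zero_mul],
        map_zero] at hval
      exact pow_ne_zero _ (zero_lt_one.trans ht1).ne' hval.symm)
  have hjN : p * (q j).natDegree + f.natDegree * j = N := by
    have h1 := hvj V hV
    rw [← hq, hval, ← zpow_natCast] at h1
    have h2 := hinj h1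
    rw [hpo] at h2
    exact_mod_cast h2.symm
  refine ⟨q, hqsum, fun i hi h => ?_, j, hj, (hne j).1 hqj, hjN⟩
  have h1 := hmax i hi ((hne i).2 h)
  rw [hpo, hpo, hjN] at h1
  exact_mod_cast h1

/-- A polynomial relation of degree less than `p` in `y` is trivial. -/
theorem eq_zero_of_eval₂_eq_zero {H : k[X][X]} (hH : H.natDegree < p)
    (h : H.eval₂ (aeval (x p f) : k[X] →ₐ[k] ArtinSchreierField p f).toRingHom (y p f) = 0) :
    H = 0 := by
  have h1 : AdjoinRoot.mk (artinSchreierPoly p f)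
      (H.map (algebraMap k[X] (RatFunc k))) = 0 := by
    rw [← h, eval₂_eq_sum_range' _ hH, mk_eq_sum (by rwa [natDegree_map_eq_of_injective
      (RatFunc.algebraMap_injective k)])]
    refine Finset.sum_congr rfl fun i _ => ?_
    rw [coeff_map, ← aeval_x]
    rfl
  rw [AdjoinRoot.mk_eq_zero] at h1
  have h2 := eq_zero_of_dvd_of_degree_lt h1 (by
    rw [degree_eq_natDegree (monic (p := p) (f := f)).ne_zero, natDegree_eq]
    refine lt_of_le_of_lt degree_map_le (degree_le_natDegree.trans_lt ?_)
    exact_mod_cast hH)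
  exact (Polynomial.map_eq_zero_iff (RatFunc.algebraMap_injective k)).1 h2

theorem eq_of_add_mul_y_eq {A B A' B' : k[X]} (h : aeval (x p f) A + aeval (x p f) B * y p f =
    aeval (x p f) A' + aeval (x p f) B' * y p f) : A = A' ∧ B = B' := by
  have h1 := eq_zero_of_eval₂_eq_zero (p := p) (f := f) (H := C (B - B') * X + C (A - A'))
    (natDegree_linear_le.trans_lt hp.out.one_lt) (by
      rw [eval₂_add, eval₂_mul, eval₂_C, eval₂_C, eval₂_X]
      change aeval (x p f) (B - B') * y p f + aeval (x p f) (A - A') = 0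
      rw [map_sub, map_sub]
      linear_combination h)
  have h2 := congrArg (fun g => g.coeff 0) h1
  have h3 := congrArg (fun g => g.coeff 1) h1
  simp only [coeff_add, coeff_C_mul, coeff_X_zero, coeff_X_one, coeff_C_zero, coeff_C_succ,
    coeff_zero, mul_zero, zero_add, mul_one, add_zero] at h2 h3
  exact ⟨sub_eq_zero.1 h2, sub_eq_zero.1 h3⟩

/-- An affine substitution of `p`-power order is unipotent. -/
theorem eq_one_of_pow_eq_one [CharP k p] {α c γ : k} {B : k[X]}
    (hx : σ (x p f) = aeval (x p f) (C α * X + C c))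
    (hy : σ (y p f) = algebraMap k _ γ * y p f + aeval (x p f) B) {m : ℕ}
    (hσ : σ ^ p ^ m = 1) : α = 1 ∧ γ = 1 := by
  have hone : ∀ u : k, u ^ p ^ m = 1 → u = 1 := by
    intro u hu
    rw [← sub_eq_zero]
    apply pow_eq_zero_iff (pow_pos hp.out.pos m).ne' |>.1
    rw [sub_pow_char_pow, hu, one_pow, sub_self]
  have hσA : ∀ A : k[X], σ (aeval (x p f) A) = aeval (x p f) (A.comp (C α * X + C c)) := by
    intro A
    have := aeval_algHom_apply (σ : ArtinSchreierField p f →ₐ[k] ArtinSchreierField p f) (x p f) A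
    change aeval (σ (x p f)) A = σ _ at this
    rw [← this, hx, aeval_comp]
  have key : ∀ n : ℕ, (∃ c' : k, (σ ^ n) (x p f) = aeval (x p f) (C (α ^ n) * X + C c')) ∧
      ∃ B' : k[X], (σ ^ n) (y p f) = algebraMap k _ (γ ^ n) * y p f + aeval (x p f) B' := by
    intro n
    induction n with
    | zero => exact ⟨⟨0, by simp⟩, ⟨0, by simp⟩⟩
    | succ n ih =>
      obtain ⟨⟨c', hc'⟩, ⟨B', hB'⟩⟩ := ih
      refine ⟨⟨α ^ n * c + c', ?_⟩, ⟨C (γ ^ n) * B + B'.comp (C α * X + C c), ?_⟩⟩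
      · rw [pow_succ', AlgEquiv.mul_apply, hc', hσA]
        congr 1
        simp only [add_comp, mul_comp, C_comp, X_comp, pow_succ, C_mul, C_add]
        ring
      · rw [pow_succ', AlgEquiv.mul_apply, hB', map_add, map_mul, AlgEquiv.commutes, hy, hσA,
          map_add, map_mul, aeval_C, pow_succ, map_mul]
        ring
  obtain ⟨⟨c', hc'⟩, ⟨B', hB'⟩⟩ := key (p ^ m)
  rw [hσ, AlgEquiv.one_apply] at hc' hB'
  constructor
  · apply hone
    have h1 := eq_of_add_mul_y_eq (p := p) (f := f) (A := X) (B := 0)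
      (A' := C (α ^ p ^ m) * X + C c') (B' := 0) (by rw [← hc', aeval_X])
    have h2 := congrArg (fun g => g.coeff 1) h1.1
    simp only [coeff_add, coeff_C_mul, coeff_X_one, coeff_C_succ, add_zero, mul_one] at h2
    exact h2.symm
  · apply hone
    have h1 := eq_of_add_mul_y_eq (p := p) (f := f) (A := 0) (B := 1)
      (A' := B') (B' := C (γ ^ p ^ m)) (by
        rw [map_zero, map_one, aeval_C, zero_add, one_mul, add_comm, ← hB'])
    have h2 := congrArg (fun g => g.coeff 0) h1.2
    simp only [coeff_one_zero, coeff_C_zero] at h2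
    exact h2.symm

end ArtinSchreierField

/-! ### The automorphisms `σ_{b,c}` of `C_R` and the Sylow subgroup `P` -/

namespace AdditivePolynomial

variable {p h : ℕ} [hp : Fact p.Prime] [hp2 : Fact (p ≠ 2)] {F : Type*} [Field F] [CharP F p]
  {R : AdditivePolynomial p h F} {k : Type*} [Field k] [Algebra F k]

/-- The automorphism `σ` is `σ_{b,c} : (x, y) ↦ (x + c, y + b + B_c(x))`, where `B = B_c`. -/
structure IsTranslation (σ : R.FunctionField k ≃ₐ[k] R.FunctionField k) (c b : k) (B : k[X]) :
    Prop where
  isB : R.IsB c B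
  pow_sub : b ^ p - b = c * (R.polyOver k).eval c
  apply_x : σ (R.x k) = R.x k + algebraMap k _ c
  apply_y : σ (R.y k) = R.y k + algebraMap k _ b + aeval (R.x k) B

theorem y_pow_sub : R.y k ^ p - R.y k = aeval (R.x k) (X * R.polyOver k) :=
  ArtinSchreierField.y_pow_sub _

theorem transcendental_x : Transcendental k (R.x k) :=
  ArtinSchreierField.transcendental_x _

theorem aeval_x_injective : Function.Injective (aeval (R.x k) : k[X] → R.FunctionField k) :=
  transcendental_iff_injective.1 transcendental_x

omit hp2 [CharP F p] in
theorem natDegree_rhs : (R.rhs k).natDegree = p ^ h + 1 := natDegree_X_mul_polyOver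

omit [CharP F p] in
theorem not_dvd_natDegree_rhs : ¬ p ∣ (R.rhs k).natDegree := by
  rw [natDegree_rhs]
  rcases Nat.eq_zero_or_pos h with rfl | hh
  · intro hd
    exact hp2.out ((Nat.prime_dvd_prime_iff_eq hp.out Nat.prime_two).1 (by simpa using hd))
  · intro hd
    exact hp.out.one_lt.ne' (Nat.dvd_one.1 ((Nat.dvd_add_right (dvd_pow_self p hh.ne')).1 hd))

theorem mem_placesAtInfinity_iff {V : ValuationSubring (R.FunctionField k)} :
    V ∈ R.placesAtInfinity k ↔ ArtinSchreierField.IsAtInfinity V := by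
  constructor
  · rintro ⟨hV, hxy⟩
    exact ⟨hV, fun hx => hxy ⟨hx, ArtinSchreierField.y_mem hV hx⟩⟩
  · rintro ⟨hV, hx⟩
    exact ⟨hV, fun hxy => hx hxy.1⟩

theorem mem_aut0_iff {σ : R.FunctionField k ≃ₐ[k] R.FunctionField k} :
    σ ∈ R.aut0 k ↔ ∀ V : ValuationSubring (R.FunctionField k),
      ArtinSchreierField.IsAtInfinity V → σ • V = V := by
  simp only [aut0, Subgroup.mem_iInf, MulAction.mem_stabilizer_iff, mem_placesAtInfinity_iff]

section

variable [CharP k p]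

omit [CharP k p] in
theorem IsTranslation.apply_aeval_x {σ : R.FunctionField k ≃ₐ[k] R.FunctionField k} {c b : k}
    {B : k[X]} (hσ : IsTranslation σ c b B) (A : k[X]) :
    σ (aeval (R.x k) A) = aeval (R.x k) (A.comp (X + C c)) := by
  have := aeval_algHom_apply (σ : R.FunctionField k →ₐ[k] R.FunctionField k) (R.x k) A
  change aeval (σ (R.x k)) A = σ _ at this
  rw [← this, hσ.apply_x, aeval_comp]
  simp

theorem IsTranslation.one : IsTranslation (1 : R.FunctionField k ≃ₐ[k] R.FunctionField k) 0 0 0 :=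
  ⟨isB_zero R, by simp [hp.out.ne_zero], by simp, by simp⟩

theorem IsTranslation.mul {σ τ : R.FunctionField k ≃ₐ[k] R.FunctionField k} {c b d e : k}
    {B D : k[X]} (hσ : IsTranslation σ c b B) (hτ : IsTranslation τ d e D) :
    IsTranslation (σ * τ) (c + d) (b + e + D.eval c) (B + D) := by
  refine ⟨hσ.isB.add hτ.isB, ?_, ?_, ?_⟩
  · have h1 := congrArg (Polynomial.eval c) ((isB_iff R).1 hτ.isB).2
    simp only [Polynomial.eval_sub, Polynomial.eval_pow, Polynomial.eval_add, eval_mul, eval_C,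
      eval_X] at h1
    rw [polyOver_eval_add, add_pow_char, add_pow_char]
    linear_combination hσ.pow_sub + hτ.pow_sub + h1
  · rw [AlgEquiv.mul_apply, hτ.apply_x, map_add, hσ.apply_x, AlgEquiv.commutes, map_add]
    ring
  · rw [AlgEquiv.mul_apply, hτ.apply_y, map_add, map_add, hσ.apply_y, AlgEquiv.commutes,
      hσ.apply_aeval_x, hτ.isB.comp]
    simp only [map_add, aeval_C]
    ring

omit [CharP k p] in
theorem IsTranslation.ext {σ τ : R.FunctionField k ≃ₐ[k] R.FunctionField k} {c b : k}
    {B : k[X]} (hσ : IsTranslation σ c b B) (hτ : IsTranslation τ c b B) : σ = τ := by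
  have h : (σ : R.FunctionField k →ₐ[k] R.FunctionField k) = τ := by
    apply ArtinSchreierField.algHom_ext
    · exact hσ.apply_x.trans hτ.apply_x.symm
    · exact hσ.apply_y.trans hτ.apply_y.symm
  exact AlgEquiv.ext fun z => AlgHom.congr_fun h z

omit [CharP k p] in
theorem IsTranslation.eq_of_apply_x {σ : R.FunctionField k ≃ₐ[k] R.FunctionField k} {c b c' : k}
    {B : k[X]} (hσ : IsTranslation σ c b B)
    (hx : σ (R.x k) = R.x k + algebraMap k _ c') : c' = c := by
  rw [hσ.apply_x] at hx
  exact ((algebraMap k (R.FunctionField k)).injective (add_left_cancel hx)).symm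

/-- The numbers `c`, `b` and the polynomial `B` are determined by the automorphism. -/
theorem IsTranslation.unique {σ : R.FunctionField k ≃ₐ[k] R.FunctionField k} {c b d e : k}
    {B D : k[X]} (hσ : IsTranslation σ c b B) (hσ' : IsTranslation σ d e D) :
    c = d ∧ b = e ∧ B = D := by
  have h1 : c = d := hσ'.eq_of_apply_x hσ.apply_x
  subst h1
  have h2 := hσ.isB.unique hσ'.isB
  subst h2
  refine ⟨rfl, ?_, rfl⟩
  have h3 := hσ.apply_y.symm.trans hσ'.apply_y
  exact (algebraMap k (R.FunctionField k)).injective (add_left_cancel (add_right_cancel h3))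

theorem exists_algHom_translation {c b : k} {B : k[X]} (hB : R.IsB c B)
    (hb : b ^ p - b = c * (R.polyOver k).eval c) :
    ∃ φ : R.FunctionField k →ₐ[k] R.FunctionField k, φ (R.x k) = R.x k + algebraMap k _ c ∧
      φ (R.y k) = R.y k + algebraMap k _ b + aeval (R.x k) B := by
  have : CharP (R.FunctionField k) p :=
    charP_of_injective_algebraMap (algebraMap k (R.FunctionField k)).injective p
  apply ArtinSchreierField.exists_algHom
  · intro halg
    apply transcendental_x (R := R) (k := k)
    have := halg.sub (isAlgebraic_algebraMap (R := k) c)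
    rwa [add_sub_cancel_right] at this
  · have h1 := congrArg (aeval (R.x k)) ((isB_iff R).1 hB).2
    have h2 := congrArg (algebraMap k (R.FunctionField k)) hb
    have h3 : aeval (R.x k + algebraMap k _ c) (R.rhs k) =
        aeval (R.x k) ((X * R.polyOver k).comp (X + C c)) := by
      rw [aeval_comp]; simp
    rw [h3, mul_comp, X_comp, polyOver_comp, add_pow_char, add_pow_char]
    have h4 := y_pow_sub (R := R) (k := k)
    simp only [map_sub, map_add, map_mul, map_pow, aeval_C, aeval_X] at h1 h2 h4 ⊢
    linear_combination h1 + h2 + h4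

theorem exists_isTranslation {c b : k} {B : k[X]} (hB : R.IsB c B)
    (hb : b ^ p - b = c * (R.polyOver k).eval c) :
    ∃ σ : R.FunctionField k ≃ₐ[k] R.FunctionField k, IsTranslation σ c b B := by
  obtain ⟨φ, hφx, hφy⟩ := exists_algHom_translation hB hb
  have hb' : (-b + B.eval c) ^ p - (-b + B.eval c) = -c * (R.polyOver k).eval (-c) := by
    have h1 := congrArg (Polynomial.eval c) ((isB_iff R).1 hB).2
    simp only [Polynomial.eval_sub, Polynomial.eval_pow, Polynomial.eval_add, eval_mul, eval_C,
      eval_X] at h1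
    have h2 : (-b) ^ p = -b ^ p := (hp.out.odd_of_ne_two hp2.out).neg_pow b
    rw [polyOver_eval_neg, add_pow_char, h2]
    linear_combination h1 - hb
  obtain ⟨ψ, hψx, hψy⟩ := exists_algHom_translation hB.neg hb'
  have hA : ∀ (φ : R.FunctionField k →ₐ[k] R.FunctionField k) (d : k),
      φ (R.x k) = R.x k + algebraMap k _ d → ∀ A : k[X],
      φ (aeval (R.x k) A) = aeval (R.x k) (A.comp (X + C d)) := by
    intro φ d hφ A
    rw [← aeval_algHom_apply, hφ, aeval_comp]
    simp
  refine ⟨AlgEquiv.ofAlgHom φ ψ ?_ ?_, hB, hb, hφx, hφy⟩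
  · apply ArtinSchreierField.algHom_ext
    · change φ (ψ (R.x k)) = R.x k
      rw [hψx, map_add, hφx, AlgHom.commutes, map_neg]
      ring
    · change φ (ψ (R.y k)) = R.y k
      rw [hψy, map_add, map_add, hφy, AlgHom.commutes, hA φ c hφx, neg_comp, hB.comp]
      simp only [map_add, map_neg, aeval_C]
      ring
  · apply ArtinSchreierField.algHom_ext
    · change ψ (φ (R.x k)) = R.x k
      rw [hφx, map_add, hψx, AlgHom.commutes, map_neg]
      ring
    · change ψ (φ (R.y k)) = R.y k
      rw [hφy, map_add, map_add, hψy, AlgHom.commutes, hA ψ (-c) hψx, hB.comp, hB.eval_neg]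
      simp only [map_add, map_neg, aeval_C]
      ring

theorem IsTranslation.pow {σ : R.FunctionField k ≃ₐ[k] R.FunctionField k} {c b : k} {B : k[X]}
    (hσ : IsTranslation σ c b B) (n : ℕ) : ∃ b' B', IsTranslation (σ ^ n) (n * c) b' B' := by
  induction n with
  | zero => exact ⟨0, 0, by simpa using IsTranslation.one⟩
  | succ n ih =>
    obtain ⟨b', B', h⟩ := ih
    rw [pow_succ, Nat.cast_succ, add_mul, one_mul]
    exact ⟨_, _, h.mul hσ⟩

theorem IsTranslation.pow_sq_eq_one {σ : R.FunctionField k ≃ₐ[k] R.FunctionField k} {c b : k}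
    {B : k[X]} (hσ : IsTranslation σ c b B) : σ ^ p ^ 2 = 1 := by
  obtain ⟨b', B', h⟩ := hσ.pow p
  rw [CharP.cast_eq_zero, zero_mul] at h
  have hB' : B' = 0 := h.isB.unique (isB_zero R)
  subst hB'
  have key : ∀ n : ℕ, IsTranslation ((σ ^ p) ^ n) 0 (n * b') 0 := by
    intro n
    induction n with
    | zero => simpa using IsTranslation.one
    | succ n ih =>
      have h1 := ih.mul h
      simp only [add_zero, eval_zero] at h1
      rwa [pow_succ, Nat.cast_succ, add_mul, one_mul]
  have h1 := key p
  rw [CharP.cast_eq_zero, zero_mul, ← pow_mul, ← pow_two] at h1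
  exact h1.ext IsTranslation.one

theorem IsTranslation.inv {σ : R.FunctionField k ≃ₐ[k] R.FunctionField k} {c b : k} {B : k[X]}
    (hσ : IsTranslation σ c b B) : ∃ b' B', IsTranslation σ⁻¹ (-c) b' B' := by
  obtain ⟨b', B', h⟩ := hσ.pow (p ^ 2 - 1)
  have h1 : σ ^ (p ^ 2 - 1) = σ⁻¹ := by
    rw [eq_inv_iff_mul_eq_one, ← pow_succ, Nat.sub_add_cancel (pow_pos hp.out.pos 2),
      hσ.pow_sq_eq_one]
  have h2 : ((p ^ 2 - 1 : ℕ) : k) = -1 := by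
    rw [Nat.cast_sub (pow_pos hp.out.pos 2)]
    simp
  rw [h1, h2, neg_one_mul] at h
  exact ⟨b', B', h⟩

theorem IsTranslation.mem_aut0 {σ : R.FunctionField k ≃ₐ[k] R.FunctionField k} {c b : k}
    {B : k[X]} (hσ : IsTranslation σ c b B) : σ ∈ R.aut0 k := by
  rw [mem_aut0_iff]
  intro V hV
  obtain ⟨b', B', hinv⟩ := hσ.inv
  refine ArtinSchreierField.IsAtInfinity.unique not_dvd_natDegree_rhs ⟨fun a => ?_, fun hx => ?_⟩ hV
  · rw [ValuationSubring.mem_pointwise_smul_iff_inv_smul_mem, AlgEquiv.smul_def, AlgEquiv.commutes]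
    exact hV.algebraMap_mem a
  · rw [ValuationSubring.mem_pointwise_smul_iff_inv_smul_mem, AlgEquiv.smul_def] at hx
    have hx' := hinv.apply_x
    change σ⁻¹ (ArtinSchreierField.x p (R.rhs k)) = _ at hx'
    rw [hx'] at hx
    have h1 := sub_mem hx (hV.algebraMap_mem (-c))
    rw [add_sub_cancel_right] at h1
    exact hV.x_notMem h1

/-- Pole orders at infinity and, for `h = 0`, the equation of the curve force an automorphism that
fixes `∞` to be affine in `x` and triangular. -/
theorem exists_affine_of_mem_aut0 {σ : R.FunctionField k ≃ₐ[k] R.FunctionField k}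
    (hσ : σ ∈ R.aut0 k) : ∃ (α c γ : k) (B : k[X]), σ (R.x k) = aeval (R.x k) (C α * X + C c) ∧
      σ (R.y k) = algebraMap k _ γ * R.y k + aeval (R.x k) B := by
  have hp3 := three_le p
  rw [mem_aut0_iff] at hσ
  have hf := not_dvd_natDegree_rhs (R := R) (k := k)
  have hn := natDegree_rhs (R := R) (k := k)
  have hph : 0 < p ^ h := pow_pos hp.out.pos h
  obtain ⟨q, hq, hqle, j, hj, hqj, hqjN⟩ := ArtinSchreierField.exists_apply_eq_sum hf hσ
    (w := R.x k) (fun V hx _ => hx) p fun V hV => (hV.valuation_invUniformizer hf).1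
  obtain ⟨r, hr, hrle, -⟩ := ArtinSchreierField.exists_apply_eq_sum hf hσ
    (w := R.y k) (fun V _ hy => hy) _ fun V hV => (hV.valuation_invUniformizer hf).2
  rw [hn] at hqle hqjN hrle
  -- the term of `σ(x)` of the highest pole order is the linear one
  have hj0 : j = 0 := by
    by_contra hj0
    have h1 : p ∣ (p ^ h + 1) * j := by
      rw [← Nat.dvd_add_right (dvd_mul_right p (q j).natDegree), hqjN]
    rcases (Nat.Prime.dvd_mul hp.out).1 h1 with h2 | h2
    · exact hf (hn ▸ h2)
    · exact absurd (Nat.le_of_dvd (Nat.pos_of_ne_zero hj0) h2) (by omega)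
  subst hj0
  have hq0 : (q 0).natDegree = 1 := by
    rw [mul_zero, add_zero] at hqjN
    exact Nat.eq_of_mul_eq_mul_left hp.out.pos (by rw [hqjN, mul_one])
  have hq0eq : q 0 = C ((q 0).coeff 1) * X + C ((q 0).coeff 0) :=
    eq_X_add_C_of_natDegree_le_one hq0.le
  have hα : (q 0).coeff 1 ≠ 0 := by
    rw [← hq0]; exact leadingCoeff_ne_zero.2 hqj
  -- `σ(y)` is of degree at most one in `y`, with a constant linear coefficient
  have hr2 : ∀ i, 2 ≤ i → i < p → r i = 0 := by
    intro i hi hip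
    by_contra h0
    have h1 := hrle i hip h0
    have h2 := Nat.mul_le_mul_left (p ^ h + 1) hi
    omega
  have hr1 : r 1 = C ((r 1).coeff 0) := by
    by_cases h0 : r 1 = 0
    · rw [h0]; simp
    · apply eq_C_of_natDegree_eq_zero
      have h1 := hrle 1 hp.out.one_lt h0
      by_contra h2
      have h3 := Nat.mul_le_mul_left p (Nat.pos_of_ne_zero h2)
      omega
  have hsum2 : ∀ g : ℕ → R.FunctionField k, (∀ i, 2 ≤ i → i < p → g i = 0) →
      ∑ i ∈ Finset.range p, g i = g 0 + g 1 := by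
    intro g hg
    rw [← Finset.sum_range_add_sum_Ico g (show 2 ≤ p by omega),
      Finset.sum_eq_zero fun i hi => hg i (Finset.mem_Ico.1 hi).1 (Finset.mem_Ico.1 hi).2]
    simp [Finset.sum_range_succ]
  have hy : σ (R.y k) = algebraMap k _ ((r 1).coeff 0) * R.y k + aeval (R.x k) (r 0) := by
    rw [hr, hsum2 _ fun i hi hip => by rw [hr2 i hi hip, map_zero, zero_mul], hr1, aeval_C,
      coeff_C_zero, pow_zero, mul_one, pow_one, add_comm]
    rfl
  by_cases hh : h = 0
  · subst hh
    -- `σ(x) = α x + G(y)`, and the cross term `x G(y)` in the equation shows that `G` is constant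
    have hqi : ∀ i < p, 1 ≤ i → q i = C ((q i).coeff 0) ∧ (q i ≠ 0 → 2 * i < p) := by
      intro i hi h1
      by_cases h0 : q i = 0
      · rw [h0]; simp
      · have h2 := hqle i hi h0
        rw [pow_zero] at h2
        have hodd := hp.out.odd_of_ne_two hp2.out
        refine ⟨eq_C_of_natDegree_eq_zero ?_, fun _ => ?_⟩
        · by_contra h3
          have h4 := Nat.mul_le_mul_left p (Nat.pos_of_ne_zero h3)
          omega
        · obtain ⟨m, hm⟩ := hodd
          omega
    set G : k[X] := ∑ i ∈ Finset.range p, C ((q i).coeff 0) * X ^ i with hG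
    have hGc : ∀ i < p, G.coeff i = (q i).coeff 0 := by
      intro i hi
      rw [hG, finsetSum_coeff]
      simp only [coeff_C_mul_X_pow]
      rw [Finset.sum_ite_eq, if_pos (Finset.mem_range.2 hi)]
    have hGdeg : 2 * G.natDegree < p := by
      by_cases hG0 : G.natDegree = 0
      · rw [hG0]; exact hp.out.pos
      have hGp : G.natDegree < p := by
        have h1 : G.natDegree ≤ p - 1 := by
          rw [hG]
          refine natDegree_sum_le_of_forall_le _ _ fun i hi => ?_
          have := Finset.mem_range.1 hi
          exact (natDegree_C_mul_X_pow_le _ _).trans (by omega)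
        omega
      refine (hqi _ hGp (Nat.pos_of_ne_zero hG0)).2 fun h0 => ?_
      have h1 := hGc _ hGp
      rw [h0, coeff_zero] at h1
      have h2 := leadingCoeff_eq_zero.1 h1
      rw [h2, natDegree_zero] at hG0
      exact hG0 rfl
    set α := (q 0).coeff 1
    have hx : σ (R.x k) = algebraMap k _ α * R.x k + aeval (R.y k) G := by
      rw [hq, Finset.range_eq_Ico, Finset.sum_eq_sum_Ico_succ_bot hp.out.pos, hq0eq, hG, map_sum,
        Finset.range_eq_Ico, Finset.sum_eq_sum_Ico_succ_bot hp.out.pos]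
      simp only [map_add, map_mul, aeval_C, aeval_X, pow_zero, mul_one, map_pow]
      rw [Finset.sum_congr rfl fun i hi => by
        rw [(hqi i (Finset.mem_Ico.1 hi).2 (Finset.mem_Ico.1 hi).1).1]]
      simp only [aeval_C, ← add_assoc]
      rfl
    have hr0 : r 0 = C ((r 0).coeff 0) := by
      by_cases h0 : r 0 = 0
      · rw [h0]; simp
      · apply eq_C_of_natDegree_eq_zero
        have h1 := hrle 0 hp.out.pos h0
        by_contra h2
        have h3 := Nat.mul_le_mul_left p (Nat.pos_of_ne_zero h2)
        rw [pow_zero] at h1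
        omega
    have hfx : ∀ z : R.FunctionField k, aeval z (X * R.polyOver k) =
        algebraMap k _ (R.coeffOver k 0) * z ^ 2 := by
      intro z
      rw [polyOver_eq_sum]
      simp
      ring
    have heq := congrArg σ (y_pow_sub (R := R) (k := k))
    have : CharP (R.FunctionField k) p :=
      charP_of_injective_algebraMap (algebraMap k (R.FunctionField k)).injective p
    have hyy := y_pow_sub (R := R) (k := k)
    rw [hfx] at heq hyy
    rw [map_sub, map_pow, map_mul, map_pow, AlgEquiv.commutes, hx, hy, hr0, aeval_C,
      add_pow_char, mul_pow] at heq
    set a := R.coeffOver k 0 with ha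
    set γ := (r 1).coeff 0
    set β := (r 0).coeff 0
    have ha0 : a ≠ 0 := by
      rw [ha, coeffOver_last]
      exact (_root_.map_ne_zero _).2 R.coeff_last_ne_zero
    -- the equation as a polynomial in `y` with coefficients in `k[x]`
    set H : k[X][X] := C (C (2 * a * α) * X) * G.map C + C (C a) * (G.map C) ^ 2
      - (C (C (γ ^ p - γ)) * X + C (C (γ ^ p * a - a * α ^ 2) * X ^ 2 + C (β ^ p - β))) with hH
    have hGm : (G.map (C : k →+* k[X])).natDegree = G.natDegree :=
      natDegree_map_eq_of_injective C_injective G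
    have hHdeg : H.natDegree < p := by
      refine lt_of_le_of_lt (natDegree_sub_le _ _) (max_lt ?_ ?_)
      · refine lt_of_le_of_lt (natDegree_add_le _ _) (max_lt ?_ ?_)
        · exact (natDegree_C_mul_le _ _).trans_lt (by rw [hGm]; omega)
        · refine (natDegree_C_mul_le _ _).trans_lt (lt_of_le_of_lt natDegree_pow_le ?_)
          rwa [hGm]
      · exact natDegree_linear_le.trans_lt hp.out.one_lt
    have hGe : (G.map (C : k →+* k[X])).eval₂
        (aeval (R.x k) : k[X] →ₐ[k] R.FunctionField k).toRingHom (R.y k) = aeval (R.y k) G := by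
      rw [eval₂_map, aeval_def]
      congr 1
      ext u
      simp
    have hH0 : H = 0 := by
      refine ArtinSchreierField.eq_zero_of_eval₂_eq_zero (f := R.rhs k) hHdeg ?_
      change H.eval₂ (aeval (R.x k) : k[X] →ₐ[k] R.FunctionField k).toRingHom (R.y k) = 0
      rw [hH, eval₂_sub, eval₂_add, eval₂_add, eval₂_mul, eval₂_mul, eval₂_mul, eval₂_pow, hGe,
        eval₂_C, eval₂_C, eval₂_C, eval₂_C, eval₂_X]
      simp only [AlgHom.toRingHom_eq_coe, RingHom.coe_coe, map_mul, map_sub, map_add, map_pow,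
        aeval_C, aeval_X, map_ofNat]
      linear_combination heq.symm + algebraMap k (R.FunctionField k) γ ^ p * hyy
    have hGi : ∀ i, 1 ≤ i → G.coeff i = 0 := by
      intro i hi
      have h1 := congrArg (fun g => (g.coeff i).coeff 1) hH0
      have h2 : ((G.map (C : k →+* k[X]) ^ 2).coeff i).coeff 1 = 0 := by
        rw [← Polynomial.map_pow, coeff_map, coeff_C_succ]
      have h3 : ((X : k[X][X]).coeff i).coeff 1 = 0 := by
        rw [coeff_X]
        split_ifs
        · exact coeff_one.trans (if_neg one_ne_zero)
        · exact coeff_zero 1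
      simp only [hH, coeff_sub, coeff_add, coeff_C_mul, coeff_map, coeff_mul_C, h2, h3,
        coeff_C_of_ne_zero (show i ≠ 0 by omega), coeff_X_one, coeff_zero, mul_zero, mul_one,
        add_zero, sub_zero] at h1
      refine (mul_eq_zero.1 h1).resolve_left ?_
      exact mul_ne_zero (mul_ne_zero (two_ne_zero_of_charP p k) ha0) hα
    have hGC : G = C (G.coeff 0) := by
      ext i
      rcases Nat.eq_zero_or_pos i with rfl | hi
      · simp
      · rw [hGi i hi, coeff_C_of_ne_zero hi.ne']
    refine ⟨α, G.coeff 0, γ, r 0, ?_, hy⟩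
    rw [hx, hGC, aeval_C]
    simp
  · refine ⟨(q 0).coeff 1, (q 0).coeff 0, (r 1).coeff 0, r 0, ?_, hy⟩
    have hq1 : ∀ i, 1 ≤ i → i < p → q i = 0 := by
      intro i hi hip
      by_contra h0
      have h1 := hqle i hip h0
      have h2 := Nat.mul_le_mul_left (p ^ h + 1) hi
      have h3 : p ≤ p ^ h := Nat.le_self_pow hh p
      omega
    rw [hq, hsum2 _ fun i hi hip => by rw [hq1 i (by omega) hip, map_zero, zero_mul],
      hq1 1 le_rfl hp.out.one_lt, map_zero, zero_mul, add_zero, pow_zero, mul_one, ← hq0eq]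
    rfl

/-- The automorphisms of `p`-power order that fix `∞` are the automorphisms `σ_{b,c}`. -/
theorem exists_isTranslation_of_mem_aut0 {σ : R.FunctionField k ≃ₐ[k] R.FunctionField k}
    (hσ : σ ∈ R.aut0 k) {m : ℕ} (hm : σ ^ p ^ m = 1) : ∃ c b B, IsTranslation σ c b B := by
  obtain ⟨α, c, γ, B, hx, hy⟩ := exists_affine_of_mem_aut0 hσ
  obtain ⟨rfl, rfl⟩ := ArtinSchreierField.eq_one_of_pow_eq_one hx hy hm
  rw [C_1, one_mul] at hx
  rw [map_one, one_mul] at hy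
  have : CharP (R.FunctionField k) p :=
    charP_of_injective_algebraMap (algebraMap k (R.FunctionField k)).injective p
  have hyy := y_pow_sub (R := R) (k := k)
  have heq := congrArg σ hyy
  have h1 := aeval_algHom_apply (σ : R.FunctionField k →ₐ[k] R.FunctionField k) (R.x k)
    (X * R.polyOver k)
  change aeval (σ (R.x k)) _ = σ _ at h1
  rw [← h1, hx, ← aeval_comp, map_sub, map_pow, hy, add_pow_char] at heq
  have h2 : X * R.polyOver k + (B ^ p - B) = (X * R.polyOver k).comp (X + C c) := by
    apply aeval_x_injective (R := R)
    rw [← heq, map_add, ← hyy, map_sub, map_pow]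
    ring
  rw [mul_comp, X_comp, polyOver_comp] at h2
  have h3 : B.coeff 0 ^ p - B.coeff 0 = c * (R.polyOver k).eval c := by
    have h4 := congrArg (Polynomial.eval 0) h2
    have h0 := R.polyOver_eval_add (0 : k) 0
    rw [add_zero, left_eq_add] at h0
    simp only [Polynomial.eval_add, Polynomial.eval_sub, Polynomial.eval_pow, eval_mul, eval_X,
      eval_C, h0, zero_mul, zero_add] at h4
    rwa [coeff_zero_eq_eval_zero]
  refine ⟨c, B.coeff 0, B - C (B.coeff 0), ?_, h3, ?_, ?_⟩
  · rw [isB_iff]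
    refine ⟨by simp, ?_⟩
    rw [sub_pow_char, ← C_pow]
    have h4 := congrArg (C : k → k[X]) h3
    rw [C_sub, C_mul] at h4
    linear_combination h2 - h4
  · rw [hx, map_add, aeval_X, aeval_C]
  · rw [hy, map_sub, aeval_C]
    ring

variable (R k) in
/-- The group of the automorphisms `σ_{b,c}`. -/
noncomputable def translationGroup : Subgroup (R.aut0 k) where
  carrier := {σ | ∃ c b B, IsTranslation (σ : R.FunctionField k ≃ₐ[k] R.FunctionField k) c b B}
  mul_mem' := by
    rintro σ τ ⟨c, b, B, hσ⟩ ⟨d, e, D, hτ⟩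
    exact ⟨_, _, _, hσ.mul hτ⟩
  one_mem' := ⟨_, _, _, IsTranslation.one⟩
  inv_mem' := by
    rintro σ ⟨c, b, B, hσ⟩
    obtain ⟨b', B', h⟩ := hσ.inv
    exact ⟨_, _, _, h⟩

theorem sylow_eq_translationGroup (P : Sylow p (R.aut0 k)) :
    (P : Subgroup (R.aut0 k)) = translationGroup R k := by
  refine (P.is_maximal' (Q := translationGroup R k) ?_ ?_).symm
  · rintro ⟨σ, c, b, B, hσ⟩
    exact ⟨2, Subtype.ext (Subtype.ext hσ.pow_sq_eq_one)⟩
  · intro σ hσ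
    obtain ⟨m, hm⟩ := P.isPGroup' ⟨σ, hσ⟩
    refine exists_isTranslation_of_mem_aut0 σ.2 (m := m) ?_
    exact congrArg (fun τ : P => ((τ : R.aut0 k) : R.FunctionField k ≃ₐ[k] R.FunctionField k)) hm

end

end AdditivePolynomial

/-! ### Subgroups of `P` and their groups of translations -/

namespace AdditivePolynomial

variable {p h : ℕ} [hp : Fact p.Prime] [hp2 : Fact (p ≠ 2)] {F : Type*} [Field F] [CharP F p]
  {R : AdditivePolynomial p h F} {k : Type*} [Field k] [Algebra F k]
  {P : Sylow p (R.aut0 k)}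

/-- The automorphism of the function field given by an element of `P`. -/
noncomputable abbrev toAut (σ : P) : R.FunctionField k ≃ₐ[k] R.FunctionField k :=
  ((σ : R.aut0 k) : R.FunctionField k ≃ₐ[k] R.FunctionField k)

theorem toAut_injective : Function.Injective (toAut : P → _) := fun _ _ h =>
  Subtype.ext (Subtype.ext h)

variable [CharP k p]

theorem exists_isTranslation_toAut (σ : P) : ∃ c b B, IsTranslation (toAut σ) c b B := by
  have h : (σ : R.aut0 k) ∈ translationGroup R k := by
    rw [← sylow_eq_translationGroup P]; exact σ.2
  exact h

theorem IsTranslation.exists_toAut_eq (P : Sylow p (R.aut0 k))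
    {τ : R.FunctionField k ≃ₐ[k] R.FunctionField k} {c b : k} {B : k[X]}
    (hτ : IsTranslation τ c b B) : ∃ σ : P, toAut σ = τ := by
  have h : (⟨τ, hτ.mem_aut0⟩ : R.aut0 k) ∈ (P : Subgroup (R.aut0 k)) := by
    rw [sylow_eq_translationGroup P]; exact ⟨c, b, B, hτ⟩
  exact ⟨⟨_, h⟩, rfl⟩

theorem mem_translations_iff {H : Subgroup P} {c : k} :
    c ∈ translations H ↔ ∃ σ ∈ H, ∃ b B, IsTranslation (toAut σ) c b B := by
  constructor
  · rintro ⟨σ, hσ, hx⟩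
    obtain ⟨c', b, B, h⟩ := exists_isTranslation_toAut σ
    obtain rfl := h.eq_of_apply_x hx
    exact ⟨σ, hσ, b, B, h⟩
  · rintro ⟨σ, hσ, b, B, h⟩
    exact ⟨σ, hσ, h.apply_x⟩

/-- The image of a subgroup of `P` under `P → W`, as a group. -/
noncomputable def translationsAddSubgroup (H : Subgroup P) : AddSubgroup k where
  carrier := translations H
  zero_mem' := mem_translations_iff.2 ⟨1, one_mem H, 0, 0, IsTranslation.one⟩
  add_mem' := by
    intro c d hc hd
    obtain ⟨σ, hσ, b, B, h⟩ := mem_translations_iff.1 hc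
    obtain ⟨τ, hτ, b', B', h'⟩ := mem_translations_iff.1 hd
    exact mem_translations_iff.2 ⟨σ * τ, mul_mem hσ hτ, _, _, h.mul h'⟩
  neg_mem' := by
    intro c hc
    obtain ⟨σ, hσ, b, B, h⟩ := mem_translations_iff.1 hc
    obtain ⟨b', B', h'⟩ := h.inv
    exact mem_translations_iff.2 ⟨σ⁻¹, inv_mem hσ, b', B', h'⟩

theorem commute_iff {σ τ : P} {c b d e : k} {B D : k[X]} (hσ : IsTranslation (toAut σ) c b B)
    (hτ : IsTranslation (toAut τ) d e D) : σ * τ = τ * σ ↔ D.eval c = B.eval d := by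
  have h1 := hσ.mul hτ
  have h2 := hτ.mul hσ
  constructor
  · intro h
    have h3 : toAut σ * toAut τ = toAut τ * toAut σ := congrArg toAut h
    rw [h3] at h1
    linear_combination (h1.unique h2).2.1
  · intro h
    apply toAut_injective
    rw [add_comm d, add_comm e, ← h, add_comm D] at h2
    exact h1.ext h2

omit hp2 [CharP F p] in
theorem aeval_E_eq_zero_of_isB [PerfectField k] {c : k} {B : k[X]} (hB : R.IsB c B) :
    aeval c R.E = 0 :=
  aeval_E_eq_zero_of_pow_sub ((isB_iff R).1 hB).2

/-- The image in `W` of a maximal abelian subgroup of `P` is a maximal isotropic subspace: the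
preimage in `P` of an isotropic subspace is abelian. -/
theorem maximal_isIsotropic_translations [IsAlgClosed k] {𝒜 : Subgroup P}
    (h𝒜 : Maximal (fun H : Subgroup P => IsMulCommutative H) 𝒜) :
    Maximal R.IsIsotropic (translationsAddSubgroup 𝒜) := by
  have hcomm : ∀ σ ∈ 𝒜, ∀ τ ∈ 𝒜, σ * τ = τ * σ := fun σ hσ τ hτ =>
    congrArg Subtype.val (h𝒜.prop.is_comm.comm (⟨σ, hσ⟩ : 𝒜) ⟨τ, hτ⟩)
  refine ⟨⟨?_, ?_⟩, ?_⟩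
  · intro c hc
    obtain ⟨σ, hσ, b, B, h⟩ := mem_translations_iff.1 hc
    exact aeval_E_eq_zero_of_isB h.isB
  · intro c hc d hd
    obtain ⟨σ, hσ, b, B, h⟩ := mem_translations_iff.1 hc
    obtain ⟨τ, hτ, b', B', h'⟩ := mem_translations_iff.1 hd
    refine ⟨B, B', h.isB, h'.isB, sub_eq_zero.2 ?_⟩
    exact ((commute_iff h h').1 (hcomm σ hσ τ hτ)).symm
  · intro V hV hle c hc
    let ℬ : Subgroup P :=
      { carrier := {σ | ∃ c ∈ V, ∃ b B, IsTranslation (toAut σ) c b B}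
        mul_mem' := by
          rintro σ τ ⟨c, hc, b, B, h⟩ ⟨d, hd, b', B', h'⟩
          exact ⟨_, add_mem hc hd, _, _, h.mul h'⟩
        one_mem' := ⟨0, zero_mem V, 0, 0, IsTranslation.one⟩
        inv_mem' := by
          rintro σ ⟨c, hc, b, B, h⟩
          obtain ⟨b', B', h'⟩ := h.inv
          exact ⟨_, neg_mem hc, b', B', h'⟩ }
    have hℬ : IsMulCommutative ℬ := by
      refine ⟨⟨?_⟩⟩
      rintro ⟨σ, c, hc, b, B, h⟩ ⟨τ, d, hd, b', B', h'⟩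
      refine Subtype.ext ((commute_iff h h').2 ?_)
      obtain ⟨B₁, B₂, h₁, h₂, h₃⟩ := hV.2 c hc d hd
      rw [h.isB.unique h₁, h'.isB.unique h₂]
      exact (sub_eq_zero.1 h₃).symm
    have h𝒜ℬ : 𝒜 ≤ ℬ := by
      intro σ hσ
      obtain ⟨c, b, B, h⟩ := exists_isTranslation_toAut σ
      exact ⟨c, hle (mem_translations_iff.2 ⟨σ, hσ, b, B, h⟩), b, B, h⟩
    have hℬ𝒜 := h𝒜.2 hℬ h𝒜ℬ
    obtain ⟨b, hb⟩ := exists_pow_sub_eq p (c * (R.polyOver k).eval c)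
    obtain ⟨τ, hτ⟩ := exists_isTranslation (isB_bPoly R (hV.1 hc)) hb
    obtain ⟨σ, rfl⟩ := hτ.exists_toAut_eq P
    exact mem_translations_iff.2 ⟨σ, hℬ𝒜 ⟨c, hc, _, _, hτ⟩, _, _, hτ⟩

/-- A subgroup of `P` that intersects the center trivially is isomorphic to its image in `W`. -/
theorem eq_of_isTranslation_of_inf_center {A : Subgroup P} (hAZ : A ⊓ Subgroup.center P = ⊥)
    {σ τ : P} (hσA : σ ∈ A) (hτA : τ ∈ A) {c b e : k} {B D : k[X]}
    (hσ : IsTranslation (toAut σ) c b B) (hτ : IsTranslation (toAut τ) c e D) : σ = τ := by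
  have h1 : σ * τ⁻¹ ∈ A ⊓ Subgroup.center P := by
    refine Subgroup.mem_inf.2 ⟨mul_mem hσA (inv_mem hτA), Subgroup.mem_center_iff.2 fun ρ => ?_⟩
    obtain ⟨c', b', B', hρ⟩ := exists_isTranslation_toAut ρ
    obtain ⟨e', D', hτ'⟩ := hτ.inv
    have h2 : IsTranslation (toAut (σ * τ⁻¹)) (c + -c) _ _ := hσ.mul hτ'
    rw [add_neg_cancel] at h2
    refine (commute_iff hρ h2).2 ?_
    rw [h2.isB.unique (isB_zero R), eval_zero, ← coeff_zero_eq_eval_zero, hρ.isB.1]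
  rw [hAZ, Subgroup.mem_bot] at h1
  exact mul_inv_eq_one.1 h1

theorem card_translationsAddSubgroup {A : Subgroup P} (hAZ : A ⊓ Subgroup.center P = ⊥) :
    Nat.card (translationsAddSubgroup A) = Nat.card A := by
  choose c b B hc using fun σ : P => exists_isTranslation_toAut σ
  symm
  refine Nat.card_congr (Equiv.ofBijective
    (fun σ : A => (⟨c σ, mem_translations_iff.2 ⟨σ, σ.2, _, _, hc σ⟩⟩ :
      translationsAddSubgroup A)) ⟨?_, ?_⟩)
  · intro σ τ h
    have h1 : c σ = c τ := congrArg Subtype.val h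
    have h2 := hc (σ : P)
    rw [h1] at h2
    exact Subtype.ext (eq_of_isTranslation_of_inf_center hAZ σ.2 τ.2 h2 (hc (τ : P)))
  · rintro ⟨d, hd⟩
    obtain ⟨σ, hσ, b', B', h⟩ := mem_translations_iff.1 hd
    exact ⟨⟨σ, hσ⟩, Subtype.ext ((hc σ).unique h).1⟩

end AdditivePolynomial

/-! ### Descent to `𝔽_q` -/

/-- Let `x` be a root of a monic polynomial of degree `N` over a field `M`. An element of `M(x)` that
is fixed by endomorphisms over `M` with at least `N` different values at `x` belongs to `M`. -/
theorem IntermediateField.mem_of_forall_apply_eq {K L : Type*} [Field K] [Field L] [Algebra K L]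
    (M : IntermediateField K L) {x z : L} {m : M[X]} (hm : m.Monic) (hmx : aeval x m = 0)
    (T : Finset L) (hT : m.natDegree ≤ T.card) (hz : z ∈ IntermediateField.adjoin M {x})
    (hσ : ∀ t ∈ T, ∃ σ : L →+* L, (∀ u ∈ M, σ u = u) ∧ σ x = t ∧ σ z = z) : z ∈ M := by
  have hint : IsIntegral M x := ⟨m, hm, hmx⟩
  rw [← IntermediateField.mem_toSubalgebra,
    IntermediateField.adjoin_simple_toSubalgebra_of_isAlgebraic hint.isAlgebraic,
    Algebra.adjoin_singleton_eq_range_aeval] at hz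
  obtain ⟨g, hg⟩ := hz
  have hg : aeval x g = z := hg
  set r := g %ₘ m with hr
  have hrx : aeval x r = z := by
    rw [← hg]
    conv_rhs => rw [← modByMonic_add_div g m]
    rw [map_add, map_mul, hmx, zero_mul, add_zero]
  have hm1 : m ≠ 1 := by
    rintro rfl
    rw [map_one] at hmx
    exact one_ne_zero hmx
  have hdeg : r.natDegree < m.natDegree := natDegree_modByMonic_lt g hm hm1
  have h0 : r.map (algebraMap M L) - C z = 0 := by
    apply eq_zero_of_natDegree_lt_card_of_eval_eq_zero' _ T
    · intro t ht
      obtain ⟨σ, hσM, hσx, hσz⟩ := hσ t ht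
      have h1 : σ.comp (algebraMap M L) = algebraMap M L := RingHom.ext fun u => hσM u u.2
      rw [eval_sub, eval_C, eval_map, ← hσx, ← h1, ← hom_eval₂, ← aeval_def, hrx, hσz, sub_self]
    · refine lt_of_le_of_lt (natDegree_sub_le _ _) ?_
      rw [natDegree_map, natDegree_C, Nat.max_zero]
      omega
  have h1 : z = algebraMap M L (r.coeff 0) := by
    have h2 := congrArg (fun g => g.coeff 0) h0
    simp only [coeff_sub, coeff_map, coeff_C_zero, coeff_zero] at h2
    exact (sub_eq_zero.1 h2).symm
  rw [h1]
  exact (r.coeff 0).2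

theorem AddSubgroup.slope_eq_finprod {K : Type*} [Field K] (V : AddSubgroup K) [Fintype V]
    (hodd : Odd (Fintype.card V)) : V.slope = ∏ᶠ c ∈ (V : Set K) \ {0}, c := by
  classical
  have hs : (V : Set K) \ {0} =
      ((Finset.univ.erase (0 : V)).map ⟨Subtype.val, Subtype.val_injective⟩ : Finset K) := by
    ext t; simp
  rw [slope_eq, hs, finprod_mem_coe_finset, finprod_mem_coe_finset, Finset.prod_neg,
    Finset.card_map, Finset.card_erase_of_mem (Finset.mem_univ _), Finset.card_univ,
    (Nat.Odd.sub_odd hodd odd_one).neg_one_pow, one_mul]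

namespace AdditivePolynomial

variable {p h : ℕ} [hp : Fact p.Prime] [hp2 : Fact (p ≠ 2)] {F : Type*} [Field F] [CharP F p]
  {R : AdditivePolynomial p h F} {k : Type*} [Field k] [Algebra F k]

omit hp hp2 [CharP F p] in
theorem polyOver_map {K : Type*} [Field K] [Algebra F K] [Algebra K k] [IsScalarTower F K k] :
    (R.polyOver K).map (algebraMap K k) = R.polyOver k := by
  rw [polyOver, polyOver, Polynomial.map_map, ← IsScalarTower.algebraMap_eq]

omit hp hp2 [CharP F p] in
theorem eval_polyOver_algebraMap {K : Type*} [Field K] [Algebra F K] [Algebra K k]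
    [IsScalarTower F K k] (c : K) :
    (R.polyOver k).eval (algebraMap K k c) = algebraMap K k ((R.polyOver K).eval c) := by
  rw [← polyOver_map (K := K), eval_map_algebraMap, aeval_algebraMap_apply]
  rfl

omit hp hp2 [CharP F p] in
theorem IsB.map {K : Type*} [Field K] [Algebra F K] [Algebra K k] [IsScalarTower F K k] {c : K}
    {B : K[X]} (hB : R.IsB c B) : R.IsB (algebraMap K k c) (B.map (algebraMap K k)) := by
  rw [isB_iff] at hB ⊢
  refine ⟨by rw [coeff_map, hB.1, map_zero], ?_⟩
  have := congrArg (Polynomial.map (algebraMap K k)) hB.2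
  simpa only [Polynomial.map_sub, Polynomial.map_pow, Polynomial.map_add, Polynomial.map_mul,
    map_C, map_X, polyOver_map, ← eval_polyOver_algebraMap] using this

variable [CharP k p]

/-- The automorphisms `σ_{b,c}` are defined over `𝔽_q`: the polynomial `B_c` has coefficients in
`𝔽_p(W)`, and `b - B_c(c) / 2` lies in the prime field. -/
theorem IsTranslation.exists_over_Fq [PerfectField k] [CharP (R.Fq k) p]
    {σ : R.FunctionField k ≃ₐ[k] R.FunctionField k} {c b : k} {B : k[X]}
    (hσ : IsTranslation σ c b B) : ∃ (c' b' : R.Fq k) (B' : (R.Fq k)[X]),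
      algebraMap (R.Fq k) k c' = c ∧ algebraMap (R.Fq k) k b' = b ∧
      B'.map (algebraMap (R.Fq k) k) = B ∧ R.IsB c' B' ∧
      b' ^ p - b' = c' * (R.polyOver (R.Fq k)).eval c' := by
  have hcW : c ∈ R.W k := aeval_E_eq_zero_of_isB hσ.isB
  set c' : R.Fq k := ⟨c, IntermediateField.subset_adjoin _ _ hcW⟩
  have hc : algebraMap (R.Fq k) k c' = c := rfl
  have hE : aeval c' R.E = 0 := by
    apply (algebraMap (R.Fq k) k).injective
    rw [← aeval_algebraMap_apply, hc, map_zero]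
    exact hcW
  have hB' := isB_bPoly R hE
  have hBB : (R.bPoly c').map (algebraMap (R.Fq k) k) = B := hB'.map.unique hσ.isB
  have h2 := two_ne_zero_of_charP p k
  have hbot : b - B.eval c / 2 ∈ (⊥ : Subfield k) :=
    (Subfield.mem_bot_iff_pow_eq_self k p).2 (hσ.isB.sub_half_pow h2 hσ.pow_sub)
  have hFq : b - B.eval c / 2 ∈ (R.Fq k).toSubfield :=
    (bot_le : (⊥ : Subfield k) ≤ (R.Fq k).toSubfield) hbot
  set u : R.Fq k := ⟨_, hFq⟩
  have hb : algebraMap (R.Fq k) k ((R.bPoly c').eval c' / 2 + u) = b := by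
    have hu : algebraMap (R.Fq k) k u = b - B.eval c / 2 := rfl
    rw [map_add, hu, map_div₀, map_ofNat, ← hBB, ← hc, eval_map_algebraMap, aeval_algebraMap_apply,
      coe_aeval_eq_eval]
    ring
  refine ⟨c', (R.bPoly c').eval c' / 2 + u, R.bPoly c', hc, hb, hBB, hB', ?_⟩
  apply (algebraMap (R.Fq k) k).injective
  rw [map_sub, map_pow, hb, map_mul, ← eval_polyOver_algebraMap, hc, hσ.pow_sub]

omit [CharP k p] in
theorem x_mem_fieldOverFq : R.x k ∈ R.fieldOverFq k :=
  IntermediateField.subset_adjoin _ _ (by simp)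

omit [CharP k p] in
theorem y_mem_fieldOverFq : R.y k ∈ R.fieldOverFq k :=
  IntermediateField.subset_adjoin _ _ (by simp)

theorem IsTranslation.apply_mem_fieldOverFq [PerfectField k] [CharP (R.Fq k) p]
    {σ : R.FunctionField k ≃ₐ[k] R.FunctionField k} {c b : k} {B : k[X]}
    (hσ : IsTranslation σ c b B) {z : R.FunctionField k} (hz : z ∈ R.fieldOverFq k) :
    σ z ∈ R.fieldOverFq k := by
  obtain ⟨c', b', B', rfl, rfl, rfl, -, -⟩ := hσ.exists_over_Fq
  have hle : R.fieldOverFq k ≤ (R.fieldOverFq k).comap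
      ((σ : R.FunctionField k →ₐ[k] R.FunctionField k).restrictScalars (R.Fq k)) := by
    rw [fieldOverFq, IntermediateField.adjoin_le_iff]
    rintro w (rfl | rfl)
    · change σ (R.x k) ∈ R.fieldOverFq k
      rw [hσ.apply_x, ← IsScalarTower.algebraMap_apply]
      exact add_mem x_mem_fieldOverFq (IntermediateField.algebraMap_mem _ _)
    · change σ (R.y k) ∈ R.fieldOverFq k
      rw [hσ.apply_y, ← IsScalarTower.algebraMap_apply, aeval_map_algebraMap]
      exact add_mem (add_mem y_mem_fieldOverFq (IntermediateField.algebraMap_mem _ _))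
        (IntermediateField.aeval_mem_of_mem _ x_mem_fieldOverFq _)
  exact hle hz

omit [CharP k p] in
theorem mem_quotientField_iff {P : Sylow p (R.aut0 k)} {A : Subgroup P} {z : R.FunctionField k} :
    z ∈ quotientField A ↔ z ∈ R.fieldOverFq k ∧ ∀ σ ∈ A, toAut σ z = z := by
  rw [quotientField, IntermediateField.mem_inf, IntermediateField.mem_restrictScalars,
    IntermediateField.mem_fixedField_iff]
  refine and_congr_right fun _ => ⟨fun h σ hσ => ?_, fun h f hf => ?_⟩
  · exact h _ (Subgroup.mem_map_of_mem _ (Subgroup.mem_map_of_mem _ hσ))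
  · obtain ⟨-, ⟨σ, hσ, rfl⟩, rfl⟩ := hf
    exact h σ hσ

end AdditivePolynomial

/-! ### The quotient curve -/

namespace AdditivePolynomial

variable {p h : ℕ} [hp : Fact p.Prime] [hp2 : Fact (p ≠ 2)] {F : Type*} [Field F] [CharP F p]
  {R : AdditivePolynomial p h F} {k : Type*} [Field k] [Algebra F k]
  {P : Sylow p (R.aut0 k)} [CharP k p] [CharP (R.Fq k) p]

/-- The image in `W` of a subgroup of `P`, as a subgroup of `𝔽_q`. -/
noncomputable def translationsFq (H : Subgroup P) : AddSubgroup (R.Fq k) :=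
  (translationsAddSubgroup H).comap (algebraMap (R.Fq k) k).toAddMonoidHom

omit [CharP (R.Fq k) p] in
theorem mem_translationsFq_iff {H : Subgroup P} {c : R.Fq k} :
    c ∈ translationsFq H ↔ algebraMap (R.Fq k) k c ∈ translations H := Iff.rfl

theorem image_translationsFq [PerfectField k] (H : Subgroup P) :
    algebraMap (R.Fq k) k '' (translationsFq H) = translations H := by
  ext c
  constructor
  · rintro ⟨c, hc, rfl⟩
    exact hc
  · intro hc
    obtain ⟨σ, hσ, b, B, h⟩ := mem_translations_iff.1 hc
    obtain ⟨c', -, -, rfl, -⟩ := h.exists_over_Fq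
    exact ⟨c', hc, rfl⟩

theorem card_translationsFq [PerfectField k] {A : Subgroup P}
    (hAZ : A ⊓ Subgroup.center P = ⊥) : Nat.card (translationsFq A) = Nat.card A := by
  rw [← card_translationsAddSubgroup hAZ]
  change Nat.card (translationsFq A : Set (R.Fq k)) = Nat.card (translations A)
  rw [← image_translationsFq, Nat.card_image_of_injective (algebraMap (R.Fq k) k).injective]

/-- The function `Y = y + Q(x)` is invariant under `A`, and `x R(x) + Q(x) ^ p - Q(x)` is quadratic
in `π(x) = ∏_{c ∈ Ā} (x - c)`, all over `𝔽_q`. -/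
theorem exists_quotient_equation_over_Fq [PerfectField k] [PerfectField (R.Fq k)] {A : Subgroup P}
    (hAZ : A ⊓ Subgroup.center P = ⊥) (hA : Nat.card A = p ^ h) [Fintype (translationsFq A)] :
    ∃ (Q : (R.Fq k)[X]) (a s : R.Fq k) (b : translationsFq A → R.Fq k)
      (B : translationsFq A → (R.Fq k)[X]),
      (∀ σ ∈ A, ∃ c : translationsFq A, IsTranslation (toAut σ) (algebraMap (R.Fq k) k c)
        (algebraMap (R.Fq k) k (b c)) ((B c).map (algebraMap (R.Fq k) k))) ∧
      (∀ c : translationsFq A, ∃ σ ∈ A, IsTranslation (toAut σ) (algebraMap (R.Fq k) k c)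
        (algebraMap (R.Fq k) k (b c)) ((B c).map (algebraMap (R.Fq k) k))) ∧
      (∀ c : translationsFq A, Q.comp (X + C (c : R.Fq k)) = Q - (B c + C (b c))) ∧
      a * (translationsFq A).slope ^ 2 = (if h = 0 then R.coeffOver (R.Fq k) 0
        else R.coeffOver (R.Fq k) h / 2 * (translationsFq A).slope) ∧
      X * R.polyOver (R.Fq k) + (Q ^ p - Q) =
        C a * ((translationsFq A).vanishingPoly + C s) ^ 2 - C (a * s ^ 2) := by
  have hinj := (algebraMap (R.Fq k) k).injective
  have hex : ∀ c : translationsFq A, ∃ (b : R.Fq k) (B : (R.Fq k)[X]), ∃ σ ∈ A,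
      IsTranslation (toAut σ) (algebraMap (R.Fq k) k c) (algebraMap (R.Fq k) k b)
        (B.map (algebraMap (R.Fq k) k)) ∧ R.IsB (c : R.Fq k) B ∧
        b ^ p - b = c * (R.polyOver (R.Fq k)).eval (c : R.Fq k) := by
    intro c
    obtain ⟨σ, hσ, b, B, h⟩ := mem_translations_iff.1 (mem_translationsFq_iff.1 c.2)
    obtain ⟨c', b', B', hc, rfl, rfl, hB, hb⟩ := h.exists_over_Fq
    obtain rfl := hinj hc
    exact ⟨b', B', σ, hσ, h, hB, hb⟩
  choose b B σ hσA hσ hB hb using hex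
  have hall : ∀ τ ∈ A, ∃ c : translationsFq A, IsTranslation (toAut τ) (algebraMap (R.Fq k) k c)
      (algebraMap (R.Fq k) k (b c)) ((B c).map (algebraMap (R.Fq k) k)) := by
    intro τ hτ
    obtain ⟨c, e, D, h⟩ := exists_isTranslation_toAut τ
    have hc : c ∈ translations A := mem_translations_iff.2 ⟨τ, hτ, e, D, h⟩
    rw [← image_translationsFq] at hc
    obtain ⟨c, hc, rfl⟩ := hc
    have h1 := eq_of_isTranslation_of_inf_center hAZ hτ (hσA ⟨c, hc⟩) h (hσ ⟨c, hc⟩)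
    exact ⟨⟨c, hc⟩, h1 ▸ hσ ⟨c, hc⟩⟩
  have hadd : ∀ c d : translationsFq A, b (c + d) = b c + b d + (B d).eval (c : R.Fq k) := by
    intro c d
    have h1 : IsTranslation (toAut (σ c * σ d)) _ _ _ := (hσ c).mul (hσ d)
    have h2 := hσ (c + d)
    rw [AddSubgroup.coe_add, map_add] at h2
    have h3 := eq_of_isTranslation_of_inf_center hAZ (hσA (c + d))
      (mul_mem (hσA c) (hσA d)) h2 h1
    rw [h3] at h2
    have h4 := (h2.unique h1).2.1
    rw [eval_map_algebraMap, aeval_algebraMap_apply, ← map_add, ← map_add] at h4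
    exact hinj h4
  obtain ⟨Q, a, s, hQ, -, ha, heq⟩ := exists_quotient_equation (R := R) (translationsFq A)
    (by rw [← Nat.card_eq_fintype_card, card_translationsFq hAZ, hA]) b B hB hb hadd
  exact ⟨Q, a, s, b, B, hall, fun c => ⟨σ c, hσA c, hσ c⟩, hQ, ha, heq⟩

omit [CharP F p] in
/-- The constant term `-a s ^ 2` of the quotient equation is of the form `η ^ p - η` over `𝔽_q`: the
point `x₀` with `π(x₀) = -s` belongs to `W`. -/
theorem exists_pow_sub_eq_neg [IsAlgClosed k] (V : AddSubgroup (R.Fq k)) [Fintype V]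
    (hV : Fintype.card V = p ^ h) {Q : (R.Fq k)[X]} {a s : R.Fq k}
    (hQ : X * R.polyOver (R.Fq k) + (Q ^ p - Q) =
      C a * (V.vanishingPoly + C s) ^ 2 - C (a * s ^ 2)) :
    ∃ η : R.Fq k, η ^ p - η = -(a * s ^ 2) := by
  have h2 := two_ne_zero_of_charP p (R.Fq k)
  have hinj := (algebraMap (R.Fq k) k).injective
  have hodd : Odd (Fintype.card V) := by
    rw [hV]; exact (hp.out.odd_of_ne_two hp2.out).pow
  set Vk : AddSubgroup k := V.map (algebraMap (R.Fq k) k).toAddMonoidHom with hVk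
  set e := V.equivMapOfInjective (algebraMap (R.Fq k) k).toAddMonoidHom hinj
  let _ : Fintype Vk := Fintype.ofEquiv V e.toEquiv
  have hπ : V.vanishingPoly.map (algebraMap (R.Fq k) k) = Vk.vanishingPoly := by
    unfold AddSubgroup.vanishingPoly
    rw [Polynomial.map_prod]
    refine Fintype.prod_equiv e.toEquiv _ _ fun c => ?_
    rw [Polynomial.map_sub, map_X, map_C]
    rfl
  obtain ⟨t, ht⟩ : ∃ t : k, Vk.vanishingPoly.eval t = -algebraMap (R.Fq k) k s := by
    obtain ⟨t, ht⟩ := IsAlgClosed.exists_root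
      (Vk.vanishingPoly + C (algebraMap (R.Fq k) k s)) (by
        have h1 : 0 < Vk.vanishingPoly.degree := by
          rw [← natDegree_pos_iff_degree_pos, AddSubgroup.natDegree_vanishingPoly]
          exact Fintype.card_pos
        rw [degree_add_C h1]
        exact h1.ne')
    exact ⟨t, by
      rw [IsRoot.def, Polynomial.eval_add, eval_C] at ht
      exact eq_neg_of_add_eq_zero_left ht⟩
  have hQk := congrArg (Polynomial.map (algebraMap (R.Fq k) k)) hQ
  simp only [Polynomial.map_sub, Polynomial.map_pow, Polynomial.map_add, Polynomial.map_mul,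
    map_C, map_X, polyOver_map, hπ] at hQk
  rw [map_mul, map_pow] at hQk
  have hE : t ∈ R.W k := aeval_E_eq_zero_of_quotient_equation
    (by rw [← hπ, ← map_X (algebraMap (R.Fq k) k), ← Polynomial.map_neg, ← Polynomial.map_comp,
      V.vanishingPoly_comp_neg_X hodd, Polynomial.map_neg])
    (Vk.vanishingPoly_comp t) ht hQk
  set t' : R.Fq k := ⟨t, IntermediateField.subset_adjoin _ _ hE⟩
  have htt : algebraMap (R.Fq k) k t' = t := rfl
  have hπt : V.vanishingPoly.eval t' = -s := by
    apply hinj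
    rw [map_neg, ← ht, ← hπ, ← htt, eval_map_algebraMap, aeval_algebraMap_apply, coe_aeval_eq_eval]
  have hE' : aeval t' R.E = 0 := by
    apply hinj
    rw [← aeval_algebraMap_apply, htt, map_zero]
    exact hE
  have hB := congrArg (Polynomial.eval t') ((isB_iff R).1 (isB_bPoly R hE')).2
  have hQt := congrArg (Polynomial.eval t') hQ
  simp only [Polynomial.eval_sub, Polynomial.eval_pow, Polynomial.eval_add, eval_mul, eval_C,
    eval_X, hπt] at hB hQt
  refine ⟨(R.bPoly t').eval t' / 2 + Q.eval t', ?_⟩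
  rw [add_pow_char, div_pow, two_pow_char]
  field_simp
  linear_combination hB + 2 * hQt

/-- A subgroup of `P` of order `p ^ h` that intersects the center trivially has the same image in `W`
as every abelian subgroup of `P` that contains it. -/
theorem translations_eq_of_le [PerfectField k] [PerfectField (R.Fq k)] {A 𝒜 : Subgroup P}
    (hA𝒜 : A ≤ 𝒜) (hcomm : ∀ σ ∈ 𝒜, ∀ τ ∈ 𝒜, σ * τ = τ * σ)
    [Fintype (translationsFq A)] {Q : (R.Fq k)[X]} {a s : R.Fq k} (ha : a ≠ 0)
    {b : translationsFq A → R.Fq k} {B : translationsFq A → (R.Fq k)[X]}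
    (hB : ∀ c : translationsFq A, ∃ σ ∈ A, IsTranslation (toAut σ) (algebraMap (R.Fq k) k c)
        (algebraMap (R.Fq k) k (b c)) ((B c).map (algebraMap (R.Fq k) k)))
    (hQB : ∀ c : translationsFq A, Q.comp (X + C (c : R.Fq k)) = Q - (B c + C (b c)))
    (hQ : X * R.polyOver (R.Fq k) + (Q ^ p - Q) =
        C a * ((translationsFq A).vanishingPoly + C s) ^ 2 - C (a * s ^ 2)) :
    translations 𝒜 = translations A := by
  have hinj := (algebraMap (R.Fq k) k).injective
  refine Set.Subset.antisymm (fun c hc => ?_) fun c ⟨σ, hσ, h⟩ => ⟨σ, hA𝒜 hσ, h⟩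
  obtain ⟨τ, hτ𝒜, e, D, hτ⟩ := mem_translations_iff.1 hc
  obtain ⟨c, e, D, rfl, rfl, rfl, hD, he⟩ := hτ.exists_over_Fq
  refine mem_translationsFq_iff.1 (mem_of_comp_eq (translationsFq A) ha hQ hD he fun d => ?_)
  obtain ⟨σ, hσA, hσ⟩ := hB d
  have h1 := (commute_iff hσ hτ).1 (hcomm σ (hA𝒜 hσA) τ hτ𝒜)
  rw [eval_map_algebraMap, eval_map_algebraMap, aeval_algebraMap_apply, aeval_algebraMap_apply,
    coe_aeval_eq_eval, coe_aeval_eq_eval] at h1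
  have h1 := congrArg (C : R.Fq k → (R.Fq k)[X]) (hinj h1)
  have hBd : R.IsB (d : R.Fq k) (B d) := by
    obtain ⟨c', b', B', hc', -, hB', hB'', -⟩ := hσ.exists_over_Fq
    rw [← Polynomial.map_injective _ hinj hB', ← hinj hc']
    exact hB''
  have h2 := congrArg (fun g => g.comp (X + C c)) (hQB d)
  simp only [comp_assoc, add_comp, sub_comp, X_comp, C_comp, hBd.comp] at h2
  have h3 : (X + C c + C (d : R.Fq k) : (R.Fq k)[X]) = X + C (d : R.Fq k) + C c := by ring
  rw [h3] at h2
  rw [sub_comp, add_comp, add_comp, hD.comp, C_comp, comp_assoc, add_comp, X_comp, C_comp, h2,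
    hQB d]
  linear_combination h1

end AdditivePolynomial

namespace AdditivePolynomial

variable {p h : ℕ} [hp : Fact p.Prime] [hp2 : Fact (p ≠ 2)] {F : Type*} [Field F] [CharP F p]
  {R : AdditivePolynomial p h F} {k : Type*} [Field k] [Algebra F k]
  {P : Sylow p (R.aut0 k)} [CharP k p] [CharP (R.Fq k) p]

omit [CharP k p] [CharP (R.Fq k) p] in
theorem IsTranslation.apply_aeval_x_Fq {σ : R.FunctionField k ≃ₐ[k] R.FunctionField k}
    {c : R.Fq k} {b : k} {B : k[X]} (hσ : IsTranslation σ (algebraMap (R.Fq k) k c) b B)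
    (g : (R.Fq k)[X]) : σ (aeval (R.x k) g) = aeval (R.x k) (g.comp (X + C c)) := by
  rw [← aeval_map_algebraMap k, hσ.apply_aeval_x, ← aeval_map_algebraMap k (R.x k) (g.comp _),
    Polynomial.map_comp]
  simp

omit [CharP k p] [CharP (R.Fq k) p] in
theorem transcendental_x_Fq : Transcendental (R.Fq k) (R.x k) := by
  rw [transcendental_iff_injective]
  intro f g h
  rw [← aeval_map_algebraMap k, ← aeval_map_algebraMap k (R.x k) g] at h
  exact Polynomial.map_injective _ (algebraMap (R.Fq k) k).injective (aeval_x_injective h)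

omit [CharP (R.Fq k) p] in
/-- The function field of the quotient curve is generated by `(π(x) + s) / e` and
`y + Q(x) - η`. -/
theorem adjoin_eq_quotientField {A : Subgroup P} [Fintype (translationsFq A)] {Q : (R.Fq k)[X]}
    {b : translationsFq A → R.Fq k} {B : translationsFq A → (R.Fq k)[X]}
    (hall : ∀ σ ∈ A, ∃ c : translationsFq A, IsTranslation (toAut σ) (algebraMap (R.Fq k) k c)
        (algebraMap (R.Fq k) k (b c)) ((B c).map (algebraMap (R.Fq k) k)))
    (hB : ∀ c : translationsFq A, ∃ σ ∈ A, IsTranslation (toAut σ) (algebraMap (R.Fq k) k c)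
        (algebraMap (R.Fq k) k (b c)) ((B c).map (algebraMap (R.Fq k) k)))
    (hQB : ∀ c : translationsFq A, Q.comp (X + C (c : R.Fq k)) = Q - (B c + C (b c)))
    {e s η : R.Fq k} (he : e ≠ 0) :
    IntermediateField.adjoin (R.Fq k)
      {aeval (R.x k) (C e⁻¹ * ((translationsFq A).vanishingPoly + C s)),
        R.y k + aeval (R.x k) (Q - C η)} = quotientField A := by
  set w := aeval (R.x k) (C e⁻¹ * ((translationsFq A).vanishingPoly + C s)) with hw
  set u := R.y k + aeval (R.x k) (Q - C η) with hu
  have hle : IntermediateField.adjoin (R.Fq k) {w, u} ≤ quotientField A := by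
    rw [IntermediateField.adjoin_le_iff]
    rintro z (rfl | rfl)
    · refine mem_quotientField_iff.2
        ⟨IntermediateField.aeval_mem_of_mem _ x_mem_fieldOverFq _, fun σ hσ => ?_⟩
      obtain ⟨c, hc⟩ := hall σ hσ
      rw [hw, hc.apply_aeval_x_Fq]
      simp only [mul_comp, add_comp, C_comp, (translationsFq A).vanishingPoly_comp_of_mem c]
    · refine mem_quotientField_iff.2 ⟨add_mem y_mem_fieldOverFq
        (IntermediateField.aeval_mem_of_mem _ x_mem_fieldOverFq _), fun σ hσ => ?_⟩
      obtain ⟨c, hc⟩ := hall σ hσ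
      rw [hu, map_add, hc.apply_aeval_x_Fq, hc.apply_y, sub_comp, hQB, C_comp,
        aeval_map_algebraMap, ← IsScalarTower.algebraMap_apply]
      simp only [map_sub, map_add, aeval_C]
      ring
  refine le_antisymm hle fun z hz => ?_
  set M := IntermediateField.adjoin (R.Fq k) {w, u} with hM
  have hwM : w ∈ M := IntermediateField.subset_adjoin _ _ (by simp)
  have huM : u ∈ M := IntermediateField.subset_adjoin _ _ (by simp)
  -- the element `π(x)` belongs to `M`
  have hπM : aeval (R.x k) (translationsFq A).vanishingPoly ∈ M := by
    have h1 : aeval (R.x k) (translationsFq A).vanishingPoly =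
        algebraMap (R.Fq k) _ e * w - algebraMap (R.Fq k) _ s := by
      rw [hw, map_mul, aeval_C, map_add, aeval_C, ← mul_assoc, ← map_mul, mul_inv_cancel₀ he,
        map_one]
      ring
    rw [h1]
    exact sub_mem (mul_mem (M.algebraMap_mem _) hwM) (M.algebraMap_mem _)
  obtain ⟨hzF, hzA⟩ := mem_quotientField_iff.1 hz
  have hzx : z ∈ IntermediateField.adjoin M {R.x k} := by
    have h1 : R.fieldOverFq k ≤
        (IntermediateField.adjoin M {R.x k}).restrictScalars (R.Fq k) := by
      have hx : R.x k ∈ (IntermediateField.adjoin M {R.x k}).restrictScalars (R.Fq k) :=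
        IntermediateField.mem_adjoin_simple_self M (R.x k)
      have hu' : u ∈ (IntermediateField.adjoin M {R.x k}).restrictScalars (R.Fq k) :=
        (IntermediateField.adjoin M {R.x k}).algebraMap_mem ⟨u, huM⟩
      rw [fieldOverFq, IntermediateField.adjoin_le_iff]
      rintro v (rfl | rfl)
      · exact hx
      · have h2 : R.y k = u - aeval (R.x k) (Q - C η) := by rw [hu]; ring
        rw [h2]
        exact sub_mem hu' (IntermediateField.aeval_mem_of_mem _ hx _)
    exact h1 hzF
  have hcard : 0 < Fintype.card (translationsFq A) := Fintype.card_pos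
  set m : M[X] := (translationsFq A).vanishingPoly.map (algebraMap (R.Fq k) M) -
    C ⟨aeval (R.x k) (translationsFq A).vanishingPoly, hπM⟩ with hm
  have hVm : ((translationsFq A).vanishingPoly.map (algebraMap (R.Fq k) M)).Monic :=
    (translationsFq A).monic_vanishingPoly.map _
  have hdV : ((translationsFq A).vanishingPoly.map (algebraMap (R.Fq k) M)).natDegree =
      Fintype.card (translationsFq A) := by
    rw [natDegree_map, (translationsFq A).natDegree_vanishingPoly]
  refine M.mem_of_forall_apply_eq (m := m) ?_ ?_
    (Finset.univ.map ⟨fun c : translationsFq A => R.x k + algebraMap (R.Fq k) _ (c : R.Fq k), ?_⟩)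
    ?_ hzx ?_
  · apply hVm.sub_of_left
    refine lt_of_le_of_lt degree_C_le ?_
    rw [← natDegree_pos_iff_degree_pos, hdV]
    exact hcard
  · rw [hm, map_sub, aeval_map_algebraMap, aeval_C]
    exact sub_self _
  · intro c d hcd
    exact Subtype.ext ((algebraMap (R.Fq k) (R.FunctionField k)).injective
      (add_left_cancel hcd))
  · rw [Finset.card_map, Finset.card_univ, hm, natDegree_sub_C, hdV]
  · intro t ht
    obtain ⟨c, -, rfl⟩ := Finset.mem_map.1 ht
    obtain ⟨σ, hσ, hc⟩ := hB c
    refine ⟨(toAut σ : R.FunctionField k →ₐ[k] R.FunctionField k),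
      fun v hv => (mem_quotientField_iff.1 (hle hv)).2 σ hσ, ?_, hzA σ hσ⟩
    change toAut σ (R.x k) = R.x k + algebraMap (R.Fq k) _ (c : R.Fq k)
    rw [hc.apply_x, ← IsScalarTower.algebraMap_apply]

/-- The quotient curve is the curve `Y ^ p - Y = a e ^ 2 X ^ 2`. -/
theorem nonempty_algEquiv_quotientField {A : Subgroup P} [Fintype (translationsFq A)]
    {Q : (R.Fq k)[X]} {b : translationsFq A → R.Fq k} {B : translationsFq A → (R.Fq k)[X]}
    (hall : ∀ σ ∈ A, ∃ c : translationsFq A, IsTranslation (toAut σ) (algebraMap (R.Fq k) k c)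
        (algebraMap (R.Fq k) k (b c)) ((B c).map (algebraMap (R.Fq k) k)))
    (hB : ∀ c : translationsFq A, ∃ σ ∈ A, IsTranslation (toAut σ) (algebraMap (R.Fq k) k c)
        (algebraMap (R.Fq k) k (b c)) ((B c).map (algebraMap (R.Fq k) k)))
    (hQB : ∀ c : translationsFq A, Q.comp (X + C (c : R.Fq k)) = Q - (B c + C (b c)))
    {a e s η : R.Fq k} (ha : a ≠ 0) (he : e ≠ 0)
    (hQ : X * R.polyOver (R.Fq k) + (Q ^ p - Q) =
        C a * ((translationsFq A).vanishingPoly + C s) ^ 2 - C (a * s ^ 2))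
    (hη : η ^ p - η = -(a * s ^ 2)) :
    Nonempty (quotientField A ≃ₐ[R.Fq k]
      ArtinSchreierField p (C (a * e ^ 2) * X ^ 2 : (R.Fq k)[X])) := by
  have hcharL : CharP (R.FunctionField k) p :=
    charP_of_injective_algebraMap (algebraMap k (R.FunctionField k)).injective p
  set g := C e⁻¹ * ((translationsFq A).vanishingPoly + C s) with hg
  set w := aeval (R.x k) g with hw
  set u := R.y k + aeval (R.x k) (Q - C η) with hu
  have htr : Transcendental (R.Fq k) w := by
    refine transcendental_x_Fq.aeval g ?_ ?_
    · rw [hg, natDegree_C_mul (inv_ne_zero he), natDegree_add_C,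
        (translationsFq A).natDegree_vanishingPoly]
      exact Fintype.card_ne_zero
    · exact mem_nonZeroDivisors_of_ne_zero (leadingCoeff_ne_zero.2 (by
        rw [hg]
        refine mul_ne_zero (C_ne_zero.2 (inv_ne_zero he)) fun h0 => ?_
        have h1 := congrArg natDegree h0
        rw [natDegree_add_C, (translationsFq A).natDegree_vanishingPoly, natDegree_zero] at h1
        exact Fintype.card_ne_zero h1))
  have heq : u ^ p - u = aeval w (C (a * e ^ 2) * X ^ 2 : (R.Fq k)[X]) := by
    have h1 : (Q - C η) ^ p - (Q - C η) + X * R.polyOver (R.Fq k) =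
        C (a * e ^ 2) * g ^ 2 := by
      have h2 : C (a * e ^ 2) * g ^ 2 = C a * ((translationsFq A).vanishingPoly + C s) ^ 2 := by
        have h3 : (C e * C e⁻¹ : (R.Fq k)[X]) = 1 := by rw [← C_mul, mul_inv_cancel₀ he, C_1]
        rw [hg, C_mul, C_pow]
        linear_combination (C a * ((translationsFq A).vanishingPoly + C s) ^ 2) *
          (C e * C e⁻¹ + 1) * h3
      have h4 := congrArg (C : R.Fq k → (R.Fq k)[X]) hη
      rw [h2, sub_pow_char]
      simp only [C_sub, C_pow, C_neg] at h4 ⊢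
      linear_combination hQ - h4
    have h2 := congrArg (aeval (R.x k)) h1
    have h3 := y_pow_sub (R := R) (k := k)
    rw [← polyOver_map (K := R.Fq k), ← map_X (algebraMap (R.Fq k) k), ← Polynomial.map_mul,
      aeval_map_algebraMap] at h3
    rw [map_add, map_sub, map_pow, ← h3, map_mul, map_pow, aeval_C] at h2
    rw [map_mul, map_pow, aeval_C, aeval_X, hu, add_pow_char]
    linear_combination h2
  have hirr : Fact (Irreducible (artinSchreierPoly p (C (a * e ^ 2) * X ^ 2 : (R.Fq k)[X]))) := by
    refine ⟨irreducible_artinSchreierPoly ?_⟩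
    rw [natDegree_C_mul_X_pow _ _ (mul_ne_zero ha (pow_ne_zero 2 he))]
    exact fun h => hp2.out ((Nat.prime_dvd_prime_iff_eq hp.out Nat.prime_two).1 h)
  obtain ⟨φ, hφx, hφy⟩ := ArtinSchreierField.exists_algHom htr heq
  have hrange : φ.fieldRange = quotientField A := by
    rw [← adjoin_eq_quotientField hall hB hQB he (s := s) (η := η), AlgHom.fieldRange_eq_map,
      ← ArtinSchreierField.adjoin_eq_top, IntermediateField.adjoin_map, Set.image_pair, hφx, hφy]
  have ψ : ArtinSchreierField p (C (a * e ^ 2) * X ^ 2 : (R.Fq k)[X]) ≃ₐ[R.Fq k] φ.fieldRange :=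
    AlgEquiv.ofInjectiveField φ
  exact ⟨(ψ.trans (IntermediateField.equivOfEq hrange)).symm⟩

end AdditivePolynomial

theorem mainTheorem3 {p h : ℕ} [Fact p.Prime] [Fact (p ≠ 2)]
    {F : Type*} [Field F] [Finite F] [CharP F p]
    {k : Type*} [Field k] [Algebra F k] [IsAlgClosure F k]
    (R : AdditivePolynomial p h F)
    (P : Sylow p (R.aut0 k))
    (𝒜 : Subgroup P) (h𝒜 : Maximal (fun H : Subgroup P => IsMulCommutative H) 𝒜)
    (A : Subgroup P) (hA𝒜 : A ≤ 𝒜) (hA : Nat.card A = p ^ h)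
    (hAZ : A ⊓ Subgroup.center P = ⊥) :
    (∃ V : AddSubgroup k, (V : Set k) = AdditivePolynomial.translations 𝒜 ∧
      Maximal R.IsIsotropic V) ∧
    (∀ σ ∈ A, ∀ z ∈ R.fieldOverFq k,
      ((σ : R.aut0 k) : R.FunctionField k ≃ₐ[k] R.FunctionField k) z ∈ R.fieldOverFq k) ∧
    ∃ a : R.Fq k, (a : k) = AdditivePolynomial.aConst 𝒜 ∧
      Nonempty (AdditivePolynomial.quotientField A ≃ₐ[R.Fq k]
        ArtinSchreierField p (C a * X ^ 2 : (R.Fq k)[X])) := by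
  have hp : Fact p.Prime := inferInstance
  have hp2 : Fact (p ≠ 2) := inferInstance
  have : IsAlgClosed k := IsAlgClosure.isAlgClosed F
  have : Algebra.IsAlgebraic F k := IsAlgClosure.isAlgebraic
  have : CharP k p := charP_of_injective_algebraMap (algebraMap F k).injective p
  have : CharP (R.Fq k) p := charP_of_injective_algebraMap (algebraMap F (R.Fq k)).injective p
  have : PerfectField (R.Fq k) := Algebra.IsAlgebraic.perfectField F
  have hinj := (algebraMap (R.Fq k) k).injective
  refine ⟨⟨_, rfl, AdditivePolynomial.maximal_isIsotropic_translations h𝒜⟩, ?_, ?_⟩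
  · intro σ _ z hz
    obtain ⟨c, b, B, hσ⟩ := AdditivePolynomial.exists_isTranslation_toAut σ
    exact hσ.apply_mem_fieldOverFq hz
  have hcard : Nat.card (AdditivePolynomial.translationsFq A) = p ^ h := by
    rw [AdditivePolynomial.card_translationsFq hAZ, hA]
  have : Finite (AdditivePolynomial.translationsFq A) :=
    Nat.finite_of_card_ne_zero (by rw [hcard]; exact (pow_pos hp.out.pos h).ne')
  let _ : Fintype (AdditivePolynomial.translationsFq A) := Fintype.ofFinite _
  rw [Nat.card_eq_fintype_card] at hcard
  obtain ⟨Q, a, s, b, B, hall, hB, hQB, ha, hQ⟩ :=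
    AdditivePolynomial.exists_quotient_equation_over_Fq hAZ hA
  obtain ⟨η, hη⟩ := AdditivePolynomial.exists_pow_sub_eq_neg _ hcard hQ
  set e := (AdditivePolynomial.translationsFq A).slope with he
  have he0 : e ≠ 0 := AddSubgroup.slope_ne_zero _
  have hlast : R.coeffOver (R.Fq k) h ≠ 0 := by
    rw [AdditivePolynomial.coeffOver_last]
    exact (_root_.map_ne_zero _).2 R.coeff_last_ne_zero
  have ha0 : a ≠ 0 := by
    rintro rfl
    rw [zero_mul] at ha
    split_ifs at ha with hh
    · subst hh
      exact hlast ha.symm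
    · exact mul_ne_zero (div_ne_zero hlast (AdditivePolynomial.two_ne_zero_of_charP p _)) he0
        ha.symm
  have hcomm : ∀ σ ∈ 𝒜, ∀ τ ∈ 𝒜, σ * τ = τ * σ := fun σ hσ τ hτ =>
    congrArg Subtype.val (h𝒜.prop.is_comm.comm (⟨σ, hσ⟩ : 𝒜) ⟨τ, hτ⟩)
  refine ⟨a * e ^ 2, ?_, AdditivePolynomial.nonempty_algEquiv_quotientField hall hB hQB ha0 he0
    hQ hη⟩
  rw [ha, AdditivePolynomial.aConst]
  split_ifs with hh
  · subst hh
    change algebraMap (R.Fq k) k (R.coeffOver (R.Fq k) 0) = _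
    simp only [AdditivePolynomial.coeffOver]
    rfl
  · have hodd : Odd (Fintype.card (AdditivePolynomial.translationsFq A)) := by
      rw [hcard]; exact (hp.out.odd_of_ne_two hp2.out).pow
    have h1 : algebraMap (R.Fq k) k e = ∏ᶠ c ∈ AdditivePolynomial.translations 𝒜 \ {0}, c := by
      rw [AdditivePolynomial.translations_eq_of_le hA𝒜 hcomm ha0 hB hQB hQ,
        ← AdditivePolynomial.image_translationsFq A, he, AddSubgroup.slope_eq_finprod _ hodd]
      have h2 : algebraMap (R.Fq k) k '' (AdditivePolynomial.translationsFq A) \ {0} =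
          algebraMap (R.Fq k) k '' ((AdditivePolynomial.translationsFq A : Set (R.Fq k)) \ {0}) := by
        rw [Set.image_sdiff hinj, Set.image_singleton, map_zero]
      rw [h2, finprod_mem_image hinj.injOn]
      exact MonoidHom.map_finprod_mem (fun c => c) (algebraMap (R.Fq k) k).toMonoidHom
        (Set.Finite.sdiff (Set.toFinite _))
    change algebraMap (R.Fq k) k (R.coeffOver (R.Fq k) h / 2 * e) = _
    rw [map_mul, map_div₀, map_ofNat, h1, AdditivePolynomial.coeffOver_last]
    rfl
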